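/- **Setting.** Let $(\Omega,\mathcal F,(\mathcal F_t),P)$ be a filtered probability space with a totally ordered time set that has a last element $T$, and $\mathcal F_T=\mathcal F$. Let $p,q\in[1,\infty]$ with $\frac1p+\frac1q=1$ and $1\le m\le d$. Let $M=\mathbb R^m\times\{0\}^{d-m}$, $M_+=M\cap\mathbb R^d_+$, $M^\perp$ its orthogonal space, and for $C\subseteq\mathbb R^d$ let $C^+=\{v: v^{\mathsf T}u\ge0\ \forall u\in C\}$. For a (random) set $D$, $L^p_t(D)$ is the set of classes of $\mathcal F_t$-measurable, $p$-integrable (essentially bounded if $p=\infty$) random vectors with values a.s. in $D$; $L^p=L^p_T(\mathbb R^d)$, $M_t=L^p_t(M)$, $M_{t,+}=L^p_t(M_+)$, $M_{t,-}=-M_{t,+}$, and $M_{s,+}^+=\{f\in L^q_s(\mathbb R^d): E[f^{\mathsf T}u]\ge0\ \forall u\in M_{s,+}\}$. $L^p$ carries the norm topology if $p<\infty$ and the weak* topology $\sigma(L^\infty,L^1)$ if $p=\infty$. Let $R_t:L^p\to 2^{M_t}$ be a conditional risk measure: $R_t(X)=R_t(X)+M_{t,+}$; $R_t(X)\subseteq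 R_t(Y)$ whenever $Y-X\ge0$ a.s.; $R_t(X+k)=R_t(X)-k$ for $k\in M_t$; and $R_t(0)$ is non-empty, closed, $\mathcal F_t$-decomposable and equal to $L^p_t(\tilde R_t(0))$ for an $\mathcal F_t$-measurable random closed set $\tilde R_t(0)$ with $P(\tilde R_t(0)=M)=0$. Assume moreover that $R_t$ is - normalized: $R_t(X)=R_t(X)+R_t(0)$ for all $X$; - conditionally convex: $R_t(\lambda X+(1-\lambda)Y)\supseteq\lambda R_t(X)+(1-\lambda)R_t(Y)$ for all $X,Y$ and all $\mathcal F_t$-measurable $\lambda$ with values in $[0,1]$; - convex upper continuous: $\{X: R_t(X)\cap D\neq\emptyset\}$ is closed for every $D\subseteq M_t$ with $D=\operatorname{cl}\operatorname{co}(D+M_{t,-})$. Let $A_t=\{X\in L^p: 0\in R_t(X)\}$ and $\rho_t^w(X)=\operatorname{ess\,inf}\{w^{\mathsf T}u: u\in R_t(X)\}$, and assume that $\rho_t^v(X)$ is integrable for all $X\in L^p$ and $v\in L^q_t(\tilde R_t(0)^+\setminus M^\perp)$. **Dual variables.** Let $\mathcal M^d$ be the set of $d$-tuples of probability measures absolutely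 continuous with respect to $P$. For $Q\in\mathcal M^d$ and times $t\le s$, put $w_t^s(Q,w)=\big(w_i\,\bar\xi_{t,s}(Q_i)\big)_{i\le d}$, where $\bar\xi_{t,s}(Q_i)=E[\tfrac{dQ_i}{dP}|\mathcal F_s]\big/E[\tfrac{dQ_i}{dP}|\mathcal F_t]$ if the denominator is positive, and $1$ otherwise. Let $$\mathcal W_{t,s}(w)=\{(Q,m_\perp)\in\mathcal M^d\times L^q_t(M^\perp): w+m_\perp\in L^q_t(M_+^+\setminus M^\perp),\ w_t^s(Q,w+m_\perp)\in M_{s,+}^+\},$$ $$\mathcal W_s(v)=\{(R,n_\perp)\in\mathcal M^d\times L^q_s(M^\perp): v+n_\perp\in M_{s,+}^+,\ w_s^T(R,v+n_\perp)\in L^q_T(\mathbb R^d_+)\}\qquad(v\in M_{s,+}^+),$$ $$\beta_{t,s}^w(Q,m_\perp,R,n_\perp)=\operatorname*{ess\,sup}_{Z\in A_t}E\big[w_s^T(R,w_t^s(Q,w+m_\perp)+n_\perp)^{\mathsf T}(-Z)\,\big|\,\mathcal F_t\big],$$ and let $\widetilde{\mathcal W}_{t,s}(w)$ be the set of all $(Q,m_\perp,R,n_\perp)$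 with $(Q,m_\perp)\in\mathcal W_{t,s}(w)$, $(R,n_\perp)\in\mathcal W_s(w_t^s(Q,w+m_\perp))$ and $E[\beta_{t,s}^w(Q,m_\perp,R,n_\perp)]<+\infty$. Essential suprema over the empty set are $-\infty$. **Proposition.** Let $t\le s$ $(\le T)$, $w\in L^q_t(M_+^+\setminus M^\perp)$ and $X\in L^p$. Then a.s. $$\rho_t^w(X)=\operatorname*{ess\,sup}_{(Q,m_\perp)\in\mathcal W_{t,s}(w)}\ \operatorname*{ess\,sup}_{(R,n_\perp)\in\mathcal W_s(w_t^s(Q,w+m_\perp))}\Big(-\beta_{t,s}^w(Q,m_\perp,R,n_\perp)+E\big[w_s^T(R,w_t^s(Q,w+m_\perp)+n_\perp)^{\mathsf T}(-X)\,\big|\,\mathcal F_t\big]\Big).$$ Moreover, a.s. $$\rho_t^w(X)=\operatorname*{ess\,sup}_{(Q,m_\perp,R,n_\perp)\in\widetilde{\mathcal W}_{t,s}(w)}\Big(-\beta_{t,s}^w(Q,m_\perp,R,n_\perp)+E\big[w_s^T(R,w_t^s(Q,w+m_\perp)+n_\perp)^{\mathsf T}(-X)\,\big|\,\mathcal F_t\big]\Big).$$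 -/

import Mathlib

open MeasureTheory Filter
open scoped ENNReal Pointwise

/-! ### Essential suprema and infima of arbitrary families of extended real random variables -/

section EssentialSupremum

variable {Ω : Type*} {mΩ : MeasurableSpace Ω}

/-- `g` is (a version of) the essential supremum of the family `S`: the `P`-a.s. least measurable
`P`-a.s. upper bound. -/
structure IsFamilyEssSup (P : Measure Ω) (S : Set (Ω → EReal)) (g : Ω → EReal) : Prop where
  measurable : Measurable g
  upper : ∀ f ∈ S, f ≤ᵐ[P] g
  least : ∀ h : Ω → EReal, AEMeasurable h P → (∀ f ∈ S, f ≤ᵐ[P] h) → g ≤ᵐ[P] h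

theorem exists_isFamilyEssSup (P : Measure Ω) [IsProbabilityMeasure P] (S : Set (Ω → EReal)) :
    ∃ g, IsFamilyEssSup P S g := by
  classical
  let φ : EReal → ℝ≥0∞ := fun x => (1 + x.exp)⁻¹
  have hφ : StrictAnti φ := by
    intro a b hab
    refine ENNReal.inv_strictAnti ?_
    exact (ENNReal.add_lt_add_iff_left ENNReal.one_ne_top).2 (EReal.exp_strictMono hab)
  have hφm : Measurable φ := hφ.antitone.measurable
  have hφ1 : ∀ x, φ x ≤ 1 := fun x => by
    simp only [φ, ENNReal.inv_le_one]
    exact le_self_add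
  let U : Set (Ω → EReal) := {h | Measurable h ∧ ∀ f ∈ S, f ≤ᵐ[P] h}
  have hUne : U.Nonempty := ⟨fun _ => ⊤, measurable_const, fun f _ => ae_of_all _ fun _ => le_top⟩
  let I : (Ω → EReal) → ℝ≥0∞ := fun h => ∫⁻ ω, φ (h ω) ∂P
  have hI1 : ∀ h, I h ≤ 1 := fun h => by
    calc I h ≤ ∫⁻ _, 1 ∂P := lintegral_mono fun ω => hφ1 _
      _ = 1 := by simp
  obtain ⟨v, -, hv, hvU⟩ := exists_seq_tendsto_sSup (S := I '' U) (hUne.image I) (OrderTop.bddAbove _)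
  choose u huU huv using hvU
  let g : Ω → EReal := fun ω => ⨅ n, u n ω
  have hgU : g ∈ U := by
    refine ⟨Measurable.iInf fun n => (huU n).1, fun f hf => ?_⟩
    have : ∀ᵐ ω ∂P, ∀ n, f ω ≤ u n ω := ae_all_iff.2 fun n => (huU n).2 f hf
    filter_upwards [this] with ω hω using le_iInf hω
  have hgI : ∀ h ∈ U, I h ≤ I g := by
    intro h hh
    have h1 : I h ≤ sSup (I '' U) := le_sSup ⟨h, hh, rfl⟩
    refine h1.trans (le_of_tendsto' hv fun n => ?_)
    rw [← huv n]
    exact lintegral_mono fun ω => hφ.antitone (iInf_le _ n)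
  refine ⟨g, hgU.1, hgU.2, fun h hh hS => ?_⟩
  let h' := hh.mk h
  have hh' : h =ᵐ[P] h' := hh.ae_eq_mk
  let k : Ω → EReal := fun ω => g ω ⊓ h' ω
  have hkm : Measurable k := hgU.1.inf hh.measurable_mk
  have hkU : k ∈ U := by
    refine ⟨hkm, fun f hf => ?_⟩
    filter_upwards [hgU.2 f hf, hS f hf, hh'] with ω h1 h2 h3
    exact le_inf h1 (h3 ▸ h2)
  have hle : (fun ω => φ (g ω)) ≤ᵐ[P] fun ω => φ (k ω) :=
    ae_of_all _ fun ω => hφ.antitone inf_le_left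
  have heq : (fun ω => φ (g ω)) =ᵐ[P] fun ω => φ (k ω) :=
    ae_eq_of_ae_le_of_lintegral_le hle (ne_top_of_le_ne_top ENNReal.one_ne_top (hI1 g))
      (hφm.comp hkm).aemeasurable (hgI k hkU)
  filter_upwards [heq, hh'] with ω h1 h2
  have h3 : g ω = g ω ⊓ h' ω := hφ.injective h1
  rw [h2]
  exact inf_eq_left.1 h3.symm

open Classical in
/-- The essential supremum `ess sup S` of a family of extended real random variables. It always
exists when `P` is a probability measure (`isFamilyEssSup_familyEssSup`) and is `P`-a.s. unique. -/
noncomputable def familyEssSup (P : Measure Ω) (S : Set (Ω → EReal)) : Ω → EReal :=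
  if h : ∃ g, IsFamilyEssSup P S g then h.choose else fun _ => ⊤

theorem isFamilyEssSup_familyEssSup (P : Measure Ω) [IsProbabilityMeasure P]
    (S : Set (Ω → EReal)) : IsFamilyEssSup P S (familyEssSup P S) := by
  have h := exists_isFamilyEssSup P S
  rw [familyEssSup, dif_pos h]
  exact h.choose_spec

/-- The essential infimum `ess inf S = -ess sup (-S)`. -/
noncomputable def familyEssInf (P : Measure Ω) (S : Set (Ω → EReal)) : Ω → EReal :=
  fun ω => -familyEssSup P {f | ∃ g ∈ S, f = fun ω' => -g ω'} ω

end EssentialSupremum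

namespace RiskMeasure

/-! ### Random vectors and the eligible portfolios

Random vectors that are arguments of a risk measure are elements of Mathlib's `Lp` (equivalence
classes); dual variables are represented by functions, to be read up to `P`-a.s. equality. -/

section Definitions

variable {Ω : Type*} {mΩ : MeasurableSpace Ω} {ι : Type*} [LinearOrder ι] {d : ℕ}

/-- `f` represents an element of `L^p_t(D)`: it is `ℱ t`-measurable (up to a null set), has finite
`p`-norm, and takes a.s. values in the random set `D`. -/
def MemLt (P : Measure Ω) (ℱ : Filtration ι mΩ) (p : ℝ≥0∞) (t : ι) (D : Ω → Set (Fin d → ℝ))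
    (f : Ω → Fin d → ℝ) : Prop :=
  AEStronglyMeasurable[ℱ t] f P ∧ MemLp f p P ∧ ∀ᵐ ω ∂P, f ω ∈ D ω

/-- The set `L^p_t(D)` of equivalence classes, as a subset of `L^p`. -/
def Lt (P : Measure Ω) (ℱ : Filtration ι mΩ) (p : ℝ≥0∞) (t : ι) (D : Ω → Set (Fin d → ℝ)) :
    Set (Lp (Fin d → ℝ) p P) :=
  {X | MemLt P ℱ p t D X}

/-- The eligible portfolios `M = ℝ^m × {0}^(d-m)`. -/
def eligible (d m : ℕ) : Set (Fin d → ℝ) := {x | ∀ i : Fin d, m ≤ (i : ℕ) → x i = 0}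

/-- `M_+ = M ∩ ℝ^d_+`. -/
def eligiblePos (d m : ℕ) : Set (Fin d → ℝ) := {x | x ∈ eligible d m ∧ 0 ≤ x}

/-- The positive dual cone `C^+` of a subset `C` of `ℝ^d`. -/
def dualCone (C : Set (Fin d → ℝ)) : Set (Fin d → ℝ) := {v | ∀ u ∈ C, 0 ≤ v ⬝ᵥ u}

/-- The orthogonal space `C^⊥` of a subset `C` of `ℝ^d`. -/
def orth (C : Set (Fin d → ℝ)) : Set (Fin d → ℝ) := {v | ∀ u ∈ C, v ⬝ᵥ u = 0}

/-- `M_t = L^p_t(M)`. -/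
def Mt (P : Measure Ω) (ℱ : Filtration ι mΩ) (p : ℝ≥0∞) (m : ℕ) (t : ι) :
    Set (Lp (Fin d → ℝ) p P) :=
  Lt P ℱ p t fun _ => eligible d m

/-- `M_{t,+} = L^p_t(M_+)`. -/
def MtPos (P : Measure Ω) (ℱ : Filtration ι mΩ) (p : ℝ≥0∞) (m : ℕ) (t : ι) :
    Set (Lp (Fin d → ℝ) p P) :=
  Lt P ℱ p t fun _ => eligiblePos d m

open Classical in
/-- The topology used on `L^p`: the norm topology for `p < ∞`, and for `p = ∞` the weak* topology,
i.e. the coarsest one that makes `X ↦ E[YᵀX]` continuous for every `Y ∈ L^1`. -/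
@[reducible] noncomputable def lpTopology (P : Measure Ω) (p : ℝ≥0∞) [Fact (1 ≤ p)] :
    TopologicalSpace (Lp (Fin d → ℝ) p P) :=
  if p = ∞ then
    TopologicalSpace.induced
      (fun (X : Lp (Fin d → ℝ) p P) (Y : Lp (Fin d → ℝ) 1 P) => ∫ ω, Y ω ⬝ᵥ X ω ∂P)
      Pi.topologicalSpace
  else inferInstance

/-- `𝒢(M_t; M_{t,-})`: the sets `D ⊆ M_t` with `D = cl co (D + M_{t,-})`, where
`M_{t,-} = -M_{t,+}`. -/
def lowerClosedConvex (P : Measure Ω) (ℱ : Filtration ι mΩ) (p : ℝ≥0∞) [Fact (1 ≤ p)] (m : ℕ)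
    (t : ι) : Set (Set (Lp (Fin d → ℝ) p P)) :=
  {D | D ⊆ Mt P ℱ p m t ∧
    D = @closure _ (lpTopology P p) (convexHull ℝ (D + -MtPos P ℱ p m t))}

/-! ### Set-valued conditional risk measures -/

/-- `ℱ t`-decomposability: `1_B X + 1_{Bᶜ} Y ∈ S` for `X, Y ∈ S` and `B ∈ ℱ t`. -/
def Decomposable (P : Measure Ω) (ℱ : Filtration ι mΩ) {p : ℝ≥0∞} (t : ι)
    (S : Set (Lp (Fin d → ℝ) p P)) : Prop :=
  ∀ B : Set Ω, MeasurableSet[ℱ t] B → ∀ X ∈ S, ∀ Y ∈ S, ∀ Z : Lp (Fin d → ℝ) p P,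
    (Z =ᵐ[P] fun ω => B.indicator X ω + Bᶜ.indicator Y ω) → Z ∈ S

/-- An `ℱ t`-measurable random closed set: closed values, and `{K ∩ G ≠ ∅} ∈ ℱ t` for every open
`G`. -/
structure IsRandomClosedSet (ℱ : Filtration ι mΩ) (t : ι) (K : Ω → Set (Fin d → ℝ)) : Prop where
  closed : ∀ ω, IsClosed (K ω)
  measurable : ∀ G : Set (Fin d → ℝ), IsOpen G → MeasurableSet[ℱ t] {ω | (K ω ∩ G).Nonempty}

/-- `R` is a conditional risk measure at time `t`, and `R0` is the random set `R̃_t(0)` with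
`R_t(0) = L^p_t(R̃_t(0))`. -/
structure IsConditionalRiskMeasure (P : Measure Ω) (ℱ : Filtration ι mΩ) (p : ℝ≥0∞)
    [Fact (1 ≤ p)] (m : ℕ) (t : ι) (R : Lp (Fin d → ℝ) p P → Set (Lp (Fin d → ℝ) p P))
    (R0 : Ω → Set (Fin d → ℝ)) : Prop where
  subset_eligible : ∀ X, R X ⊆ Mt P ℱ p m t
  upper : ∀ X, R X = R X + MtPos P ℱ p m t
  monotone : ∀ X Y : Lp (Fin d → ℝ) p P, (∀ᵐ ω ∂P, 0 ≤ (Y - X : Lp (Fin d → ℝ) p P) ω) → R X ⊆ R Y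
  translative : ∀ X, ∀ k ∈ Mt P ℱ p m t, R (X + k) = (fun u => u - k) '' R X
  nonempty_zero : (R 0).Nonempty
  closed_zero : @IsClosed _ (lpTopology P p) (R 0)
  decomposable_zero : Decomposable P ℱ t (R 0)
  randomSet : IsRandomClosedSet ℱ t R0
  zero_eq : R 0 = Lt P ℱ p t R0
  ne_eligible : ∀ᵐ ω ∂P, R0 ω ≠ eligible d m

/-- `R_t(X) = R_t(X) + R_t(0)` for every `X`. -/
def Normalized {P : Measure Ω} {p : ℝ≥0∞}
    (R : Lp (Fin d → ℝ) p P → Set (Lp (Fin d → ℝ) p P)) : Prop :=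
  ∀ X, R X = R X + R 0

/-- Conditional convexity: `R_t(λX + (1-λ)Y) ⊇ λR_t(X) + (1-λ)R_t(Y)` for `ℱ t`-measurable
`λ` with values in `[0,1]`. Here `Z` is the class of `λX + (1-λ)Y` and `z` the class of
`λu + (1-λ)v`. -/
def ConditionallyConvex {P : Measure Ω} (ℱ : Filtration ι mΩ) {p : ℝ≥0∞} (t : ι)
    (R : Lp (Fin d → ℝ) p P → Set (Lp (Fin d → ℝ) p P)) : Prop :=
  ∀ (X Y Z : Lp (Fin d → ℝ) p P) (l : Ω → ℝ), AEStronglyMeasurable[ℱ t] l P →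
    (∀ᵐ ω ∂P, l ω ∈ Set.Icc (0 : ℝ) 1) →
    (Z =ᵐ[P] fun ω => l ω • X ω + (1 - l ω) • Y ω) →
    ∀ u ∈ R X, ∀ v ∈ R Y, ∀ z : Lp (Fin d → ℝ) p P,
      (z =ᵐ[P] fun ω => l ω • u ω + (1 - l ω) • v ω) → z ∈ R Z

/-- Convex upper continuity: `{X | R_t(X) ∩ D ≠ ∅}` is closed for every closed
`D ∈ 𝒢(M_t; M_{t,-})`. -/
def ConvexUpperContinuous {P : Measure Ω} (ℱ : Filtration ι mΩ) {p : ℝ≥0∞} [Fact (1 ≤ p)] (m : ℕ)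
    (t : ι) (R : Lp (Fin d → ℝ) p P → Set (Lp (Fin d → ℝ) p P)) : Prop :=
  ∀ D ∈ lowerClosedConvex P ℱ p m t, @IsClosed _ (lpTopology P p) {X | (R X ∩ D).Nonempty}

/-- The acceptance set `A_t = {X | 0 ∈ R_t(X)}`. -/
def acceptance {P : Measure Ω} {p : ℝ≥0∞}
    (R : Lp (Fin d → ℝ) p P → Set (Lp (Fin d → ℝ) p P)) : Set (Lp (Fin d → ℝ) p P) :=
  {X | 0 ∈ R X}

/-- The scalarized risk measure `ρ_t^w(X) = ess inf {wᵀu | u ∈ R_t(X)}`. -/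
noncomputable def scalarization (P : Measure Ω) {p : ℝ≥0∞}
    (R : Lp (Fin d → ℝ) p P → Set (Lp (Fin d → ℝ) p P)) (w : Ω → Fin d → ℝ)
    (X : Lp (Fin d → ℝ) p P) : Ω → EReal :=
  familyEssInf P {f | ∃ u ∈ R X, f = fun ω => ((w ω ⬝ᵥ u ω : ℝ) : EReal)}

/-- All scalarizations in directions `w ∈ L^q_t(R̃_t(0)^+ ∖ M^⊥)` are integrable. -/
def IntegrableScalarizations (P : Measure Ω) (ℱ : Filtration ι mΩ) {p : ℝ≥0∞} (q : ℝ≥0∞) (m : ℕ)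
    (t : ι) (R : Lp (Fin d → ℝ) p P → Set (Lp (Fin d → ℝ) p P))
    (R0 : Ω → Set (Fin d → ℝ)) : Prop :=
  ∀ w : Ω → Fin d → ℝ, MemLt P ℱ q t (fun ω => dualCone (R0 ω) \ orth (eligible d m)) w →
    ∀ X : Lp (Fin d → ℝ) p P, ∃ g : Ω → ℝ, Integrable g P ∧
      scalarization P R w X =ᵐ[P] fun ω => (g ω : EReal)

/-! ### Dual variables -/

/-- `ℳ^d`: vectors of probability measures absolutely continuous with respect to `P`. -/
def vectorMeasures (P : Measure Ω) (d : ℕ) : Set (Fin d → Measure Ω) :=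
  {Q | ∀ i, IsProbabilityMeasure (Q i) ∧ Q i ≪ P}

open Classical in
/-- `ξ̄_{s,σ}(Q) = E[dQ/dP | ℱ σ] / E[dQ/dP | ℱ s]` where the denominator is positive, and `1`
elsewhere. -/
noncomputable def xi (P : Measure Ω) (ℱ : Filtration ι mΩ) (s σ : ι) (Q : Measure Ω) : Ω → ℝ :=
  fun ω =>
    if 0 < (P[fun ω' => (Q.rnDeriv P ω').toReal | ℱ s]) ω then
      (P[fun ω' => (Q.rnDeriv P ω').toReal | ℱ σ]) ω /
        (P[fun ω' => (Q.rnDeriv P ω').toReal | ℱ s]) ω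
    else 1

/-- `w_t^s(Q, w) = diag(w) ξ_{t,s}(Q)`. -/
noncomputable def wStep (P : Measure Ω) (ℱ : Filtration ι mΩ) (t s : ι)
    (Q : Fin d → Measure Ω) (w : Ω → Fin d → ℝ) : Ω → Fin d → ℝ :=
  fun ω i => w ω i * xi P ℱ t s (Q i) ω

/-- `f` represents an element of the dual cone `M_{s,+}^+`, a subset of `L^q_s`. -/
def MemDualMtPos (P : Measure Ω) (ℱ : Filtration ι mΩ) (p q : ℝ≥0∞) (m : ℕ) (s : ι)
    (f : Ω → Fin d → ℝ) : Prop :=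
  MemLt P ℱ q s (fun _ => Set.univ) f ∧
    ∀ u ∈ (MtPos P ℱ p m s : Set (Lp (Fin d → ℝ) p P)), 0 ≤ ∫ ω, f ω ⬝ᵥ u ω ∂P

/-- The stepped dual variables `𝒲_{t,s}(w)`: pairs `(Q, m_⊥) ∈ ℳ^d × L^q_t(M^⊥)` with
`w + m_⊥ ∈ L^q_t(M_+^+ ∖ M^⊥)` and `w_t^s(Q, w + m_⊥) ∈ M_{s,+}^+`. -/
def steppedDual (P : Measure Ω) (ℱ : Filtration ι mΩ) (p q : ℝ≥0∞) (m : ℕ) (t s : ι)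
    (w : Ω → Fin d → ℝ) : Set ((Fin d → Measure Ω) × (Ω → Fin d → ℝ)) :=
  {a | a.1 ∈ vectorMeasures P d ∧
    MemLt P ℱ q t (fun _ => orth (eligible d m)) a.2 ∧
    MemLt P ℱ q t (fun _ => dualCone (eligiblePos d m) \ orth (eligible d m)) (w + a.2) ∧
    MemDualMtPos P ℱ p q m s (wStep P ℱ t s a.1 (w + a.2))}

/-- The time-`s` dual variables `𝒲_s(v)`: pairs `(R, n_⊥) ∈ ℳ^d × L^q_s(M^⊥)` with
`v + n_⊥ ∈ M_{s,+}^+` and `w_s^T(R, v + n_⊥) ∈ L^q(ℝ^d_+)`.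

It is evaluated at `v ∈ M_{s,+}^+`, which may take values in `M^⊥` with positive probability (when
`v = w_t^s(Q, w + m_⊥)` with `Q` not equivalent to `P`). If `v` takes no value in `M^⊥` a.s., then
neither does `v + n_⊥`. -/
def terminalDual [OrderTop ι] (P : Measure Ω) (ℱ : Filtration ι mΩ) (p q : ℝ≥0∞) (m : ℕ) (s : ι)
    (v : Ω → Fin d → ℝ) : Set ((Fin d → Measure Ω) × (Ω → Fin d → ℝ)) :=
  {b | b.1 ∈ vectorMeasures P d ∧
    MemLt P ℱ q s (fun _ => orth (eligible d m)) b.2 ∧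
    MemDualMtPos P ℱ p q m s (v + b.2) ∧
    MemLt P ℱ q ⊤ (fun _ => {x : Fin d → ℝ | 0 ≤ x}) (wStep P ℱ s ⊤ b.1 (v + b.2))}

/-- The composed density `w_s^T(R, w_t^s(Q, w + m_⊥) + n_⊥)`, for `a = (Q, m_⊥)` and
`b = (R, n_⊥)`; the terminal time `T` is `⊤`. -/
noncomputable def splitDensity [OrderTop ι] (P : Measure Ω) (ℱ : Filtration ι mΩ) (t s : ι)
    (w : Ω → Fin d → ℝ) (a b : (Fin d → Measure Ω) × (Ω → Fin d → ℝ)) : Ω → Fin d → ℝ :=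
  wStep P ℱ s ⊤ b.1 (wStep P ℱ t s a.1 (w + a.2) + b.2)

/-- `E[w_s^T(R, w_t^s(Q, w + m_⊥) + n_⊥)ᵀ(-X) | ℱ t]`. -/
noncomputable def splitExpectation [OrderTop ι] {P : Measure Ω} (ℱ : Filtration ι mΩ) {p : ℝ≥0∞}
    (t s : ι) (w : Ω → Fin d → ℝ) (a b : (Fin d → Measure Ω) × (Ω → Fin d → ℝ))
    (X : Lp (Fin d → ℝ) p P) : Ω → EReal :=
  fun ω => (((P[fun ω' => splitDensity P ℱ t s w a b ω' ⬝ᵥ -(X ω') | ℱ t]) ω : ℝ) : EReal)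

/-- The penalty `β_{t,s}^w(Q, m_⊥, R, n_⊥)`, an essential supremum over the acceptance set. -/
noncomputable def beta [OrderTop ι] {P : Measure Ω} (ℱ : Filtration ι mΩ) {p : ℝ≥0∞}
    (t s : ι) (Rt : Lp (Fin d → ℝ) p P → Set (Lp (Fin d → ℝ) p P)) (w : Ω → Fin d → ℝ)
    (a b : (Fin d → Measure Ω) × (Ω → Fin d → ℝ)) : Ω → EReal :=
  familyEssSup P {f | ∃ Z ∈ acceptance Rt, f = splitExpectation ℱ t s w a b Z}

/-- `-β_{t,s}^w(Q, m_⊥, R, n_⊥) + E[w_s^T(R, w_t^s(Q, w + m_⊥) + n_⊥)ᵀ(-X) | ℱ t]`. -/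
noncomputable def dualValue [OrderTop ι] {P : Measure Ω} (ℱ : Filtration ι mΩ) {p : ℝ≥0∞}
    (t s : ι) (Rt : Lp (Fin d → ℝ) p P → Set (Lp (Fin d → ℝ) p P)) (w : Ω → Fin d → ℝ)
    (a b : (Fin d → Measure Ω) × (Ω → Fin d → ℝ)) (X : Lp (Fin d → ℝ) p P) : Ω → EReal :=
  fun ω => -beta ℱ t s Rt w a b ω + splitExpectation ℱ t s w a b X ω

/-- The joint dual variables `𝒲̃_{t,s}(w)`. Since `β` dominates an integrable random variable,
`E[β] < +∞` means that the positive part of `β` has finite expectation. -/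
def jointDual [OrderTop ι] {P : Measure Ω} (ℱ : Filtration ι mΩ) {p : ℝ≥0∞} (q : ℝ≥0∞) (m : ℕ)
    (t s : ι) (Rt : Lp (Fin d → ℝ) p P → Set (Lp (Fin d → ℝ) p P)) (w : Ω → Fin d → ℝ) :
    Set (((Fin d → Measure Ω) × (Ω → Fin d → ℝ)) × ((Fin d → Measure Ω) × (Ω → Fin d → ℝ))) :=
  {c | c.1 ∈ steppedDual P ℱ p q m t s w ∧
    c.2 ∈ terminalDual P ℱ p q m s (wStep P ℱ t s c.1.1 (w + c.1.2)) ∧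
    ∫⁻ ω, (beta ℱ t s Rt w c.1 c.2 ω).toENNReal ∂P < ∞}

end Definitions

end RiskMeasure

/-!
By normalization `R_t(0) + R_t(0) = R_t(0)`, and convexity makes `R_t(0)` a convex cone containing
`M_{t,+}`. Convex upper continuity, tested on a set bounded by a branch of a hyperbola, forces every
`w ∈ M_{t,+}^+` to be nonnegative on `R_t(0)`, so that all scalarizations in question are integrable
and `φ(X) = E[ρ_t^w(X)]` is the infimum of `E[wᵀu]` over `u ∈ R_t(X)`.

The functional `φ` is convex and lower semicontinuous, hence has affine minorants
`Z ↦ c - E[YᵀZ]` arbitrarily close to it at `X`. Monotonicity gives `Y ≥ 0` and translativity gives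
`E[Y | ℱ_t] - w ∈ M^⊥`. Such a `Y` is a composed density with `m_⊥ = E[Y | ℱ_t] - w` and
`n_⊥ = 0`: one and the same vector of measures `Q = R` has `ξ̄_{t,s}` and `ξ̄_{s,T}` equal to the
coordinatewise ratios `E[Y | ℱ_s] / E[Y | ℱ_t]` and `Y / E[Y | ℱ_s]`. The conditional losses
`E[-YᵀZ | ℱ_t]` of the acceptable `Z` are directed upward, so `E[β] ≤ -c`. Together with weak
duality this squeezes each essential supremum between `ρ_t^w(X)` and random variables of almost the
same mean.
-/

namespace RiskMeasure

/-! ### The dual of `L^p` over a finite measure, `p < ∞` -/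

section LpDual

variable {Ω : Type*} {mΩ : MeasurableSpace Ω} {μ : Measure Ω}

theorem hasSum_indicatorConstLp [IsFiniteMeasure μ] {E : Type*} [NormedAddCommGroup E] {p : ℝ≥0∞}
    [Fact (1 ≤ p)] (hp : p ≠ ∞) (c : E) {f : ℕ → Set Ω} (hf : ∀ i, MeasurableSet (f i))
    (hd : Pairwise (Function.onFun Disjoint f)) :
    HasSum (fun i => indicatorConstLp p (hf i) (measure_ne_top μ _) c)
      (indicatorConstLp p (MeasurableSet.iUnion hf) (measure_ne_top μ _) c) := by
  have hU : ∀ u : Finset ℕ, MeasurableSet (⋃ i ∈ u, f i) := fun u =>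
    u.measurableSet_biUnion fun i _ => hf i
  have hsum : ∀ u : Finset ℕ, ∑ i ∈ u, indicatorConstLp p (hf i) (measure_ne_top μ _) c =
      indicatorConstLp p (hU u) (measure_ne_top μ _) c := by
    intro u
    induction u using Finset.induction_on with
    | empty => simp
    | insert i u hi ih =>
      have hdisj : Disjoint (f i) (⋃ j ∈ u, f j) := Set.disjoint_iUnion₂_right.2 fun j hj =>
        hd (ne_of_mem_of_not_mem hj hi).symm
      rw [Finset.sum_insert hi, ih, ← indicatorConstLp_disjoint_union (hf i) (hU u) _ _ hdisj]
      congr 1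
      exact (Finset.set_biUnion_insert i u f).symm
  have htail : ∀ u : Finset ℕ, μ (symmDiff (⋃ i ∈ u, f i) (⋃ i, f i)) =
      ∑' i : {i // i ∉ u}, μ (f i) := fun u => by
    rw [← measure_iUnion (f := fun i : {i // i ∉ u} => f i)
        (fun i j hij => hd (Subtype.coe_injective.ne hij)) fun i => hf i,
      symmDiff_of_le (Set.iUnion₂_subset fun i _ => Set.subset_iUnion f i)]
    congr 1
    ext ω
    simp only [Set.mem_sdiff, Set.mem_iUnion, not_exists, Subtype.exists, exists_prop]
    constructor
    · rintro ⟨⟨i, hi⟩, hn⟩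
      exact ⟨i, fun hu => hn i ⟨hu, hi⟩, hi⟩
    · rintro ⟨i, hu, hi⟩
      exact ⟨⟨i, hi⟩, fun j ⟨hj, hω⟩ => (hd (ne_of_mem_of_not_mem hj hu)).le_bot ⟨hω, hi⟩⟩
  change Tendsto (fun u : Finset ℕ => ∑ i ∈ u, _) atTop _
  simp_rw [hsum]
  refine tendsto_indicatorConstLp_set hp ?_
  simp_rw [htail]
  refine ENNReal.tendsto_tsum_compl_atTop_zero (f := fun i => μ (f i)) ?_
  rw [← measure_iUnion hd hf]
  exact measure_ne_top μ _

open Classical in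
/-- The `L^p`-valued vector measure `A ↦ 1_A c`, whose images under functionals on `L^p` are the
signed measures the functionals induce. -/
noncomputable def indicatorVectorMeasure (μ : Measure Ω) [IsFiniteMeasure μ] {E : Type*}
    [NormedAddCommGroup E] {p : ℝ≥0∞} [Fact (1 ≤ p)] (hp : p ≠ ∞) (c : E) :
    VectorMeasure Ω (Lp E p μ) where
  measureOf' A := if hA : MeasurableSet A then indicatorConstLp p hA (measure_ne_top μ A) c else 0
  empty' := by simp
  not_measurable' A hA := dif_neg hA
  m_iUnion' f hf hd := by
    simpa only [hf, MeasurableSet.iUnion hf, dite_true] using hasSum_indicatorConstLp hp c hf hd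

theorem indicatorVectorMeasure_apply [IsFiniteMeasure μ] {E : Type*} [NormedAddCommGroup E]
    {p : ℝ≥0∞} [Fact (1 ≤ p)] (hp : p ≠ ∞) (c : E) {A : Set Ω} (hA : MeasurableSet A) :
    indicatorVectorMeasure μ hp c A = indicatorConstLp p hA (measure_ne_top μ A) c :=
  dif_pos hA

theorem exists_integrable_forall_apply_indicatorConstLp [IsFiniteMeasure μ] {p : ℝ≥0∞}
    [Fact (1 ≤ p)] (hp : p ≠ ∞) (l : Lp ℝ p μ →L[ℝ] ℝ) :
    ∃ y : Ω → ℝ, Measurable y ∧ Integrable y μ ∧ ∀ (A : Set Ω) (hA : MeasurableSet A),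
      l (indicatorConstLp p hA (measure_ne_top μ A) 1) = ∫ ω in A, y ω ∂μ := by
  let ν : SignedMeasure Ω :=
    (indicatorVectorMeasure μ hp (1 : ℝ)).mapRange l.toLinearMap.toAddMonoidHom l.continuous
  have hν : ∀ (A : Set Ω) (hA : MeasurableSet A),
      ν A = l (indicatorConstLp p hA (measure_ne_top μ A) 1) := fun A hA => by
    rw [← indicatorVectorMeasure_apply hp 1 hA]
    rfl
  have hac : VectorMeasure.AbsolutelyContinuous ν μ.toENNRealVectorMeasure := by
    refine VectorMeasure.AbsolutelyContinuous.mk fun A hA hA0 => ?_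
    rw [Measure.toENNRealVectorMeasure_apply_measurable hA] at hA0
    have hnull : indicatorConstLp p hA (measure_ne_top μ A) (1 : ℝ) = 0 := by
      rw [← norm_le_zero_iff]
      refine norm_indicatorConstLp_le.trans_eq ?_
      rw [measureReal_def, hA0, ENNReal.toReal_zero, Real.zero_rpow, mul_zero]
      exact (one_div_pos.2 (ENNReal.toReal_pos (zero_lt_one.trans_le Fact.out).ne' hp)).ne'
    rw [hν A hA, hnull, map_zero]
  refine ⟨ν.rnDeriv μ, SignedMeasure.measurable_rnDeriv ν μ, SignedMeasure.integrable_rnDeriv ν μ,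
    fun A hA => ?_⟩
  rw [← hν A hA, ← withDensityᵥ_apply (SignedMeasure.integrable_rnDeriv ν μ) hA,
    SignedMeasure.withDensityᵥ_rnDeriv_eq ν μ hac]

theorem apply_toLp_simpleFunc_eq_integral [IsFiniteMeasure μ] {p : ℝ≥0∞} [Fact (1 ≤ p)]
    (l : Lp ℝ p μ →L[ℝ] ℝ) {y : Ω → ℝ} (hy : Integrable y μ)
    (hl : ∀ (A : Set Ω) (hA : MeasurableSet A),
      l (indicatorConstLp p hA (measure_ne_top μ A) 1) = ∫ ω in A, y ω ∂μ)
    (Z : SimpleFunc Ω ℝ) :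
    l ((Z.memLp_of_isFiniteMeasure p μ).toLp Z) = ∫ ω, y ω * Z ω ∂μ := by
  induction Z using SimpleFunc.induction with
  | @const c A hA =>
    have hmul : ∀ ω, y ω * SimpleFunc.piecewise A hA (SimpleFunc.const Ω c) (SimpleFunc.const Ω 0) ω
        = A.indicator (fun ω => c * y ω) ω := fun ω => by
      by_cases hω : ω ∈ A <;> simp [hω, mul_comm]
    have hsmul : ((SimpleFunc.piecewise A hA (SimpleFunc.const Ω c)
        (SimpleFunc.const Ω 0)).memLp_of_isFiniteMeasure p μ).toLp _ =
        c • indicatorConstLp p hA (measure_ne_top μ A) (1 : ℝ) := by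
      rw [indicatorConstLp, ← MemLp.toLp_const_smul]
      refine MemLp.toLp_congr _ _ (ae_of_all _ fun ω => ?_)
      by_cases hω : ω ∈ A <;> simp [hω]
    simp_rw [hmul]
    rw [hsmul, map_smul, hl A hA, integral_indicator hA, integral_const_mul, smul_eq_mul]
  | @add f g _ hf hg =>
    have hint : ∀ Z : SimpleFunc Ω ℝ, Integrable (fun ω => y ω * Z ω) μ := fun Z =>
      hy.mul_of_top_left (Z.memLp_of_isFiniteMeasure ∞ μ)
    have hadd : ((f + g).memLp_of_isFiniteMeasure p μ).toLp (f + g) =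
        (f.memLp_of_isFiniteMeasure p μ).toLp f + (g.memLp_of_isFiniteMeasure p μ).toLp g := rfl
    rw [hadd, map_add, hf, hg, ← integral_add (hint f) (hint g)]
    simp only [SimpleFunc.coe_add, Pi.add_apply, mul_add]

theorem le_rpow_of_le_mul_rpow {a b : ℝ} (hab : a.HolderConjugate b) {I C : ℝ≥0∞} (hI : I ≠ ∞)
    (h : I ≤ C * I ^ (1 / a)) : I ≤ C ^ b := by
  rcases eq_or_ne I 0 with rfl | h0
  · exact zero_le
  have hfactor : I ^ (1 / b) * I ^ (1 / a) = I := by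
    rw [← ENNReal.rpow_add _ _ h0 hI, one_div, one_div, add_comm, hab.inv_add_inv_eq_one,
      ENNReal.rpow_one]
  have hroot : I ^ (1 / b) ≤ C := by
    refine (ENNReal.mul_le_mul_iff_left (c := I ^ (1 / a)) ?_ ?_).1 (hfactor.le.trans h)
    · simp [ENNReal.rpow_eq_zero_iff, h0, hI]
    · exact ENNReal.rpow_ne_top_of_nonneg (one_div_nonneg.2 hab.nonneg) hI
  calc I = (I ^ (1 / b)) ^ b := by rw [← ENNReal.rpow_mul, one_div_mul_cancel hab.symm.ne_zero,
        ENNReal.rpow_one]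
    _ ≤ C ^ b := ENNReal.rpow_le_rpow hroot hab.symm.nonneg

theorem lintegral_rpow_le_of_forall_simpleFunc [IsFiniteMeasure μ] {a b : ℝ}
    (hab : a.HolderConjugate b) {y : Ω → ℝ≥0∞} (hy : Measurable y) {C : ℝ≥0∞}
    (h : ∀ Z : SimpleFunc Ω ℝ≥0∞, (∀ ω, Z ω ≠ ∞) →
      ∫⁻ ω, y ω * Z ω ∂μ ≤ C * (∫⁻ ω, Z ω ^ a ∂μ) ^ (1 / a)) :
    ∫⁻ ω, y ω ^ b ∂μ ≤ C ^ b := by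
  have hb : 0 ≤ b - 1 := sub_nonneg.2 hab.symm.lt.le
  let Y := SimpleFunc.eapprox y
  have hYt : ∀ n ω, Y n ω ≠ ∞ := fun n ω => (SimpleFunc.eapprox_lt_top y n ω).ne
  have hpow : ∀ z : ℝ≥0∞, z ^ b = z * z ^ (b - 1) := fun z => by
    simpa using ENNReal.rpow_add_of_nonneg (x := z) 1 (b - 1) zero_le_one hb
  have hbound : ∀ n, ∫⁻ ω, Y n ω ^ b ∂μ ≤ C ^ b := fun n => by
    refine le_rpow_of_le_mul_rpow hab ?_ ?_
    · have hfin : ∀ ω, (Y n).map (· ^ b) ω ≠ ∞ := fun ω =>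
        ENNReal.rpow_ne_top_of_nonneg hab.symm.nonneg (hYt n ω)
      have hsupp : (Y n).FinMeasSupp μ := SimpleFunc.finMeasSupp_iff_support.2 (measure_lt_top μ _)
      have hzero : (0 : ℝ≥0∞) ^ b = 0 := ENNReal.zero_rpow_of_pos hab.symm.pos
      rw [lintegral_congr fun ω => (SimpleFunc.map_apply (· ^ b) (Y n) ω).symm,
        SimpleFunc.lintegral_eq_lintegral]
      exact ((hsupp.map hzero).lintegral_lt_top (ae_of_all _ hfin)).ne
    · have hconj : ∀ z : ℝ≥0∞, (z ^ (b - 1)) ^ a = z ^ b := fun z => by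
        rw [← ENNReal.rpow_mul, hab.symm.sub_one_mul_conj]
      calc ∫⁻ ω, Y n ω ^ b ∂μ ≤ ∫⁻ ω, y ω * (Y n).map (· ^ (b - 1)) ω ∂μ :=
            lintegral_mono fun ω => by
              rw [hpow, SimpleFunc.map_apply]
              gcongr
              exact (le_iSup (fun n => Y n ω) n).trans_eq (SimpleFunc.iSup_eapprox_apply hy ω)
        _ ≤ C * (∫⁻ ω, (Y n).map (· ^ (b - 1)) ω ^ a ∂μ) ^ (1 / a) :=
            h _ fun ω => ENNReal.rpow_ne_top_of_nonneg hb (hYt n ω)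
        _ = C * (∫⁻ ω, Y n ω ^ b ∂μ) ^ (1 / a) := by simp_rw [SimpleFunc.map_apply, hconj]
  have hsup : ∀ ω, y ω ^ b = ⨆ n, Y n ω ^ b := fun ω => by
    rw [← SimpleFunc.iSup_eapprox_apply hy ω]
    exact (ENNReal.orderIsoRpow b hab.symm.pos).map_iSup _
  simp_rw [hsup]
  rw [lintegral_iSup (fun n => (Y n).measurable.pow_const _) fun i j hij ω =>
    ENNReal.rpow_le_rpow (SimpleFunc.monotone_eapprox y hij ω) hab.symm.nonneg]
  exact iSup_le hbound

theorem lintegral_enorm_mul_le_of_forall_simpleFunc [IsFiniteMeasure μ] {p : ℝ≥0∞} {y : Ω → ℝ}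
    (hym : Measurable y) (hy : Integrable y μ) {C : ℝ}
    (h : ∀ Z : SimpleFunc Ω ℝ, ∫ ω, y ω * Z ω ∂μ ≤ C * (eLpNorm Z p μ).toReal)
    (Z : SimpleFunc Ω ℝ≥0∞) (hZ : ∀ ω, Z ω ≠ ∞) :
    ∫⁻ ω, ‖y ω‖ₑ * Z ω ∂μ ≤ ENNReal.ofReal C * eLpNorm Z p μ := by
  let sgn : SimpleFunc Ω ℝ := SimpleFunc.piecewise {ω | 0 ≤ y ω} (hym measurableSet_Ici)
    (SimpleFunc.const Ω 1) (SimpleFunc.const Ω (-1))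
  let S : SimpleFunc Ω ℝ := sgn * Z.map ENNReal.toReal
  have hsgn : ∀ ω, |sgn ω| = 1 ∧ y ω * sgn ω = |y ω| := fun ω => by
    rcases le_or_gt 0 (y ω) with hω | hω
    · simp [sgn, hω, abs_of_nonneg]
    · simp [sgn, hω.not_ge, abs_of_neg hω]
  have hSZ : ∀ ω, ‖S ω‖ₑ = Z ω := fun ω => by
    rw [← ofReal_norm, Real.norm_eq_abs, SimpleFunc.mul_apply, abs_mul, (hsgn ω).1,
      one_mul, SimpleFunc.map_apply, abs_of_nonneg ENNReal.toReal_nonneg,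
      ENNReal.ofReal_toReal (hZ ω)]
  have hyS : ∀ ω, ENNReal.ofReal (y ω * S ω) = ‖y ω‖ₑ * Z ω := fun ω => by
    rw [SimpleFunc.mul_apply, ← mul_assoc, (hsgn ω).2, SimpleFunc.map_apply,
      ENNReal.ofReal_mul (abs_nonneg _), ENNReal.ofReal_toReal (hZ ω), ← Real.norm_eq_abs,
      ofReal_norm]
  have hyS0 : ∀ ω, 0 ≤ y ω * S ω := fun ω => by
    rw [SimpleFunc.mul_apply, ← mul_assoc, (hsgn ω).2]
    exact mul_nonneg (abs_nonneg _) ENNReal.toReal_nonneg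
  calc ∫⁻ ω, ‖y ω‖ₑ * Z ω ∂μ = ENNReal.ofReal (∫ ω, y ω * S ω ∂μ) := by
        simp_rw [← hyS]
        exact (ofReal_integral_eq_lintegral_ofReal
          (hy.mul_of_top_left (S.memLp_of_isFiniteMeasure ∞ μ)) (ae_of_all _ hyS0)).symm
    _ ≤ ENNReal.ofReal (C * (eLpNorm S p μ).toReal) := ENNReal.ofReal_le_ofReal (h S)
    _ = ENNReal.ofReal C * eLpNorm Z p μ := by
        rw [ENNReal.ofReal_mul' ENNReal.toReal_nonneg,
          ENNReal.ofReal_toReal (S.memLp_of_isFiniteMeasure p μ).2.ne,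
          eLpNorm_congr_enorm_ae (g := Z) (ae_of_all _ hSZ)]

theorem memLp_of_forall_simpleFunc [IsFiniteMeasure μ] {p q : ℝ≥0∞} [ENNReal.HolderConjugate p q]
    {y : Ω → ℝ} (hym : Measurable y) (hy : Integrable y μ) {C : ℝ}
    (h : ∀ Z : SimpleFunc Ω ℝ, ∫ ω, y ω * Z ω ∂μ ≤ C * (eLpNorm Z p μ).toReal) : MemLp y q μ := by
  have hle := lintegral_enorm_mul_le_of_forall_simpleFunc hym hy h
  refine ⟨hym.aestronglyMeasurable, ?_⟩
  rcases eq_or_ne q ∞ with rfl | hq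
  · obtain rfl : p = 1 := (ENNReal.HolderConjugate.eq_top_iff_eq_one ∞ p).1 rfl
    refine (essSup_le_of_ae_le (ENNReal.ofReal C) ?_).trans_lt ENNReal.ofReal_lt_top
    refine ae_le_of_forall_setLIntegral_le_of_sigmaFinite hym.enorm fun A hA _ => ?_
    have hA' := hle (SimpleFunc.piecewise A hA (SimpleFunc.const Ω 1) (SimpleFunc.const Ω 0))
      fun ω => by by_cases hω : ω ∈ A <;> simp [hω]
    have hind : ∀ ω, ‖y ω‖ₑ * A.indicator 1 ω = A.indicator (fun ω => ‖y ω‖ₑ) ω := fun ω => by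
      by_cases hω : ω ∈ A <;> simp [hω]
    simpa [eLpNorm_one_eq_lintegral_enorm, hA, hind] using hA'
  rcases eq_or_ne p ∞ with rfl | hp
  · obtain rfl : q = 1 := (ENNReal.HolderConjugate.eq_top_iff_eq_one ∞ q).1 rfl
    exact (memLp_one_iff_integrable.2 hy).2
  · have hp0 : p ≠ 0 := ENNReal.HolderConjugate.ne_zero p q
    have hq0 : q ≠ 0 := ENNReal.HolderConjugate.ne_zero q p
    rw [eLpNorm_lt_top_iff_lintegral_rpow_enorm_lt_top hq0 hq]
    have hpq := ENNReal.HolderConjugate.toReal_of_ne_top (p := p) (q := q) hp hq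
    refine (lintegral_rpow_le_of_forall_simpleFunc hpq hym.enorm (C := ENNReal.ofReal C)
      fun Z hZ => (hle Z hZ).trans_eq ?_).trans_lt
      (ENNReal.rpow_lt_top_of_nonneg hpq.symm.nonneg ENNReal.ofReal_ne_top)
    rw [eLpNorm_eq_lintegral_rpow_enorm_toReal hp0 hp]
    simp_rw [enorm_eq_self]

theorem exists_memLp_forall_apply_eq_integral [IsFiniteMeasure μ] {p q : ℝ≥0∞} [Fact (1 ≤ p)]
    [ENNReal.HolderConjugate p q] (hp : p ≠ ∞) (l : Lp ℝ p μ →L[ℝ] ℝ) :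
    ∃ y : Ω → ℝ, MemLp y q μ ∧ ∀ Z : Lp ℝ p μ, l Z = ∫ ω, y ω * Z ω ∂μ := by
  obtain ⟨y, hym, hyi, hl⟩ := exists_integrable_forall_apply_indicatorConstLp hp l
  have hsimple := apply_toLp_simpleFunc_eq_integral l hyi hl
  have hy : MemLp y q μ := memLp_of_forall_simpleFunc (p := p) hym hyi (C := ‖l‖) fun Z => by
    rw [← hsimple Z, ← Lp.norm_toLp Z (Z.memLp_of_isFiniteMeasure p μ)]
    exact (le_abs_self _).trans (l.le_opNorm _)
  have : Fact (1 ≤ q) := ⟨ENNReal.HolderConjugate.one_le q p⟩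
  let L := (ContinuousLinearMap.mul ℝ ℝ).lpPairing μ q p (hy.toLp y)
  have hL : ∀ Z : Lp ℝ p μ, L Z = ∫ ω, y ω * Z ω ∂μ := fun Z => by
    rw [ContinuousLinearMap.lpPairing_eq_integral]
    refine integral_congr_ae ?_
    filter_upwards [hy.coeFn_toLp] with ω hω
    rw [hω, ContinuousLinearMap.mul_apply']
  refine ⟨y, hy, fun Z => ?_⟩
  rw [← hL Z]
  refine (Lp.simpleFunc.denseRange hp).induction_on (p := fun Z => l Z = L Z) Z
    (isClosed_eq l.continuous L.continuous) fun Z => ?_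
  have hZ : (Z : Lp ℝ p μ) = ((Lp.simpleFunc.toSimpleFunc Z).memLp_of_isFiniteMeasure p μ).toLp _ :=
    (congrArg _ (Lp.simpleFunc.toLp_toSimpleFunc Z)).symm
  rw [hL, hZ, hsimple]
  refine integral_congr_ae ?_
  filter_upwards [MemLp.coeFn_toLp ((Lp.simpleFunc.toSimpleFunc Z).memLp_of_isFiniteMeasure p μ)]
    with ω hω
  rw [hω]

end LpDual

/-! ### The pairing of `L^p` with `L^q` -/

section Pairing

variable {Ω : Type*} {mΩ : MeasurableSpace Ω} {P : Measure Ω} {d : ℕ} {p q : ℝ≥0∞}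

theorem integrable_dotProduct [ENNReal.HolderConjugate p q] {Y X : Ω → Fin d → ℝ}
    (hY : MemLp Y q P) (hX : MemLp X p P) : Integrable (fun ω => Y ω ⬝ᵥ X ω) P :=
  integrable_finsetSum _ fun i _ => (hY.eval i).integrable_mul (hX.eval i)

/-- The functional `X ↦ E[YᵀX]` on `L^p` given by `Y ∈ L^q`. -/
noncomputable def pairing (p : ℝ≥0∞) [ENNReal.HolderConjugate p q] {Y : Ω → Fin d → ℝ}
    (hY : MemLp Y q P) : Lp (Fin d → ℝ) p P →ₗ[ℝ] ℝ where
  toFun X := ∫ ω, Y ω ⬝ᵥ X ω ∂P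
  map_add' X Z := by
    rw [← integral_add (integrable_dotProduct hY (Lp.memLp X))
      (integrable_dotProduct hY (Lp.memLp Z))]
    refine integral_congr_ae ?_
    filter_upwards [Lp.coeFn_add X Z] with ω hω
    rw [hω, Pi.add_apply, dotProduct_add]
  map_smul' c X := by
    rw [RingHom.id_apply, smul_eq_mul, ← integral_const_mul]
    refine integral_congr_ae ?_
    filter_upwards [Lp.coeFn_smul c X] with ω hω
    rw [hω, Pi.smul_apply, dotProduct_smul, smul_eq_mul]

theorem pairing_apply [ENNReal.HolderConjugate p q] {Y : Ω → Fin d → ℝ} (hY : MemLp Y q P)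
    (X : Lp (Fin d → ℝ) p P) : pairing p hY X = ∫ ω, Y ω ⬝ᵥ X ω ∂P := rfl

theorem pairing_toLp [ENNReal.HolderConjugate p q] {Y : Ω → Fin d → ℝ} (hY : MemLp Y q P) :
    pairing p (Lp.memLp hY.toLp) = pairing p hY := by
  ext X
  refine integral_congr_ae ?_
  filter_upwards [hY.coeFn_toLp] with ω hω
  rw [hω]

theorem lpTopology_top [Fact ((1 : ℝ≥0∞) ≤ ∞)] :
    (lpTopology P ∞ : TopologicalSpace (Lp (Fin d → ℝ) ∞ P)) =
      ⨅ Y : Lp (Fin d → ℝ) 1 P,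
        TopologicalSpace.induced (pairing ∞ (Lp.memLp Y)) inferInstance := by
  rw [lpTopology, if_pos rfl, Pi.topologicalSpace, induced_iInf]
  refine iInf_congr fun Y => ?_
  rw [induced_compose]
  rfl

variable [Fact (1 ≤ p)]

theorem lpTopology_of_ne_top (hp : p ≠ ∞) :
    lpTopology P p = (inferInstance : TopologicalSpace (Lp (Fin d → ℝ) p P)) :=
  if_neg hp

theorem isTopologicalAddGroup_lpTopology :
    @IsTopologicalAddGroup (Lp (Fin d → ℝ) p P) (lpTopology P p) _ := by
  rcases eq_or_ne p ∞ with rfl | hp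
  · rw [lpTopology_top]
    exact topologicalAddGroup_iInf fun Y => topologicalAddGroup_induced _
  · rw [lpTopology_of_ne_top hp]
    infer_instance

theorem continuousSMul_lpTopology :
    @ContinuousSMul ℝ (Lp (Fin d → ℝ) p P) _ _ (lpTopology P p) := by
  rcases eq_or_ne p ∞ with rfl | hp
  · rw [lpTopology_top]
    exact continuousSMul_iInf fun Y => continuousSMul_induced _
  · rw [lpTopology_of_ne_top hp]
    infer_instance

theorem locallyConvexSpace_lpTopology :
    @LocallyConvexSpace ℝ (Lp (Fin d → ℝ) p P) _ _ _ _ (lpTopology P p) := by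
  rcases eq_or_ne p ∞ with rfl | hp
  · rw [lpTopology_top]
    exact LocallyConvexSpace.iInf fun Y => LocallyConvexSpace.induced _
  · rw [lpTopology_of_ne_top hp]
    infer_instance

variable [ENNReal.HolderConjugate p q]

theorem continuous_pairing {Y : Ω → Fin d → ℝ} (hY : MemLp Y q P) :
    @Continuous _ _ (lpTopology P p) _ (pairing p hY) := by
  rcases eq_or_ne p ∞ with rfl | hp
  · obtain rfl : q = 1 := ENNReal.HolderConjugate.unique ∞ q 1
    rw [lpTopology_top, ← pairing_toLp hY]
    exact continuous_iInf_dom (i := hY.toLp) continuous_induced_dom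
  · have : Fact (1 ≤ q) := ⟨ENNReal.HolderConjugate.one_le q p⟩
    rw [lpTopology_of_ne_top hp, ← pairing_toLp hY]
    have hbilin : (pairing p (Lp.memLp hY.toLp) : Lp (Fin d → ℝ) p P → ℝ) =
        (dotProductBilin ℝ ℝ).toContinuousBilinearMap.lpPairing P q p hY.toLp := by
      ext Z
      rw [ContinuousLinearMap.lpPairing_eq_integral]
      rfl
    rw [hbilin]
    exact ContinuousLinearMap.continuous _

theorem exists_eq_pairing_top [Fact ((1 : ℝ≥0∞) ≤ ∞)] {l : Lp (Fin d → ℝ) ∞ P →ₗ[ℝ] ℝ}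
    (hc : @Continuous _ _ (lpTopology P ∞) _ l) :
    ∃ (Y : Ω → Fin d → ℝ) (hY : MemLp Y 1 P), l = pairing ∞ hY := by
  rw [lpTopology_top, ← LinearMap.mem_span_iff_continuous] at hc
  induction hc using Submodule.span_induction with
  | mem x hx =>
    obtain ⟨Y, rfl⟩ := hx
    exact ⟨Y, Lp.memLp Y, rfl⟩
  | zero =>
    refine ⟨0, MemLp.zero, ?_⟩
    ext X
    simp [pairing_apply]
  | add x y _ _ hx hy =>
    obtain ⟨Y, hY, rfl⟩ := hx
    obtain ⟨Z, hZ, rfl⟩ := hy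
    refine ⟨Y + Z, hY.add hZ, ?_⟩
    ext X
    simp only [LinearMap.add_apply, pairing_apply, Pi.add_apply, add_dotProduct]
    exact (integral_add (integrable_dotProduct hY (Lp.memLp X))
      (integrable_dotProduct hZ (Lp.memLp X))).symm
  | smul c x _ hx =>
    obtain ⟨Y, hY, rfl⟩ := hx
    refine ⟨c • Y, hY.const_smul c, ?_⟩
    ext X
    simp only [LinearMap.smul_apply, pairing_apply, Pi.smul_apply, smul_dotProduct, smul_eq_mul,
      integral_const_mul]

theorem eq_sum_compLpL_single_proj (X : Lp (Fin d → ℝ) p P) :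
    X = ∑ i, (ContinuousLinearMap.single ℝ (fun _ : Fin d => ℝ) i).compLpL p P
      ((ContinuousLinearMap.proj (R := ℝ) (φ := fun _ : Fin d => ℝ) i).compLpL p P X) := by
  refine Lp.ext ?_
  have hproj := ae_all_iff.2 fun i : Fin d =>
    (ContinuousLinearMap.proj (R := ℝ) (φ := fun _ : Fin d => ℝ) i).coeFn_compLpL X
  have hsingle := ae_all_iff.2 fun i : Fin d =>
    (ContinuousLinearMap.single ℝ (fun _ : Fin d => ℝ) i).coeFn_compLpL
      ((ContinuousLinearMap.proj (R := ℝ) (φ := fun _ : Fin d => ℝ) i).compLpL p P X)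
  filter_upwards [hproj, hsingle, Lp.coeFn_fun_finsetSum Finset.univ fun i : Fin d =>
    (ContinuousLinearMap.single ℝ (fun _ : Fin d => ℝ) i).compLpL p P
      ((ContinuousLinearMap.proj (R := ℝ) (φ := fun _ : Fin d => ℝ) i).compLpL p P X)]
    with ω hproj hsingle hsum
  rw [hsum]
  simp_rw [hsingle, hproj]
  exact (Finset.univ_sum_single (X ω)).symm

theorem exists_eq_pairing_of_ne_top [IsFiniteMeasure P] (hp : p ≠ ∞)
    (l : Lp (Fin d → ℝ) p P →L[ℝ] ℝ) :
    ∃ (Y : Ω → Fin d → ℝ) (hY : MemLp Y q P), l.toLinearMap = pairing p hY := by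
  choose y hy hly using fun i : Fin d => exists_memLp_forall_apply_eq_integral (q := q) hp
    (l ∘L (ContinuousLinearMap.single ℝ (fun _ : Fin d => ℝ) i).compLpL p P)
  refine ⟨fun ω i => y i ω, MemLp.of_eval hy, LinearMap.ext fun X => ?_⟩
  have hsum : l X = ∑ i, (l ∘L (ContinuousLinearMap.single ℝ (fun _ : Fin d => ℝ) i).compLpL p P)
      ((ContinuousLinearMap.proj (R := ℝ) (φ := fun _ : Fin d => ℝ) i).compLpL p P X) := by
    conv_lhs => rw [eq_sum_compLpL_single_proj X, map_sum]
    rfl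
  have hint : ∀ i ∈ Finset.univ, Integrable (fun ω => y i ω * X ω i) P := fun i _ =>
    (hy i).integrable_mul ((Lp.memLp X).eval i)
  rw [ContinuousLinearMap.coe_coe, hsum, pairing_apply]
  simp only [dotProduct]
  rw [integral_finsetSum _ hint]
  refine Finset.sum_congr rfl fun i _ => ?_
  rw [hly]
  refine integral_congr_ae ?_
  filter_upwards [(ContinuousLinearMap.proj (R := ℝ) (φ := fun _ : Fin d => ℝ) i).coeFn_compLpL X]
    with ω hω
  rw [hω, ContinuousLinearMap.proj_apply]

theorem exists_eq_pairing [IsFiniteMeasure P] {l : Lp (Fin d → ℝ) p P →ₗ[ℝ] ℝ}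
    (hc : @Continuous _ _ (lpTopology P p) _ l) :
    ∃ (Y : Ω → Fin d → ℝ) (hY : MemLp Y q P), l = pairing p hY := by
  rcases eq_or_ne p ∞ with rfl | hp
  · obtain rfl : q = 1 := ENNReal.HolderConjugate.unique ∞ q 1
    exact exists_eq_pairing_top hc
  · rw [lpTopology_of_ne_top hp] at hc
    exact exists_eq_pairing_of_ne_top hp ⟨l, hc⟩

end Pairing

/-! ### Conditional expectations -/

section ConditionalExpectation

variable {Ω : Type*} {m' mΩ : MeasurableSpace Ω} {P : Measure Ω}

theorem aestronglyMeasurable_pi_iff {κ : Type*} [Countable κ] {f : Ω → κ → ℝ} :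
    AEStronglyMeasurable[m'] f P ↔ ∀ i, AEStronglyMeasurable[m'] (fun ω => f ω i) P := by
  refine ⟨fun h i => (continuous_apply i).comp_aestronglyMeasurable h, fun h => ?_⟩
  refine ⟨fun ω i => (h i).mk _ ω, Measurable.stronglyMeasurable <|
    @measurable_pi_lambda _ _ _ m' _ _ fun i => (h i).stronglyMeasurable_mk.measurable, ?_⟩
  filter_upwards [ae_all_iff.2 fun i => (h i).ae_eq_mk] with ω hω
  exact funext hω

theorem integral_condExp_mul [IsFiniteMeasure P] (hm' : m' ≤ mΩ) {f g : Ω → ℝ}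
    (hf : Integrable f P) (hg : Integrable g P) {C : ℝ} (hC : ∀ᵐ ω ∂P, ‖g ω‖ ≤ C) :
    ∫ ω, (P[g | m']) ω * f ω ∂P = ∫ ω, g ω * (P[f | m']) ω ∂P := by
  have hleft : Integrable (P[g | m'] * f) P :=
    hf.bdd_mul integrable_condExp.1 (ae_bdd_norm_condExp_of_ae_bdd_norm hC)
  have hright : Integrable (g * P[f | m']) P := integrable_condExp.bdd_mul hg.1 hC
  calc ∫ ω, (P[g | m']) ω * f ω ∂P = ∫ ω, (P[P[g | m'] * f | m']) ω ∂P :=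
        (integral_condExp hm').symm
    _ = ∫ ω, (P[g * P[f | m'] | m']) ω ∂P := integral_congr_ae <|
        (condExp_mul_of_stronglyMeasurable_left stronglyMeasurable_condExp hleft hf).trans
          (condExp_mul_of_stronglyMeasurable_right stronglyMeasurable_condExp hright hg).symm
    _ = ∫ ω, g ω * (P[f | m']) ω ∂P := integral_condExp hm'

theorem integral_indicator_one_mul {A : Set Ω} (hA : MeasurableSet A) (f : Ω → ℝ) :
    ∫ ω, A.indicator 1 ω * f ω ∂P = ∫ ω in A, f ω ∂P := by
  rw [← integral_indicator hA]
  refine integral_congr_ae (ae_of_all _ fun ω => ?_)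
  by_cases hω : ω ∈ A <;> simp [hω]

theorem ae_eq_zero_iff_forall_integral_indicator_mul {f : Ω → ℝ} (hf : Integrable f P) :
    f =ᵐ[P] 0 ↔ ∀ A, MeasurableSet A → ∫ ω, A.indicator 1 ω * f ω ∂P = 0 := by
  refine ⟨fun h A _ => ?_, fun h => ?_⟩
  · refine integral_eq_zero_of_ae ?_
    filter_upwards [h] with ω hω
    rw [hω, Pi.zero_apply, mul_zero]
  · refine hf.ae_eq_of_forall_setIntegral_eq _ _ (integrable_zero _ _ _) fun A hA _ => ?_
    rw [← integral_indicator_one_mul hA, h A hA, Pi.zero_def, integral_zero]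

theorem aestronglyMeasurable_iff_forall_integral_indicator_sub_condExp_mul [IsFiniteMeasure P]
    (hm' : m' ≤ mΩ) {f : Ω → ℝ} (hf : Integrable f P) :
    AEStronglyMeasurable[m'] f P ↔ ∀ A, MeasurableSet A →
      ∫ ω, (A.indicator 1 ω - (P[A.indicator (1 : Ω → ℝ) | m']) ω) * f ω ∂P = 0 := by
  have hpair : ∀ A, MeasurableSet A →
      ∫ ω, (A.indicator 1 ω - (P[A.indicator (1 : Ω → ℝ) | m']) ω) * f ω ∂P =
        ∫ ω, A.indicator 1 ω * (f - P[f | m']) ω ∂P := fun A hA => by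
    have hA1 : Integrable (A.indicator (1 : Ω → ℝ)) P := (integrable_const 1).indicator hA
    have hbdd : ∀ᵐ ω ∂P, ‖A.indicator (1 : Ω → ℝ) ω‖ ≤ 1 := ae_of_all _ fun ω => by
      by_cases hω : ω ∈ A <;> simp [hω]
    simp only [sub_mul, mul_sub, Pi.sub_apply]
    rw [integral_sub (hf.bdd_mul hA1.1 hbdd)
        (hf.bdd_mul integrable_condExp.1 (ae_bdd_norm_condExp_of_ae_bdd_norm hbdd)),
      integral_sub (hf.bdd_mul hA1.1 hbdd) (integrable_condExp.bdd_mul hA1.1 hbdd),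
      integral_condExp_mul hm' hf hA1 hbdd]
  calc AEStronglyMeasurable[m'] f P ↔ f - P[f | m'] =ᵐ[P] 0 :=
        ⟨fun h => by
          filter_upwards [condExp_of_aestronglyMeasurable' hm' h hf] with ω hω
          rw [Pi.sub_apply, hω, sub_self, Pi.zero_apply],
        fun h => stronglyMeasurable_condExp.aestronglyMeasurable.congr
          ((sub_ae_eq_zero _ _).1 h).symm⟩
    _ ↔ _ := by
        rw [ae_eq_zero_iff_forall_integral_indicator_mul (hf.sub integrable_condExp)]
        exact forall₂_congr fun A hA => by rw [hpair A hA]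

end ConditionalExpectation

/-! ### Eligible portfolios -/

theorem mem_orth_eligible {d m : ℕ} {v : Fin d → ℝ} :
    v ∈ orth (eligible d m) ↔ ∀ i : Fin d, (i : ℕ) < m → v i = 0 := by
  refine ⟨fun h i hi => ?_, fun h u hu => Finset.sum_eq_zero fun i _ => ?_⟩
  · have hsingle := h (Pi.single i 1) fun j hj =>
      Pi.single_eq_of_ne (fun hji => (hi.trans_le hj).ne (congrArg _ hji.symm)) 1
    simpa using hsingle
  · rcases lt_or_ge (i : ℕ) m with hi | hi
    · rw [h i hi, zero_mul]
    · rw [hu i hi, mul_zero]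

theorem mem_dualCone_eligiblePos {d m : ℕ} {v : Fin d → ℝ} :
    v ∈ dualCone (eligiblePos d m) ↔ ∀ i : Fin d, (i : ℕ) < m → 0 ≤ v i := by
  refine ⟨fun h i hi => ?_, fun h u hu => Finset.sum_nonneg fun i _ => ?_⟩
  · have hsingle := h (Pi.single i 1) ⟨fun j hj =>
      Pi.single_eq_of_ne (fun hji => (hi.trans_le hj).ne (congrArg _ hji.symm)) 1,
      Pi.single_nonneg.2 zero_le_one⟩
    simpa using hsingle
  · rcases lt_or_ge (i : ℕ) m with hi | hi
    · exact mul_nonneg (h i hi) (hu.2 i)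
    · rw [hu.1 i hi, mul_zero]

section Mt

variable {Ω : Type*} {mΩ : MeasurableSpace Ω} {P : Measure Ω} {ι : Type*} [LinearOrder ι]
  {ℱ : Filtration ι mΩ} {d m : ℕ} {p : ℝ≥0∞} {t : ι}

theorem mem_Mt {X : Lp (Fin d → ℝ) p P} :
    X ∈ Mt P ℱ p m t ↔ AEStronglyMeasurable[ℱ t] X P ∧ ∀ᵐ ω ∂P, X ω ∈ eligible d m :=
  ⟨fun h => ⟨h.1, h.2.2⟩, fun h => ⟨h.1, Lp.memLp X, h.2⟩⟩

theorem mem_MtPos {X : Lp (Fin d → ℝ) p P} :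
    X ∈ MtPos P ℱ p m t ↔ X ∈ Mt P ℱ p m t ∧ ∀ᵐ ω ∂P, 0 ≤ X ω :=
  ⟨fun h => ⟨⟨h.1, h.2.1, h.2.2.mono fun _ h => h.1⟩, h.2.2.mono fun _ h => h.2⟩,
    fun h => ⟨h.1.1, h.1.2.1, h.1.2.2.and h.2⟩⟩

theorem zero_mem_Mt : (0 : Lp (Fin d → ℝ) p P) ∈ Mt P ℱ p m t := by
  refine mem_Mt.2 ⟨aestronglyMeasurable_zero.congr (Lp.coeFn_zero _ _ _).symm, ?_⟩
  filter_upwards [Lp.coeFn_zero (Fin d → ℝ) p P] with ω hω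
  rw [hω]
  exact fun i _ => rfl

theorem add_mem_Mt {X Y : Lp (Fin d → ℝ) p P} (hX : X ∈ Mt P ℱ p m t) (hY : Y ∈ Mt P ℱ p m t) :
    X + Y ∈ Mt P ℱ p m t := by
  rw [mem_Mt] at *
  refine ⟨(hX.1.add hY.1).congr (Lp.coeFn_add _ _).symm, ?_⟩
  filter_upwards [Lp.coeFn_add X Y, hX.2, hY.2] with ω hω hXω hYω
  rw [hω]
  intro i hi
  rw [Pi.add_apply, Pi.add_apply, hXω i hi, hYω i hi, add_zero]

theorem smul_mem_Mt (c : ℝ) {X : Lp (Fin d → ℝ) p P} (hX : X ∈ Mt P ℱ p m t) :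
    c • X ∈ Mt P ℱ p m t := by
  rw [mem_Mt] at *
  refine ⟨(hX.1.const_smul c).congr (Lp.coeFn_smul _ _).symm, ?_⟩
  filter_upwards [Lp.coeFn_smul c X, hX.2] with ω hω hXω
  rw [hω]
  intro i hi
  rw [Pi.smul_apply, Pi.smul_apply, hXω i hi, smul_zero]

theorem sub_mem_Mt {X Y : Lp (Fin d → ℝ) p P} (hX : X ∈ Mt P ℱ p m t) (hY : Y ∈ Mt P ℱ p m t) :
    X - Y ∈ Mt P ℱ p m t := by
  rw [sub_eq_add_neg, ← neg_one_smul ℝ]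
  exact add_mem_Mt hX (smul_mem_Mt _ hY)

theorem convex_Mt : Convex ℝ (Mt P ℱ p m t : Set (Lp (Fin d → ℝ) p P)) :=
  fun _ hX _ hY _ _ _ _ _ => add_mem_Mt (smul_mem_Mt _ hX) (smul_mem_Mt _ hY)

theorem zero_mem_MtPos : (0 : Lp (Fin d → ℝ) p P) ∈ MtPos P ℱ p m t :=
  mem_MtPos.2 ⟨zero_mem_Mt, (Lp.coeFn_zero (Fin d → ℝ) p P).mono fun _ hω => hω.ge⟩

theorem exists_mem_MtPos_add_mem {X : Lp (Fin d → ℝ) p P} (hX : X ∈ Mt P ℱ p m t) :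
    ∃ e ∈ MtPos P ℱ p m t, X + e ∈ MtPos P ℱ p m t := by
  obtain ⟨hXm, hXM⟩ := mem_Mt.1 hX
  have hcont : Continuous fun x : Fin d → ℝ => (-x) ⊔ 0 :=
    continuous_pi fun i => (continuous_apply i).neg.sup continuous_const
  have hneg : MemLp (fun ω => (-X ω) ⊔ 0) p P := MemLp.of_eval fun i =>
    (((Lp.memLp X).eval i).neg).sup MemLp.zero'
  have he : hneg.toLp ∈ Mt P ℱ p m t := by
    refine mem_Mt.2 ⟨(hcont.comp_aestronglyMeasurable hXm).congr hneg.coeFn_toLp.symm, ?_⟩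
    filter_upwards [hneg.coeFn_toLp, hXM] with ω hω hXω
    rw [hω]
    intro i hi
    simp [hXω i hi]
  refine ⟨hneg.toLp, mem_MtPos.2 ⟨he, ?_⟩, mem_MtPos.2 ⟨add_mem_Mt hX he, ?_⟩⟩
  · filter_upwards [hneg.coeFn_toLp] with ω hω
    rw [hω]
    exact le_sup_right
  · filter_upwards [hneg.coeFn_toLp, Lp.coeFn_add X hneg.toLp] with ω hω hadd
    rw [hadd, Pi.add_apply, hω, ← neg_le_iff_add_nonneg']
    exact le_sup_left

theorem continuous_integral_mul_eval [Fact (1 ≤ p)] {q : ℝ≥0∞} [ENNReal.HolderConjugate p q]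
    {y : Ω → ℝ} (hy : MemLp y q P) (i : Fin d) :
    @Continuous _ _ (lpTopology P p) _
      fun X : Lp (Fin d → ℝ) p P => ∫ ω, y ω * X ω i ∂P := by
  have hsingle : MemLp (fun ω => (Pi.single i (y ω) : Fin d → ℝ)) q P := MemLp.of_eval fun j => by
    rcases eq_or_ne j i with rfl | hj
    · simpa using hy
    · simp [hj]
  have hpair : ⇑(pairing p hsingle) = fun X => ∫ ω, y ω * X ω i ∂P := funext fun X => by
    simp only [pairing_apply, single_dotProduct]
  exact hpair ▸ continuous_pairing hsingle

theorem isClosed_Mt [IsFiniteMeasure P] [Fact (1 ≤ p)] :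
    @IsClosed _ (lpTopology P p) (Mt P ℱ p m t : Set (Lp (Fin d → ℝ) p P)) := by
  let := lpTopology (d := d) P p
  obtain ⟨q, hpq⟩ : ∃ q, ENNReal.HolderConjugate p q :=
    ⟨p.conjExponent, ENNReal.HolderConjugate.conjExponent Fact.out⟩
  have hind : ∀ A, MeasurableSet A → MemLp (A.indicator 1 : Ω → ℝ) q P := fun A hA =>
    memLp_indicator_const q hA 1 (Or.inr (measure_ne_top P A))
  have hset : (Mt P ℱ p m t : Set (Lp (Fin d → ℝ) p P)) =
      {X | (∀ i, ∀ A, MeasurableSet A →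
          ∫ ω, (A.indicator 1 ω - (P[A.indicator (1 : Ω → ℝ) | ℱ t]) ω) * X ω i ∂P = 0) ∧
        ∀ i : Fin d, m ≤ (i : ℕ) → ∀ A, MeasurableSet A →
          ∫ ω, A.indicator 1 ω * X ω i ∂P = 0} := by
    ext X
    have hX : ∀ i, Integrable (fun ω => X ω i) P := fun i =>
      ((Lp.memLp X).eval i).integrable Fact.out
    rw [mem_Mt, aestronglyMeasurable_pi_iff]
    refine and_congr (forall_congr' fun i =>
      aestronglyMeasurable_iff_forall_integral_indicator_sub_condExp_mul (ℱ.le t) (hX i)) ?_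
    simp_rw [← ae_eq_zero_iff_forall_integral_indicator_mul (hX _)]
    exact ae_all_iff.trans (forall_congr' fun i => eventually_imp_distrib_left)
  rw [hset]
  simp only [Set.ofPred_and, Set.ofPred_forall]
  refine IsClosed.inter
    (isClosed_iInter fun i => isClosed_iInter fun A => isClosed_iInter fun hA => ?_)
    (isClosed_iInter fun i => isClosed_iInter fun _ => isClosed_iInter fun A =>
      isClosed_iInter fun hA => ?_)
  · exact isClosed_eq (continuous_integral_mul_eval ((hind A hA).sub
      ((hind A hA).condExp (ENNReal.HolderConjugate.one_le q p))) i) continuous_const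
  · exact isClosed_eq (continuous_integral_mul_eval (hind A hA) i) continuous_const

end Mt

/-! ### The cone `R_t(0)` -/

section Cone

theorem exists_tilt {E : Type*} [AddCommGroup E] [Module ℝ E] {K : Set E}
    (hK : ∀ c : ℝ, 0 ≤ c → ∀ k ∈ K, c • k ∈ K) {f g : E →ₗ[ℝ] ℝ} (hf : ∀ k ∈ K, 0 ≤ f k)
    (hg : ∃ k ∈ K, g k < 0) :
    ∃ c : ℝ, 0 ≤ c ∧ (∀ k ∈ K, 0 ≤ f k + c * g k) ∧
      ∀ ε : ℝ, 0 < ε → ∃ k ∈ K, g k = -1 ∧ f k + c * g k < ε := by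
  set S : Set ℝ := f '' {k | k ∈ K ∧ g k = -1}
  have hnormalize : ∀ k ∈ K, g k < 0 → f k / -g k ∈ S := fun k hk hgk =>
    ⟨(-g k)⁻¹ • k, ⟨hK _ (inv_nonneg.2 (neg_nonneg.2 hgk.le)) k hk, by
      rw [map_smul, smul_eq_mul, inv_neg, neg_mul, inv_mul_cancel₀ hgk.ne]⟩, by
      rw [map_smul, smul_eq_mul, div_eq_inv_mul]⟩
  have hSne : S.Nonempty := let ⟨k, hk, hgk⟩ := hg; ⟨_, hnormalize k hk hgk⟩
  have hS0 : ∀ s ∈ S, 0 ≤ s := by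
    rintro _ ⟨k, hk, rfl⟩
    exact hf k hk.1
  refine ⟨sInf S, le_csInf hSne hS0, fun k hk => ?_, fun ε hε => ?_⟩
  · rcases le_or_gt 0 (g k) with hgk | hgk
    · exact add_nonneg (hf k hk) (mul_nonneg (le_csInf hSne hS0) hgk)
    · have hle := csInf_le ⟨0, hS0⟩ (hnormalize k hk hgk)
      rw [le_div_iff₀ (neg_pos.2 hgk)] at hle
      linarith
  · obtain ⟨_, ⟨k, ⟨hkK, hgk⟩, rfl⟩, hlt⟩ := exists_lt_of_csInf_lt hSne (lt_add_of_pos_right _ hε)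
    exact ⟨k, hkK, hgk, by rw [hgk]; linarith⟩

theorem convex_setOf_nonpos_one_le_mul :
    Convex ℝ {x : ℝ × ℝ | x.1 ≤ 0 ∧ x.2 ≤ 0 ∧ 1 ≤ x.1 * x.2} := by
  rintro ⟨x, x'⟩ ⟨hx, hx', hxx'⟩ ⟨y, y'⟩ ⟨hy, hy', hyy'⟩ a b ha hb hab
  simp only at hx hx' hxx' hy hy' hyy'
  have hcross : 2 ≤ x * y' + y * x' := by
    have hprod : 1 ≤ (x * y') * (y * x') := by nlinarith
    nlinarith [sq_nonneg (x * y' - y * x'), mul_nonneg_of_nonpos_of_nonpos hx hy',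
      mul_nonneg_of_nonpos_of_nonpos hy hx']
  simp only [Set.mem_ofPred_eq, Prod.smul_mk, Prod.mk_add_mk, smul_eq_mul]
  refine ⟨by nlinarith, by nlinarith, ?_⟩
  calc (1 : ℝ) = (a + b) ^ 2 := by rw [hab, one_pow]
    _ = a ^ 2 * 1 + a * b * 2 + b ^ 2 * 1 := by ring
    _ ≤ a ^ 2 * (x * x') + a * b * (x * y' + y * x') + b ^ 2 * (y * y') := by gcongr
    _ = (a * x + b * y) * (a * x' + b * y') := by ring

variable {Ω : Type*} {mΩ : MeasurableSpace Ω} {P : Measure Ω} {ι : Type*} [LinearOrder ι]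
  {ℱ : Filtration ι mΩ} {d m : ℕ} {p : ℝ≥0∞} {t : ι}
  {R : Lp (Fin d → ℝ) p P → Set (Lp (Fin d → ℝ) p P)} {R0 : Ω → Set (Fin d → ℝ)}

theorem ConditionallyConvex.combo_mem (hconv : ConditionallyConvex ℱ t R)
    {X Y u v : Lp (Fin d → ℝ) p P} (hu : u ∈ R X) (hv : v ∈ R Y) {a b : ℝ} (ha : 0 ≤ a)
    (hb : 0 ≤ b) (hab : a + b = 1) : a • u + b • v ∈ R (a • X + b • Y) := by
  obtain rfl : b = 1 - a := eq_sub_of_add_eq' hab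
  have hcoe : ∀ X Y : Lp (Fin d → ℝ) p P, (a • X + (1 - a) • Y : Lp (Fin d → ℝ) p P) =ᵐ[P]
      fun ω => a • X ω + (1 - a) • Y ω := fun X Y => by
    filter_upwards [Lp.coeFn_add (a • X) ((1 - a) • Y), Lp.coeFn_smul a X,
      Lp.coeFn_smul (1 - a) Y] with ω hadd hX hY
    rw [hadd, Pi.add_apply, hX, hY, Pi.smul_apply, Pi.smul_apply]
  exact hconv X Y _ (fun _ => a) aestronglyMeasurable_const
    (ae_of_all _ fun _ => ⟨ha, sub_nonneg.1 hb⟩) (hcoe X Y) u hu v hv _ (hcoe u v)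

theorem ConditionallyConvex.convex (hconv : ConditionallyConvex ℱ t R) (X : Lp (Fin d → ℝ) p P) :
    Convex ℝ (R X) := fun u hu v hv a b ha hb hab => by
  simpa only [Convex.combo_self hab] using hconv.combo_mem hu hv ha hb hab

theorem Normalized.add_mem (hnorm : Normalized R) {u v : Lp (Fin d → ℝ) p P} (hu : u ∈ R 0)
    (hv : v ∈ R 0) : u + v ∈ R 0 := by
  rw [hnorm 0]
  exact Set.add_mem_add hu hv

variable (P ℱ m t) in
/-- The eligible portfolios on which `(F, G)` lies on or below the lower branch of the hyperbola
`x * y = 1`: a test set for convex upper continuity on which `F` is negative, although `F` comes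
arbitrarily close to `0` where `G` is large and negative. -/
def hyperbolicSet (F G : Lp (Fin d → ℝ) p P →ₗ[ℝ] ℝ) : Set (Lp (Fin d → ℝ) p P) :=
  {u | u ∈ Mt P ℱ p m t ∧ F u ≤ 0 ∧ G u ≤ 0 ∧ 1 ≤ F u * G u}

variable [Fact (1 ≤ p)]

theorem zero_mem_zero (hR : IsConditionalRiskMeasure P ℱ p m t R R0) (hnorm : Normalized R)
    (hconv : ConditionallyConvex ℱ t R) : (0 : Lp (Fin d → ℝ) p P) ∈ R 0 := by
  have hhalf : ∀ u ∈ R 0, (1 / 2 : ℝ) • u ∈ R 0 := by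
    intro u hu
    rw [hnorm 0] at hu
    obtain ⟨a, ha, b, hb, rfl⟩ := hu
    rw [smul_add]
    exact hconv.convex 0 ha hb (by norm_num) (by norm_num) (by norm_num)
  obtain ⟨u, hu⟩ := hR.nonempty_zero
  have hpow : ∀ n : ℕ, ((1 / 2 : ℝ) ^ n) • u ∈ R 0 := by
    intro n
    induction n with
    | zero => rwa [pow_zero, one_smul]
    | succ n ih => rw [pow_succ', mul_smul]; exact hhalf _ ih
  let := lpTopology (d := d) P p
  have := continuousSMul_lpTopology (d := d) (P := P) (p := p)
  have hlim : Tendsto (fun n : ℕ => ((1 / 2 : ℝ) ^ n) • u) atTop (nhds ((0 : ℝ) • u)) :=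
    (tendsto_pow_atTop_nhds_zero_of_lt_one (by norm_num) (by norm_num)).smul tendsto_const_nhds
  rw [zero_smul] at hlim
  exact hR.closed_zero.mem_of_tendsto hlim (Eventually.of_forall hpow)

theorem smul_mem_zero (hR : IsConditionalRiskMeasure P ℱ p m t R R0) (hnorm : Normalized R)
    (hconv : ConditionallyConvex ℱ t R) {c : ℝ} (hc : 0 ≤ c) {u : Lp (Fin d → ℝ) p P}
    (hu : u ∈ R 0) : c • u ∈ R 0 := by
  have h0 := zero_mem_zero hR hnorm hconv
  have hnat : ∀ n : ℕ, (n : ℝ) • u ∈ R 0 := by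
    intro n
    induction n with
    | zero => rwa [Nat.cast_zero, zero_smul]
    | succ n ih =>
      rw [Nat.cast_succ, add_smul, one_smul]
      exact hnorm.add_mem ih hu
  obtain ⟨n, hn⟩ := exists_nat_gt c
  have hn0 : (0 : ℝ) < n := hc.trans_lt hn
  have hmem := (hconv.convex 0).smul_mem_of_zero_mem h0 (hnat n)
    ⟨div_nonneg hc hn0.le, (div_le_one hn0).2 hn.le⟩
  rwa [smul_smul, div_mul_cancel₀ _ hn0.ne'] at hmem

theorem mtPos_subset_zero (hR : IsConditionalRiskMeasure P ℱ p m t R R0) (hnorm : Normalized R)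
    (hconv : ConditionallyConvex ℱ t R) : MtPos P ℱ p m t ⊆ R 0 := fun u hu => by
  rw [hR.upper 0]
  exact ⟨0, zero_mem_zero hR hnorm hconv, u, hu, zero_add u⟩

theorem exists_nonneg_on_zero_pos_on_mtPos (hR : IsConditionalRiskMeasure P ℱ p m t R R0)
    (hnorm : Normalized R) (hconv : ConditionallyConvex ℱ t R)
    (hne : ∃ x ∈ Mt P ℱ p m t, x ∉ R 0) :
    ∃ f : Lp (Fin d → ℝ) p P →ₗ[ℝ] ℝ, @Continuous _ _ (lpTopology P p) _ f ∧
      (∀ k ∈ R 0, 0 ≤ f k) ∧ ∃ e ∈ MtPos P ℱ p m t, 0 < f e := by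
  let := lpTopology (d := d) P p
  have := isTopologicalAddGroup_lpTopology (d := d) (P := P) (p := p)
  have := continuousSMul_lpTopology (d := d) (P := P) (p := p)
  have := locallyConvexSpace_lpTopology (d := d) (P := P) (p := p)
  obtain ⟨x, hxM, hx⟩ := hne
  obtain ⟨f, a, hfx, hfa⟩ :=
    geometric_hahn_banach_point_closed (hconv.convex 0) hR.closed_zero hx
  have ha : a < 0 := by simpa only [map_zero] using hfa 0 (zero_mem_zero hR hnorm hconv)
  have hf : ∀ k ∈ R 0, 0 ≤ f k := by
    intro k hk
    by_contra! hneg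
    have hscaled := hfa _ (smul_mem_zero hR hnorm hconv (div_pos_of_neg_of_neg ha hneg).le hk)
    rw [map_smul, smul_eq_mul, div_mul_cancel₀ _ hneg.ne] at hscaled
    exact lt_irrefl _ hscaled
  obtain ⟨e, he, hxe⟩ := exists_mem_MtPos_add_mem hxM
  have hfxe := hf _ (mtPos_subset_zero hR hnorm hconv hxe)
  rw [map_add] at hfxe
  exact ⟨f.toLinearMap, f.continuous, hf, e, he, by
    rw [ContinuousLinearMap.coe_coe]; linarith⟩

theorem mem_lowerClosedConvex {D : Set (Lp (Fin d → ℝ) p P)} (hD : D ⊆ Mt P ℱ p m t)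
    (hconv : Convex ℝ D) (hcl : @IsClosed _ (lpTopology P p) D)
    (hlow : ∀ u ∈ D, ∀ e ∈ MtPos P ℱ p m t, u - e ∈ D) : D ∈ lowerClosedConvex P ℱ p m t := by
  refine ⟨hD, ?_⟩
  have hadd : D + -MtPos P ℱ p m t = D := by
    refine Set.Subset.antisymm ?_ fun u hu =>
      ⟨u, hu, 0, by simpa using! zero_mem_MtPos, add_zero u⟩
    rintro _ ⟨u, hu, e, he, rfl⟩
    simpa using hlow u hu (-e) he
  rw [hadd, hconv.convexHull_eq, @IsClosed.closure_eq _ (lpTopology P p) _ hcl]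

theorem hyperbolicSet_mem_lowerClosedConvex [IsFiniteMeasure P]
    {F G : Lp (Fin d → ℝ) p P →ₗ[ℝ] ℝ}
    (hFc : @Continuous _ _ (lpTopology P p) _ F) (hGc : @Continuous _ _ (lpTopology P p) _ G)
    (hF : ∀ e ∈ MtPos P ℱ p m t, 0 ≤ F e) (hG : ∀ e ∈ MtPos P ℱ p m t, 0 ≤ G e) :
    hyperbolicSet P ℱ m t F G ∈ lowerClosedConvex P ℱ p m t := by
  let := lpTopology (d := d) P p
  refine mem_lowerClosedConvex (fun u hu => hu.1)
    (convex_Mt.inter (convex_setOf_nonpos_one_le_mul.linear_preimage (F.prod G)))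
    (isClosed_Mt.inter ((isClosed_le hFc continuous_const).inter
      ((isClosed_le hGc continuous_const).inter (isClosed_le continuous_const (hFc.mul hGc)))))
    fun u hu e he => ⟨sub_mem_Mt hu.1 (mem_MtPos.1 he).1, ?_⟩
  have hFe := hF e he
  have hGe := hG e he
  obtain ⟨-, hFu, hGu, huu⟩ := hu
  rw [map_sub, map_sub]
  exact ⟨by linarith, by linarith, by nlinarith⟩

theorem zero_translate_inter_hyperbolicSet_nonempty
    (hR : IsConditionalRiskMeasure P ℱ p m t R R0) (hnorm : Normalized R)
    (hconv : ConditionallyConvex ℱ t R) {F G : Lp (Fin d → ℝ) p P →ₗ[ℝ] ℝ}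
    {e : Lp (Fin d → ℝ) p P} (he : e ∈ MtPos P ℱ p m t) (hFe : 0 < F e) (hGe : 0 ≤ G e)
    (hFG : ∀ ε : ℝ, 0 < ε → ∃ k ∈ R 0, G k = -1 ∧ F k < ε) {σ : ℝ} (hσ : 0 < σ) :
    (R (σ • e) ∩ hyperbolicSet P ℱ m t F G).Nonempty := by
  set b : ℝ := σ * F e / 2 with hb
  have hb0 : 0 < b := by positivity
  obtain ⟨k, hk, hGk, hFk⟩ := hFG (b ^ 2) (by positivity)
  have hσe : σ • e ∈ Mt P ℱ p m t := smul_mem_Mt σ (mem_MtPos.1 he).1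
  have hFu : F (b⁻¹ • k - σ • e) ≤ -b := by
    have hFk' : b⁻¹ * F k ≤ b := by
      rw [inv_mul_le_iff₀ hb0, ← sq]
      exact hFk.le
    rw [map_sub, map_smul, map_smul, smul_eq_mul, smul_eq_mul]
    linarith
  have hGu : G (b⁻¹ • k - σ • e) ≤ -b⁻¹ := by
    rw [map_sub, map_smul, map_smul, smul_eq_mul, smul_eq_mul, hGk, mul_neg_one]
    linarith [mul_nonneg hσ.le hGe]
  have hbinv : 0 < b⁻¹ := inv_pos.2 hb0
  refine ⟨b⁻¹ • k - σ • e, ?_, sub_mem_Mt (smul_mem_Mt _ (hR.subset_eligible 0 hk)) hσe,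
    by linarith, by linarith, ?_⟩
  · have htrans := hR.translative 0 (σ • e) hσe
    rw [zero_add] at htrans
    rw [htrans]
    exact ⟨_, smul_mem_zero hR hnorm hconv hbinv.le hk, rfl⟩
  · calc (1 : ℝ) = -b * -b⁻¹ := by rw [neg_mul_neg, mul_inv_cancel₀ hb0.ne']
      _ ≤ _ := mul_le_mul_of_nonpos_of_nonpos hFu hGu (by linarith) (by linarith)

theorem nonneg_on_zero_of_convexUpperContinuous [IsFiniteMeasure P]
    (hR : IsConditionalRiskMeasure P ℱ p m t R R0) (hnorm : Normalized R)
    (hconv : ConditionallyConvex ℱ t R) (hcuc : ConvexUpperContinuous ℱ m t R)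
    (hne : ∃ x ∈ Mt P ℱ p m t, x ∉ R 0) {g : Lp (Fin d → ℝ) p P →ₗ[ℝ] ℝ}
    (hgc : @Continuous _ _ (lpTopology P p) _ g) (hg : ∀ e ∈ MtPos P ℱ p m t, 0 ≤ g e) :
    ∀ k ∈ R 0, 0 ≤ g k := by
  let := lpTopology (d := d) P p
  have := continuousSMul_lpTopology (d := d) (P := P) (p := p)
  obtain ⟨f, hfc, hf, e, he, hfe⟩ := exists_nonneg_on_zero_pos_on_mtPos hR hnorm hconv hne
  by_contra! hneg
  obtain ⟨c, hc, hF, hFε⟩ := exists_tilt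
    (fun a ha _ hk => smul_mem_zero hR hnorm hconv ha hk) hf hneg
  let F : Lp (Fin d → ℝ) p P →ₗ[ℝ] ℝ := f + c • g
  have hFc : Continuous F := hfc.add (continuous_const.mul hgc)
  have hFe : 0 < F e := add_pos_of_pos_of_nonneg hfe (mul_nonneg hc (hg e he))
  have hD : hyperbolicSet P ℱ m t F g ∈ lowerClosedConvex P ℱ p m t :=
    hyperbolicSet_mem_lowerClosedConvex hFc hgc
      (fun k hk => hF k (mtPos_subset_zero hR hnorm hconv hk)) hg
  have hmeets : ∀ n : ℕ, (R ((1 / ((n : ℝ) + 1)) • e) ∩ hyperbolicSet P ℱ m t F g).Nonempty :=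
    fun n => zero_translate_inter_hyperbolicSet_nonempty hR hnorm hconv he hFe (hg e he) hFε
      (by positivity)
  have hlim : Tendsto (fun n : ℕ => (1 / ((n : ℝ) + 1)) • e) atTop (nhds ((0 : ℝ) • e)) :=
    tendsto_one_div_add_atTop_nhds_zero_nat.smul tendsto_const_nhds
  rw [zero_smul] at hlim
  obtain ⟨u, huR, -, hFu, -, hone⟩ :=
    (hcuc _ hD).mem_of_tendsto hlim (Eventually.of_forall hmeets)
  have hFu0 : F u = 0 := le_antisymm hFu (hF u huR)
  rw [hFu0, zero_mul] at hone
  exact one_pos.not_ge hone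

end Cone

/-! ### Measurable selections of random closed sets -/

section KuratowskiRyllNardzewski

variable {Ω E : Type*} {mΩ : MeasurableSpace Ω}

theorem exists_measurable_refinement [TopologicalSpace E] {K : Ω → Set E}
    (hK : ∀ G : Set E, IsOpen G → MeasurableSet {ω | (K ω ∩ G).Nonempty}) {U V : ℕ → Set E}
    (hU : ∀ n, IsOpen (U n)) (hV : ∀ n, IsOpen (V n)) (hcover : ∀ x, ∃ n, x ∈ V n) {N : Ω → ℕ}
    (hN : Measurable N) (hne : ∀ ω, (K ω ∩ U (N ω)).Nonempty) :
    ∃ N' : Ω → ℕ, Measurable N' ∧ ∀ ω, (K ω ∩ (U (N ω) ∩ V (N' ω))).Nonempty := by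
  classical
  have hex : ∀ ω, ∃ n, (K ω ∩ (U (N ω) ∩ V n)).Nonempty := fun ω =>
    let ⟨x, hxK, hxU⟩ := hne ω
    let ⟨n, hn⟩ := hcover x
    ⟨n, x, hxK, hxU, hn⟩
  have hmeas : ∀ n, MeasurableSet {ω | (K ω ∩ (U (N ω) ∩ V n)).Nonempty} := fun n => by
    have hunion : {ω | (K ω ∩ (U (N ω) ∩ V n)).Nonempty} =
        ⋃ j, N ⁻¹' {j} ∩ {ω | (K ω ∩ (U j ∩ V n)).Nonempty} := by
      ext ω
      simp
    rw [hunion]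
    exact MeasurableSet.iUnion fun j =>
      (hN (measurableSet_singleton j)).inter (hK _ ((hU j).inter (hV n)))
  exact ⟨fun ω => Nat.find (hex ω), measurable_find hex hmeas, fun ω => Nat.find_spec (hex ω)⟩

theorem exists_measurable_refining_seq [TopologicalSpace E] {K : Ω → Set E}
    (hK : ∀ G : Set E, IsOpen G → MeasurableSet {ω | (K ω ∩ G).Nonempty})
    (hne : ∀ ω, (K ω).Nonempty) {V : ℕ → ℕ → Set E} (hV : ∀ k n, IsOpen (V k n))
    (hcover : ∀ k x, ∃ n, x ∈ V k n) :
    ∃ N : ℕ → Ω → ℕ, (∀ k, Measurable (N k)) ∧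
      ∀ k ω, (K ω ∩ (V k (N k ω) ∩ V (k + 1) (N (k + 1) ω))).Nonempty := by
  let T : ℕ → Type _ := fun k => {N : Ω → ℕ // Measurable N ∧ ∀ ω, (K ω ∩ V k (N ω)).Nonempty}
  obtain ⟨N₀, hN₀, hKN₀⟩ := exists_measurable_refinement hK (U := fun _ => Set.univ)
    (fun _ => isOpen_univ) (hV 0) (hcover 0) (measurable_const (a := 0))
    fun ω => by simpa only [Set.inter_univ] using hne ω
  simp only [Set.univ_inter] at hKN₀
  have hstep : ∀ k (N : T k), ∃ N' : T (k + 1),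
      ∀ ω, (K ω ∩ (V k (N.1 ω) ∩ V (k + 1) (N'.1 ω))).Nonempty := fun k N => by
    obtain ⟨N', hN', hKN'⟩ :=
      exists_measurable_refinement hK (hV k) (hV (k + 1)) (hcover (k + 1)) N.2.1 N.2.2
    exact ⟨⟨N', hN', fun ω => (hKN' ω).mono
      (Set.inter_subset_inter_right _ Set.inter_subset_right)⟩, hKN'⟩
  choose next hnext using hstep
  let N : ∀ k, T k := fun k => Nat.rec ⟨N₀, hN₀, hKN₀⟩ next k
  exact ⟨fun k => (N k).1, fun k => (N k).2.1, fun k => hnext k (N k)⟩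

theorem exists_measurable_selection_of_nonempty [MetricSpace E] [CompleteSpace E]
    [TopologicalSpace.SeparableSpace E] [MeasurableSpace E] [BorelSpace E] [Nonempty E]
    {K : Ω → Set E} (hcl : ∀ ω, IsClosed (K ω))
    (hK : ∀ G : Set E, IsOpen G → MeasurableSet {ω | (K ω ∩ G).Nonempty})
    (hne : ∀ ω, (K ω).Nonempty) : ∃ f : Ω → E, Measurable f ∧ ∀ ω, f ω ∈ K ω := by
  let c := TopologicalSpace.denseSeq E
  let r : ℕ → ℝ := fun k => (1 / 2) ^ k
  have hr : Tendsto r atTop (nhds 0) :=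
    tendsto_pow_atTop_nhds_zero_of_lt_one (by norm_num) (by norm_num)
  obtain ⟨N, hN, hKN⟩ := exists_measurable_refining_seq hK hne
    (V := fun k n => Metric.ball (c n) (r k)) (fun _ _ => Metric.isOpen_ball) fun k x =>
      (TopologicalSpace.denseRange_denseSeq E).exists_dist_lt x (by positivity)
  have hcauchy : ∀ ω, CauchySeq fun k => c (N k ω) := fun ω => by
    refine cauchySeq_of_le_geometric (1 / 2) 2 (by norm_num) fun k => ?_
    obtain ⟨x, -, hxk, hxk'⟩ := hKN k ω
    calc dist (c (N k ω)) (c (N (k + 1) ω)) ≤ dist x (c (N k ω)) + dist x (c (N (k + 1) ω)) :=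
          dist_triangle_left _ _ _
      _ ≤ r k + r (k + 1) := add_le_add hxk.le hxk'.le
      _ ≤ 2 * r k := by
        have hrk : 0 < r k := by positivity
        have hhalf : r (k + 1) = r k / 2 := by simp only [r, pow_succ]; ring
        linarith
  choose f hf using fun ω => cauchySeq_tendsto_of_complete (hcauchy ω)
  refine ⟨f, measurable_of_tendsto_metrizable
    (fun k => (measurable_from_nat (f := c)).comp (hN k)) (tendsto_pi_nhds.2 hf), fun ω => ?_⟩
  choose y hyK hy using fun k => hKN k ω
  refine (hcl ω).mem_of_tendsto (b := atTop) (f := y) ?_ (Eventually.of_forall hyK)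
  refine (tendsto_iff_of_dist ?_).1 (hf ω)
  exact squeeze_zero (fun _ => dist_nonneg)
    (fun k => (dist_comm _ _).trans_le (Metric.mem_ball.1 (hy k).1).le) hr

theorem exists_measurable_selection [MetricSpace E] [CompleteSpace E]
    [TopologicalSpace.SeparableSpace E] [MeasurableSpace E] [BorelSpace E] [Nonempty E]
    {K : Ω → Set E} (hcl : ∀ ω, IsClosed (K ω))
    (hK : ∀ G : Set E, IsOpen G → MeasurableSet {ω | (K ω ∩ G).Nonempty}) :
    ∃ f : Ω → E, Measurable f ∧ ∀ ω, (K ω).Nonempty → f ω ∈ K ω := by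
  refine exists_measurable_selection_of_nonempty (K := fun ω => {x | (K ω).Nonempty → x ∈ K ω})
    (fun ω => ?_) (fun G hG => ?_) fun ω => ?_
  · by_cases hω : (K ω).Nonempty
    · simpa only [hω, true_imp_iff] using! hcl ω
    · simp only [hω, false_imp_iff, Set.ofPred_true, isClosed_univ]
  · have hunion : {ω | ({x | (K ω).Nonempty → x ∈ K ω} ∩ G).Nonempty} =
        {ω | (K ω ∩ G).Nonempty} ∪ ({ω | (K ω ∩ Set.univ).Nonempty}ᶜ ∩ {_ω | G.Nonempty}) := by
      ext ω
      by_cases hω : (K ω).Nonempty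
      · simp [hω]
      · simp [Set.not_nonempty_iff_eq_empty.1 hω]
    rw [hunion]
    exact (hK G hG).union ((hK _ isOpen_univ).compl.inter (MeasurableSet.const _))
  · by_cases hω : (K ω).Nonempty
    · exact hω.mono fun x hx _ => hx
    · exact Set.univ_nonempty.mono fun x _ h => absurd h hω

end KuratowskiRyllNardzewski

section RandomClosedSet

theorem aestronglyMeasurable_indicator {Ω E : Type*} {m' mΩ : MeasurableSpace Ω} {P : Measure Ω}
    [TopologicalSpace E] [Zero E] {f : Ω → E} (hf : AEStronglyMeasurable[m'] f P) {A : Set Ω}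
    (hA : MeasurableSet[m'] A) : AEStronglyMeasurable[m'] (A.indicator f) P := by
  refine ⟨A.indicator (hf.mk f), hf.stronglyMeasurable_mk.indicator hA, ?_⟩
  filter_upwards [hf.ae_eq_mk] with ω hω
  by_cases hωA : ω ∈ A <;> simp [hωA, hω]

variable {Ω : Type*} {mΩ : MeasurableSpace Ω} {P : Measure Ω} {ι : Type*} [LinearOrder ι]
  {ℱ : Filtration ι mΩ} {d : ℕ} {p : ℝ≥0∞} {t : ι} {K : Ω → Set (Fin d → ℝ)}

theorem isRandomClosedSet_const {C : Set (Fin d → ℝ)} (hC : IsClosed C) :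
    IsRandomClosedSet ℱ t fun _ => C :=
  ⟨fun _ => hC, fun _ _ => MeasurableSet.const _⟩

theorem IsRandomClosedSet.exists_selection_closedBall (hK : IsRandomClosedSet ℱ t K)
    (c : Fin d → ℝ) (r : ℝ) : ∃ f : Ω → Fin d → ℝ, Measurable[ℱ t] f ∧
      ∀ ω, (K ω ∩ Metric.ball c r).Nonempty → f ω ∈ K ω ∩ Metric.closedBall c r := by
  obtain ⟨f, hf, hfK⟩ := exists_measurable_selection (mΩ := ℱ t)
    (K := fun ω => closure (K ω ∩ Metric.ball c r)) (fun ω => isClosed_closure) fun G hG => by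
      simp only [closure_inter_open_nonempty_iff hG, Set.inter_assoc]
      exact hK.measurable _ (Metric.isOpen_ball.inter hG)
  exact ⟨f, hf, fun ω hω => closure_minimal
    (Set.inter_subset_inter_right _ Metric.ball_subset_closedBall)
    ((hK.closed ω).inter Metric.isClosed_closedBall) (hfK ω hω.closure)⟩

theorem exists_mem_Lt_eq_on [IsFiniteMeasure P] {D : Ω → Set (Fin d → ℝ)}
    (hne : (Lt P ℱ p t D).Nonempty) {A : Set Ω} (hA : MeasurableSet[ℱ t] A) {f : Ω → Fin d → ℝ}
    (hf : Measurable[ℱ t] f) {C : ℝ} (hC : ∀ ω ∈ A, ‖f ω‖ ≤ C) (hfD : ∀ ω ∈ A, f ω ∈ D ω) :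
    ∃ u ∈ Lt P ℱ p t D, ∀ᵐ ω ∂P, ω ∈ A → u ω = f ω := by
  obtain ⟨v, hvm, hvp, hvD⟩ := hne
  have hfm : AEStronglyMeasurable[ℱ t] f P := hf.stronglyMeasurable.aestronglyMeasurable
  have hbound : MemLp (A.indicator f) p P := by
    refine MemLp.of_bound ((hfm.mono (ℱ.le t)).indicator (ℱ.le t _ hA)) (max C 0)
      (ae_of_all _ fun ω => ?_)
    by_cases hω : ω ∈ A
    · rw [Set.indicator_of_mem hω]
      exact (hC ω hω).trans (le_max_left _ _)
    · rw [Set.indicator_of_notMem hω, norm_zero]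
      exact le_max_right _ _
  have hu : MemLp (A.indicator f + Aᶜ.indicator v) p P :=
    hbound.add (hvp.indicator (ℱ.le t _ hA).compl)
  refine ⟨hu.toLp, ⟨?_, Lp.memLp _, ?_⟩, ?_⟩
  · exact ((aestronglyMeasurable_indicator hfm hA).add
      (aestronglyMeasurable_indicator hvm hA.compl)).congr hu.coeFn_toLp.symm
  · filter_upwards [hu.coeFn_toLp, hvD] with ω hω hvω
    rw [hω]
    by_cases hωA : ω ∈ A
    · simpa [hωA] using hfD ω hωA
    · simpa [hωA] using hvω
  · filter_upwards [hu.coeFn_toLp] with ω hω hωA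
    simp [hω, hωA]

theorem IsRandomClosedSet.ae_subset_of_forall_Lt [IsFiniteMeasure P]
    (hK : IsRandomClosedSet ℱ t K) (hne : (Lt P ℱ p t K).Nonempty) {C : Ω → Set (Fin d → ℝ)}
    (hC : ∀ ω, IsClosed (C ω)) (hKC : ∀ u ∈ Lt P ℱ p t K, ∀ᵐ ω ∂P, u ω ∈ C ω) :
    ∀ᵐ ω ∂P, K ω ⊆ C ω := by
  let c := TopologicalSpace.denseSeq (Fin d → ℝ)
  let r : ℕ → ℝ := fun k => 1 / ((k : ℝ) + 1)
  have hr : Tendsto r atTop (nhds 0) := tendsto_one_div_add_atTop_nhds_zero_nat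
  choose f hfm hf using fun n k : ℕ => hK.exists_selection_closedBall (c n) (r k)
  have hselection : ∀ n k, ∀ᵐ ω ∂P, (K ω ∩ Metric.ball (c n) (r k)).Nonempty → f n k ω ∈ C ω := by
    intro n k
    obtain ⟨u, hu, huf⟩ := exists_mem_Lt_eq_on hne (hK.measurable _ Metric.isOpen_ball) (hfm n k)
      (fun ω hω => norm_le_of_mem_closedBall (hf n k ω hω).2) fun ω hω => (hf n k ω hω).1
    filter_upwards [hKC u hu, huf] with ω huC hω hmem
    exact hω hmem ▸ huC
  filter_upwards [ae_all_iff.2 fun n => ae_all_iff.2 fun k => hselection n k] with ω hω x hx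
  choose n hn using fun k : ℕ =>
    (TopologicalSpace.denseRange_denseSeq (Fin d → ℝ)).exists_dist_lt x
      (show 0 < r k by positivity)
  have hlim : Tendsto (fun k => f (n k) k ω) atTop (nhds x) := by
    rw [tendsto_iff_dist_tendsto_zero]
    refine squeeze_zero (fun _ => dist_nonneg) (fun k => ?_)
      (by simpa only [add_zero] using hr.add hr)
    refine (dist_triangle_right _ _ (c (n k))).trans (add_le_add ?_ (hn k).le)
    exact Metric.mem_closedBall.1 (hf (n k) k ω ⟨x, hx, hn k⟩).2
  exact (hC ω).mem_of_tendsto hlim (Eventually.of_forall fun k => hω _ _ ⟨x, hx, hn k⟩)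

end RandomClosedSet

section DualCone

variable {Ω : Type*} {mΩ : MeasurableSpace Ω} {P : Measure Ω}

theorem ae_nonneg_of_forall_setIntegral_nonneg_of_aestronglyMeasurable {m' : MeasurableSpace Ω}
    (hm' : m' ≤ mΩ) {f : Ω → ℝ} (hfm : AEStronglyMeasurable[m'] f P) (hf : Integrable f P)
    (hfB : ∀ B, MeasurableSet[m'] B → 0 ≤ ∫ ω in B, f ω ∂P) : ∀ᵐ ω ∂P, 0 ≤ f ω := by
  have hmk := hfm.stronglyMeasurable_mk
  have hpos : 0 ≤ᵐ[P.trim hm'] hfm.mk f := by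
    refine ae_nonneg_of_forall_setIntegral_nonneg
      ((hf.congr hfm.ae_eq_mk).trim hm' hmk) fun B hB _ => ?_
    rw [← setIntegral_trim hm' hmk hB, ← integral_congr_ae (ae_restrict_of_ae hfm.ae_eq_mk)]
    exact hfB B hB
  filter_upwards [ae_of_ae_trim hm' hpos, hfm.ae_eq_mk] with ω hω heq
  exact heq ▸ hω

theorem aestronglyMeasurable_dotProduct {κ : Type*} [Fintype κ] {m' : MeasurableSpace Ω}
    {f g : Ω → κ → ℝ} (hf : AEStronglyMeasurable[m'] f P) (hg : AEStronglyMeasurable[m'] g P) :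
    AEStronglyMeasurable[m'] (fun ω => f ω ⬝ᵥ g ω) P :=
  (continuous_fst.dotProduct continuous_snd).comp_aestronglyMeasurable (hf.prodMk hg)

theorem exists_glue {E : Type*} [NormedAddCommGroup E] {p : ℝ≥0∞} {B : Set Ω}
    (hB : MeasurableSet B) (X Y : Lp E p P) :
    ∃ Z : Lp E p P, Z =ᵐ[P] fun ω => B.indicator X ω + Bᶜ.indicator Y ω := by
  have hZ : MemLp (B.indicator X + Bᶜ.indicator Y) p P :=
    ((Lp.memLp X).indicator hB).add ((Lp.memLp Y).indicator hB.compl)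
  exact ⟨hZ.toLp, hZ.coeFn_toLp⟩

theorem isClosed_eligible {d m : ℕ} : IsClosed (eligible d m) := by
  simp only [eligible, Set.ofPred_forall]
  exact isClosed_iInter fun i => isClosed_iInter fun _ =>
    isClosed_eq (continuous_apply i) continuous_const

variable {ι : Type*} [LinearOrder ι] {ℱ : Filtration ι mΩ} {d m : ℕ} {p q : ℝ≥0∞} {t : ι}
  [Fact (1 ≤ p)] {R : Lp (Fin d → ℝ) p P → Set (Lp (Fin d → ℝ) p P)} {R0 : Ω → Set (Fin d → ℝ)}

theorem exists_mem_Mt_notMem_zero [IsProbabilityMeasure P]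
    (hR : IsConditionalRiskMeasure P ℱ p m t R R0) : ∃ x ∈ Mt P ℱ p m t, x ∉ R 0 := by
  by_contra! hsub
  have hR0M : ∀ᵐ ω ∂P, R0 ω ⊆ eligible d m := by
    refine hR.randomSet.ae_subset_of_forall_Lt (p := p) (hR.zero_eq ▸ hR.nonempty_zero)
      (fun _ => isClosed_eligible) fun u hu => ?_
    rw [← hR.zero_eq] at hu
    exact (hR.subset_eligible 0 hu).2.2
  have hMR0 : ∀ᵐ ω ∂P, eligible d m ⊆ R0 ω := by
    refine (isRandomClosedSet_const isClosed_eligible).ae_subset_of_forall_Lt (ℱ := ℱ) (t := t)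
      (p := p) ⟨0, zero_mem_Mt⟩ hR.randomSet.closed fun u hu => ?_
    have huR := hsub u hu
    rw [hR.zero_eq] at huR
    exact huR.2.2
  obtain ⟨ω, ⟨hle, hge⟩, hne⟩ := ((hR0M.and hMR0).and hR.ne_eligible).exists
  exact hne (hle.antisymm hge)

variable [ENNReal.HolderConjugate p q]

theorem dotProduct_nonneg_of_pairing_nonneg_on_zero
    (hR : IsConditionalRiskMeasure P ℱ p m t R R0) (h0 : 0 ∈ R 0) {w : Ω → Fin d → ℝ}
    (hwm : AEStronglyMeasurable[ℱ t] w P) (hwq : MemLp w q P)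
    (hpos : ∀ k ∈ R 0, 0 ≤ pairing p hwq k) : ∀ u ∈ R 0, ∀ᵐ ω ∂P, 0 ≤ w ω ⬝ᵥ u ω := by
  intro u hu
  refine ae_nonneg_of_forall_setIntegral_nonneg_of_aestronglyMeasurable (ℱ.le t)
    (aestronglyMeasurable_dotProduct hwm (hR.subset_eligible 0 hu).1)
    (integrable_dotProduct hwq (Lp.memLp u)) fun B hB => ?_
  obtain ⟨Z, hZ⟩ := exists_glue (ℱ.le t _ hB) u 0
  have hZpos := hpos Z (hR.decomposable_zero B hB u hu 0 h0 Z hZ)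
  rw [pairing_apply] at hZpos
  rw [← integral_indicator (ℱ.le t _ hB)]
  refine hZpos.trans_eq (integral_congr_ae ?_)
  filter_upwards [hZ, Lp.coeFn_zero (Fin d → ℝ) p P] with ω hω hω0
  by_cases hωB : ω ∈ B
  · simp [hω, hωB]
  · rw [hω, Set.indicator_of_notMem hωB, Set.indicator_of_mem (Set.mem_compl hωB), hω0]
    simp [hωB]

theorem memLt_dualCone [IsProbabilityMeasure P] (hR : IsConditionalRiskMeasure P ℱ p m t R R0)
    (hnorm : Normalized R) (hconv : ConditionallyConvex ℱ t R)
    (hcuc : ConvexUpperContinuous ℱ m t R) {w : Ω → Fin d → ℝ}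
    (hw : MemLt P ℱ q t (fun _ => dualCone (eligiblePos d m) \ orth (eligible d m)) w) :
    MemLt P ℱ q t (fun ω => dualCone (R0 ω) \ orth (eligible d m)) w := by
  obtain ⟨hwm, hwq, hwv⟩ := hw
  refine ⟨hwm, hwq, ?_⟩
  have hpos : ∀ k ∈ R 0, 0 ≤ pairing p hwq k :=
    nonneg_on_zero_of_convexUpperContinuous hR hnorm hconv hcuc (exists_mem_Mt_notMem_zero hR)
      (continuous_pairing hwq) fun e he => integral_nonneg_of_ae <| by
        filter_upwards [hwv, he.2.2] with ω hwω heω using hwω.1 _ heω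
  have hsubset := hR.randomSet.ae_subset_of_forall_Lt (p := p)
    (hR.zero_eq ▸ hR.nonempty_zero) (C := fun ω => {x | 0 ≤ w ω ⬝ᵥ x})
    (fun ω => isClosed_le continuous_const (continuous_const.dotProduct continuous_id))
    (hR.zero_eq ▸ dotProduct_nonneg_of_pairing_nonneg_on_zero hR
      (zero_mem_zero hR hnorm hconv) hwm hwq hpos)
  filter_upwards [hsubset, hwv] with ω hω hwω using ⟨hω, hwω.2⟩

end DualCone

/-! ### Upward directed families of integrable functions -/

section Directed

variable {Ω : Type*} {mΩ : MeasurableSpace Ω} {P : Measure Ω}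

theorem exists_integrable_upper_bound_of_monotone {g : ℕ → Ω → ℝ} (hg : ∀ n, Integrable (g n) P)
    (hmono : ∀ᵐ ω ∂P, Monotone fun n => g n ω) {a : ℝ} (ha : ∀ n, ∫ ω, g n ω ∂P ≤ a) :
    ∃ h : Ω → ℝ, Integrable h P ∧ ∫ ω, h ω ∂P ≤ a ∧ ∀ n, g n ≤ᵐ[P] h := by
  let H : Ω → ℝ≥0∞ := fun ω => ⨆ n, ENNReal.ofReal (g n ω - g 0 ω)
  have hgm : ∀ n, AEMeasurable (fun ω => ENNReal.ofReal (g n ω - g 0 ω)) P := fun n =>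
    ((hg n).sub (hg 0)).aemeasurable.ennreal_ofReal
  have hHm : AEMeasurable H P := AEMeasurable.iSup hgm
  have hHle : ∫⁻ ω, H ω ∂P ≤ ENNReal.ofReal (a - ∫ ω, g 0 ω ∂P) := by
    rw [lintegral_iSup' hgm (by
      filter_upwards [hmono] with ω hω i j hij
      exact ENNReal.ofReal_le_ofReal (sub_le_sub_right (hω hij) _))]
    refine iSup_le fun n => ?_
    refine (ofReal_integral_eq_lintegral_ofReal ((hg n).sub (hg 0)) ?_).symm.trans_le ?_
    · filter_upwards [hmono] with ω hω using sub_nonneg.2 (hω (Nat.zero_le n))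
    rw [integral_sub' (hg n) (hg 0)]
    exact ENNReal.ofReal_le_ofReal (sub_le_sub_right (ha n) _)
  have hHtop : ∫⁻ ω, H ω ∂P ≠ ∞ := ne_top_of_le_ne_top ENNReal.ofReal_ne_top hHle
  have hHint : Integrable (fun ω => (H ω).toReal) P :=
    integrable_toReal_of_lintegral_ne_top hHm hHtop
  refine ⟨fun ω => g 0 ω + (H ω).toReal, (hg 0).add hHint, ?_, fun n => ?_⟩
  · rw [integral_add (hg 0) hHint, integral_toReal hHm (ae_lt_top' hHm hHtop)]
    linarith [ENNReal.toReal_le_of_le_ofReal (sub_nonneg.2 (ha 0)) hHle]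
  · filter_upwards [ae_lt_top' hHm hHtop] with ω hω
    have hle : ENNReal.ofReal (g n ω - g 0 ω) ≤ H ω :=
      le_iSup (fun n => ENNReal.ofReal (g n ω - g 0 ω)) n
    linarith [(ENNReal.ofReal_le_iff_le_toReal hω.ne).1 hle]

theorem exists_monotone_seq_tendsto_sSup_integral {F : Set (Ω → ℝ)} (hne : F.Nonempty)
    (hint : ∀ f ∈ F, Integrable f P) (hdir : DirectedOn (· ≤ᵐ[P] ·) F)
    (hb : BddAbove ((fun f => ∫ ω, f ω ∂P) '' F)) :
    ∃ g : ℕ → Ω → ℝ, (∀ n, g n ∈ F) ∧ (∀ᵐ ω ∂P, Monotone fun n => g n ω) ∧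
      Tendsto (fun n => ∫ ω, g n ω ∂P) atTop (nhds (sSup ((fun f => ∫ ω, f ω ∂P) '' F))) := by
  obtain ⟨v, -, hv, hvF⟩ := exists_seq_tendsto_sSup (hne.image fun f => ∫ ω, f ω ∂P) hb
  choose f hfF hfv using hvF
  choose D hDF hD₁ hD₂ using hdir
  let g : ℕ → F := fun n =>
    Nat.rec ⟨f 0, hfF 0⟩ (fun n G => ⟨_, hDF G.1 G.2 (f (n + 1)) (hfF (n + 1))⟩) n
  have hfg : ∀ n, f n ≤ᵐ[P] (g n).1 := fun n => by
    cases n with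
    | zero => exact EventuallyLE.refl _ _
    | succ n => exact hD₂ _ _ _ _
  have hmono : ∀ n, (g n).1 ≤ᵐ[P] (g (n + 1)).1 := fun n => hD₁ _ _ _ _
  refine ⟨fun n => (g n).1, fun n => (g n).2, ?_,
    tendsto_of_tendsto_of_tendsto_of_le_of_le hv tendsto_const_nhds (fun n => ?_) fun n => ?_⟩
  · filter_upwards [ae_all_iff.2 hmono] with ω hω using monotone_nat_of_le_succ hω
  · exact (hfv n).symm.trans_le (integral_mono_ae (hint _ (hfF n)) (hint _ (g n).2) (hfg n))
  · exact le_csSup hb ⟨_, (g n).2, rfl⟩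

theorem exists_integrable_upper_bound {F : Set (Ω → ℝ)} (hne : F.Nonempty)
    (hint : ∀ f ∈ F, Integrable f P) (hdir : DirectedOn (· ≤ᵐ[P] ·) F) {a : ℝ}
    (ha : ∀ f ∈ F, ∫ ω, f ω ∂P ≤ a) :
    ∃ h : Ω → ℝ, Integrable h P ∧ ∫ ω, h ω ∂P ≤ a ∧ ∀ f ∈ F, f ≤ᵐ[P] h := by
  have hb : BddAbove ((fun f => ∫ ω, f ω ∂P) '' F) := ⟨a, by rintro _ ⟨f, hf, rfl⟩; exact ha f hf⟩
  obtain ⟨g, hgF, hmono, hgS⟩ := exists_monotone_seq_tendsto_sSup_integral hne hint hdir hb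
  obtain ⟨h, hh, hha, hgh⟩ := exists_integrable_upper_bound_of_monotone (fun n => hint _ (hgF n))
    hmono fun n => ha _ (hgF n)
  set S := (fun f => ∫ ω, f ω ∂P) '' F
  have hgap : Tendsto (fun n => sSup S - ∫ ω, g n ω ∂P) atTop (nhds 0) := by
    simpa only [sub_self] using hgS.const_sub (sSup S)
  refine ⟨h, hh, hha, fun k hk => ?_⟩
  have hpos : Integrable (fun ω => max (k ω - h ω) 0) P := ((hint k hk).sub hh).pos_part
  -- a member of `F` above `k` and `g n` gains at least `(k - h)⁺` over `g n` in the mean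
  have hgain : ∀ n, ∫ ω, max (k ω - h ω) 0 ∂P ≤ sSup S - ∫ ω, g n ω ∂P := fun n => by
    obtain ⟨D, hD, hkD, hgD⟩ := hdir k hk (g n) (hgF n)
    calc ∫ ω, max (k ω - h ω) 0 ∂P ≤ ∫ ω, (D ω - g n ω) ∂P := by
          refine integral_mono_ae hpos ((hint D hD).sub (hint _ (hgF n))) ?_
          filter_upwards [hkD, hgD, hgh n] with ω hkω hgω hω
          exact max_le (sub_le_sub hkω hω) (sub_nonneg.2 hgω)
      _ = ∫ ω, D ω ∂P - ∫ ω, g n ω ∂P := integral_sub (hint D hD) (hint _ (hgF n))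
      _ ≤ _ := sub_le_sub_right (le_csSup hb ⟨D, hD, rfl⟩) _
  have hzero : ∫ ω, max (k ω - h ω) 0 ∂P = 0 :=
    (ge_of_tendsto' hgap hgain).antisymm (integral_nonneg fun _ => le_max_right _ _)
  filter_upwards [(integral_eq_zero_iff_of_nonneg (fun _ => le_max_right _ _) hpos).1 hzero]
    with ω hω
  exact sub_nonpos.1 ((le_max_left _ _).trans_eq hω)

end Directed

theorem directedOn_ae_le_of_glue {Ω : Type*} {m' mΩ : MeasurableSpace Ω} {P : Measure Ω}
    {F : Set (Ω → ℝ)} (hF : ∀ f ∈ F, AEStronglyMeasurable[m'] f P)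
    (hglue : ∀ f ∈ F, ∀ g ∈ F, ∀ B, MeasurableSet[m'] B →
      ∃ h ∈ F, h =ᵐ[P] B.indicator f + Bᶜ.indicator g) : DirectedOn (· ≤ᵐ[P] ·) F := by
  intro f hf g hg
  let B : Set Ω := {ω | (hF g hg).mk g ω ≤ (hF f hf).mk f ω}
  have hB : MeasurableSet[m'] B :=
    (hF g hg).stronglyMeasurable_mk.measurableSet_le (hF f hf).stronglyMeasurable_mk
  obtain ⟨h, hh, hfg⟩ := hglue f hf g hg B hB
  have hmax : ∀ᵐ ω ∂P, h ω = max (f ω) (g ω) := by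
    filter_upwards [hfg, (hF f hf).ae_eq_mk, (hF g hg).ae_eq_mk] with ω hω hfω hgω
    rw [hω, Pi.add_apply]
    by_cases hωB : ω ∈ B
    · simp [hωB, max_eq_left (hfω ▸ hgω ▸ hωB : g ω ≤ f ω)]
    · simp [hωB, max_eq_right (hfω ▸ hgω ▸ (not_le.1 hωB).le : f ω ≤ g ω)]
  exact ⟨h, hh, hmax.mono fun ω hω => hω ▸ le_max_left _ _,
    hmax.mono fun ω hω => hω ▸ le_max_right _ _⟩

/-! ### The density processes `ξ̄` -/

section ConditionalExpectation

variable {Ω : Type*} {mΩ : MeasurableSpace Ω} {P : Measure Ω}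

theorem ae_eq_zero_of_condExp_eq_zero {m' : MeasurableSpace Ω} (hm' : m' ≤ mΩ)
    [SigmaFinite (P.trim hm')] {f : Ω → ℝ} (hf : Integrable f P) (hf0 : 0 ≤ᵐ[P] f) :
    ∀ᵐ ω ∂P, (P[f | m']) ω = 0 → f ω = 0 := by
  have hB : MeasurableSet[m'] {ω | (P[f | m']) ω = 0} :=
    stronglyMeasurable_condExp.measurable (measurableSet_singleton 0)
  have hzero : ∫ ω in {ω | (P[f | m']) ω = 0}, f ω ∂P = 0 := by
    rw [← setIntegral_condExp hm' hf hB]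
    exact setIntegral_eq_zero_of_forall_eq_zero fun ω hω => hω
  rw [setIntegral_eq_zero_iff_of_nonneg_ae (ae_restrict_of_ae hf0) hf.integrableOn] at hzero
  exact (ae_restrict_iff' (hm' _ hB)).1 hzero

theorem condExp_eq_zero_of_condExp_eq_zero {m₁ m₂ : MeasurableSpace Ω} (h₁₂ : m₁ ≤ m₂)
    (h₂ : m₂ ≤ mΩ) [SigmaFinite (P.trim h₂)] [SigmaFinite (P.trim (h₁₂.trans h₂))] {f : Ω → ℝ}
    (hf0 : 0 ≤ᵐ[P] f) : ∀ᵐ ω ∂P, (P[f | m₁]) ω = 0 → (P[f | m₂]) ω = 0 := by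
  filter_upwards [ae_eq_zero_of_condExp_eq_zero (h₁₂.trans h₂)
    (integrable_condExp (f := f) (m := m₂)) (condExp_nonneg hf0),
    condExp_condExp_of_le (μ := P) (f := f) h₁₂ h₂] with ω hω htower hzero
  exact hω (htower.trans hzero)

theorem lintegral_mul_condExp {m' : MeasurableSpace Ω} (hm' : m' ≤ mΩ) [SigmaFinite (P.trim hm')]
    {f : Ω → ℝ} (hf : Integrable f P) (hf0 : 0 ≤ᵐ[P] f) {Z : Ω → ℝ≥0∞} (hZ : Measurable[m'] Z) :
    ∫⁻ ω, ENNReal.ofReal ((P[f | m']) ω) * Z ω ∂P = ∫⁻ ω, ENNReal.ofReal (f ω) * Z ω ∂P := by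
  have hZ' : AEMeasurable Z P := (hZ.mono hm' le_rfl).aemeasurable
  have htrim : (P.withDensity fun ω => ENNReal.ofReal ((P[f | m']) ω)).trim hm' =
      (P.withDensity fun ω => ENNReal.ofReal (f ω)).trim hm' := by
    refine @Measure.ext _ m' _ _ fun A hA => ?_
    rw [trim_measurableSet_eq hm' hA, trim_measurableSet_eq hm' hA, withDensity_apply _ (hm' _ hA),
      withDensity_apply _ (hm' _ hA), ← ofReal_integral_eq_lintegral_ofReal hf.integrableOn
        (ae_restrict_of_ae hf0), ← ofReal_integral_eq_lintegral_ofReal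
        integrable_condExp.integrableOn (ae_restrict_of_ae (condExp_nonneg hf0)),
      setIntegral_condExp hm' hf hA]
  simpa only [lintegral_trim hm' hZ, Pi.mul_apply, lintegral_withDensity_eq_lintegral_mul₀
    integrable_condExp.aemeasurable.ennreal_ofReal hZ', lintegral_withDensity_eq_lintegral_mul₀
    hf.aemeasurable.ennreal_ofReal hZ'] using congrArg (fun μ => lintegral μ Z) htrim

end ConditionalExpectation

section ConditionalDensity

variable {Ω : Type*} {m' mΩ : MeasurableSpace Ω} {P : Measure Ω}

open Classical in
/-- The ratio `y / E[y | m']`, with the value `1` where `E[y | m']` vanishes, as in the definition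
of `ξ̄`. It is the density of the measure that `exists_measure_condExp_mul_xi` attaches to `y`. -/
noncomputable def conditionalDensity (P : Measure Ω) (m' : MeasurableSpace Ω) (y : Ω → ℝ) :
    Ω → ℝ :=
  fun ω => if 0 < (P[y | m']) ω then y ω / (P[y | m']) ω else 1

variable {y : Ω → ℝ}

theorem conditionalDensity_eq_indicator (P : Measure Ω) (m' : MeasurableSpace Ω) (y : Ω → ℝ) :
    conditionalDensity P m' y = {ω | 0 < (P[y | m']) ω}.indicator (P[y | m'])⁻¹ * y +
      {ω | 0 < (P[y | m']) ω}ᶜ.indicator 1 := by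
  ext ω
  by_cases hω : 0 < (P[y | m']) ω
  · simp [conditionalDensity, hω, div_eq_inv_mul]
  · simp [conditionalDensity, hω]

theorem measurableSet_condExp_pos : MeasurableSet[m'] {ω | 0 < (P[y | m']) ω} :=
  stronglyMeasurable_condExp.measurable measurableSet_Ioi

theorem stronglyMeasurable_indicator_inv_condExp :
    StronglyMeasurable[m'] ({ω | 0 < (P[y | m']) ω}.indicator (P[y | m'])⁻¹) :=
  stronglyMeasurable_condExp.measurable.inv.stronglyMeasurable.indicator measurableSet_condExp_pos

theorem aestronglyMeasurable_conditionalDensity (hm' : m' ≤ mΩ) (hy : AEStronglyMeasurable y P) :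
    AEStronglyMeasurable (conditionalDensity P m' y) P := by
  rw [conditionalDensity_eq_indicator]
  exact ((stronglyMeasurable_indicator_inv_condExp.mono hm').aestronglyMeasurable.mul hy).add
    (aestronglyMeasurable_one.indicator (hm' _ measurableSet_condExp_pos).compl)

theorem conditionalDensity_nonneg (hy0 : 0 ≤ᵐ[P] y) : 0 ≤ᵐ[P] conditionalDensity P m' y := by
  filter_upwards [hy0] with ω hω
  rw [conditionalDensity]
  split_ifs with h
  · exact div_nonneg hω h.le
  · exact zero_le_one

theorem lintegral_conditionalDensity (hm' : m' ≤ mΩ) [SigmaFinite (P.trim hm')]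
    (hy : Integrable y P) (hy0 : 0 ≤ᵐ[P] y) :
    ∫⁻ ω, ENNReal.ofReal (conditionalDensity P m' y ω) ∂P = P Set.univ := by
  set B := {ω | 0 < (P[y | m']) ω}
  set g := B.indicator (P[y | m'])⁻¹ with hg_def
  have hB : MeasurableSet B := hm' _ measurableSet_condExp_pos
  have hdecomp : (fun ω => ENNReal.ofReal (conditionalDensity P m' y ω)) =ᵐ[P]
      fun ω => ENNReal.ofReal (y ω) * ENNReal.ofReal (g ω) + Bᶜ.indicator 1 ω := by
    filter_upwards [hy0] with ω hω
    by_cases hωB : ω ∈ B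
    · have hpos : 0 < (P[y | m']) ω := hωB
      simp [conditionalDensity, hpos, hg_def, hωB, div_eq_mul_inv, ENNReal.ofReal_mul hω]
    · have hpos : ¬ 0 < (P[y | m']) ω := hωB
      simp [conditionalDensity, hpos, hg_def, hωB]
  have hcancel : ∀ ω, ENNReal.ofReal ((P[y | m']) ω) * ENNReal.ofReal (g ω) = B.indicator 1 ω :=
    fun ω => by
      by_cases hωB : ω ∈ B
      · have hpos : 0 < (P[y | m']) ω := hωB
        simp [hg_def, hωB, ← ENNReal.ofReal_mul hpos.le, mul_inv_cancel₀ hpos.ne']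
      · simp [hg_def, hωB]
  rw [lintegral_congr_ae hdecomp, lintegral_add_right _ (measurable_one.indicator hB.compl),
    ← lintegral_mul_condExp hm' hy hy0
      stronglyMeasurable_indicator_inv_condExp.measurable.ennreal_ofReal,
    lintegral_congr hcancel, lintegral_indicator_one hB, lintegral_indicator_one hB.compl,
    measure_add_measure_compl hB]

variable [IsFiniteMeasure P]

theorem integrable_conditionalDensity (hm' : m' ≤ mΩ) (hy : Integrable y P) (hy0 : 0 ≤ᵐ[P] y) :
    Integrable (conditionalDensity P m' y) P :=
  ⟨aestronglyMeasurable_conditionalDensity hm' hy.1, by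
    rw [hasFiniteIntegral_iff_ofReal (conditionalDensity_nonneg hy0),
      lintegral_conditionalDensity hm' hy hy0]
    exact measure_lt_top P _⟩

theorem condExp_conditionalDensity {m₂ : MeasurableSpace Ω} (hm : m' ≤ m₂) (hm₂ : m₂ ≤ mΩ)
    (hy : Integrable y P) (hy0 : 0 ≤ᵐ[P] y) : ∀ᵐ ω ∂P, 0 < (P[y | m']) ω →
      (P[conditionalDensity P m' y | m₂]) ω = (P[y | m₂]) ω / (P[y | m']) ω := by
  set B := {ω | 0 < (P[y | m']) ω}
  have hB : MeasurableSet[m₂] B := hm _ measurableSet_condExp_pos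
  have hindicator : B.indicator (conditionalDensity P m' y) = B.indicator (P[y | m'])⁻¹ * y := by
    ext ω
    by_cases hω : ω ∈ B
    · have hpos : 0 < (P[y | m']) ω := hω
      simp [hω, conditionalDensity, hpos, div_eq_inv_mul]
    · simp [hω]
  have hz := integrable_conditionalDensity (hm.trans hm₂) hy hy0
  have hpull := condExp_mul_of_stronglyMeasurable_left
    (stronglyMeasurable_indicator_inv_condExp.mono hm)
    (hindicator ▸ hz.indicator (hm₂ _ hB)) hy
  rw [← hindicator] at hpull
  filter_upwards [hpull, condExp_indicator hz hB] with ω hω hωB hpos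
  rw [hω, Set.indicator_of_mem (show ω ∈ B from hpos), Pi.mul_apply,
    Set.indicator_of_mem (show ω ∈ B from hpos)] at hωB
  rw [← hωB, Pi.inv_apply, div_eq_inv_mul]

end ConditionalDensity

section Xi

variable {Ω : Type*} {mΩ : MeasurableSpace Ω} {P : Measure Ω} {ι : Type*} [LinearOrder ι]
  {ℱ : Filtration ι mΩ} {t s : ι}

theorem condExp_mul_xi [IsFiniteMeasure P] (hts : t ≤ s) {Q : Measure Ω} [IsFiniteMeasure Q]
    {v : Ω → ℝ} (hv : AEStronglyMeasurable[ℱ t] v P)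
    (hint : Integrable (fun ω => v ω * xi P ℱ t s Q ω) P) :
    P[fun ω => v ω * xi P ℱ t s Q ω | ℱ t] =ᵐ[P] v := by
  set D : Ω → ℝ := fun ω => (Q.rnDeriv P ω).toReal with hD
  set f : Ω → ℝ := fun ω => v ω * xi P ℱ t s Q ω with hf
  set B := {ω | 0 < (P[D | ℱ t]) ω}
  have hB : MeasurableSet[ℱ t] B := measurableSet_condExp_pos
  have hBf : B.indicator f = (v * B.indicator (P[D | ℱ t])⁻¹) * P[D | ℱ s] := by
    ext ω
    by_cases hω : ω ∈ B
    · have hpos : 0 < (P[D | ℱ t]) ω := hω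
      simp only [Set.indicator_of_mem hω, hf, xi, ← hD, if_pos hpos, Pi.mul_apply, Pi.inv_apply]
      ring
    · simp [hω]
  have hBcf : Bᶜ.indicator f = Bᶜ.indicator v := by
    ext ω
    by_cases hω : ω ∈ B
    · simp [hω]
    · have hpos : ¬ 0 < (P[D | ℱ t]) ω := hω
      simp [hω, hf, xi, ← hD, hpos]
  have hpull : P[B.indicator f | ℱ t] =ᵐ[P]
      v * B.indicator (P[D | ℱ t])⁻¹ * P[P[D | ℱ s] | ℱ t] := by
    have hBfI := hint.indicator (ℱ.le t _ hB)
    rw [hBf] at hBfI ⊢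
    exact condExp_mul_of_aestronglyMeasurable_left
      (hv.mul stronglyMeasurable_indicator_inv_condExp.aestronglyMeasurable) hBfI integrable_condExp
  have hcompl : P[Bᶜ.indicator f | ℱ t] =ᵐ[P] Bᶜ.indicator v := by
    have hBcfI := hint.indicator (ℱ.le t _ hB).compl
    rw [hBcf] at hBcfI ⊢
    exact condExp_of_aestronglyMeasurable' (ℱ.le t) (aestronglyMeasurable_indicator hv hB.compl)
      hBcfI
  filter_upwards [hpull, hcompl, condExp_indicator hint hB, condExp_indicator hint hB.compl,
    condExp_condExp_of_le (μ := P) (f := D) (ℱ.mono hts) (ℱ.le s)] with ω hωB hωBc hi hic htower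
  by_cases hω : ω ∈ B
  · have hpos : 0 < (P[D | ℱ t]) ω := hω
    rw [Set.indicator_of_mem hω] at hi
    rw [← hi, hωB, Pi.mul_apply, Pi.mul_apply, Set.indicator_of_mem hω, htower, Pi.inv_apply,
      inv_mul_cancel_right₀ hpos.ne']
  · rw [Set.indicator_of_mem (Set.mem_compl hω)] at hic
    rw [← hic, hωBc, Set.indicator_of_mem (Set.mem_compl hω)]

theorem exists_measure_condExp_mul_xi [IsProbabilityMeasure P] {y : Ω → ℝ} (hy : Integrable y P)
    (hy0 : 0 ≤ᵐ[P] y) : ∃ Q : Measure Ω, IsProbabilityMeasure Q ∧ Q ≪ P ∧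
      ∀ s r, t ≤ s → s ≤ r → P[y | ℱ s] * xi P ℱ s r Q =ᵐ[P] P[y | ℱ r] := by
  set z := conditionalDensity P (ℱ t) y
  have hz0 : 0 ≤ᵐ[P] z := conditionalDensity_nonneg hy0
  set Q := P.withDensity fun ω => ENNReal.ofReal (z ω)
  have hQ : IsProbabilityMeasure Q := ⟨by
    rw [withDensity_apply _ MeasurableSet.univ, Measure.restrict_univ,
      lintegral_conditionalDensity (ℱ.le t) hy hy0, measure_univ]⟩
  have hD : (fun ω => (Q.rnDeriv P ω).toReal) =ᵐ[P] z := by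
    filter_upwards [Measure.rnDeriv_withDensity₀ P
      (aestronglyMeasurable_conditionalDensity (ℱ.le t) hy.1).aemeasurable.ennreal_ofReal, hz0]
      with ω hω hω0
    rw [hω, ENNReal.toReal_ofReal hω0]
  have hDs : ∀ s, t ≤ s → ∀ᵐ ω ∂P, 0 < (P[y | ℱ t]) ω →
      (P[fun ω => (Q.rnDeriv P ω).toReal | ℱ s]) ω = (P[y | ℱ s]) ω / (P[y | ℱ t]) ω :=
    fun s hs => by
    filter_upwards [condExp_congr_ae (m := ℱ s) hD,
      condExp_conditionalDensity (ℱ.mono hs) (ℱ.le s) hy hy0] with ω hω hωs hpos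
    rw [hω, hωs hpos]
  refine ⟨Q, hQ, withDensity_absolutelyContinuous _ _, fun s r hts hsr => ?_⟩
  filter_upwards [hDs s hts, hDs r (hts.trans hsr), condExp_nonneg (m := ℱ t) hy0,
    condExp_nonneg (m := ℱ s) hy0,
    condExp_eq_zero_of_condExp_eq_zero (ℱ.mono hts) (ℱ.le s) hy0,
    condExp_eq_zero_of_condExp_eq_zero (ℱ.mono hsr) (ℱ.le r) hy0]
    with ω hDs hDr ht0 hs0 hts0 hsr0
  rcases hs0.eq_or_lt with hs0 | hs0
  · rw [Pi.mul_apply, hsr0 hs0.symm, ← hs0, Pi.zero_apply, zero_mul]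
  · have ht : 0 < (P[y | ℱ t]) ω := ht0.lt_of_ne fun h => hs0.ne (hts0 h.symm).symm
    rw [Pi.mul_apply, xi, hDs ht, hDr ht, if_pos (div_pos hs0 ht), div_div_div_cancel_right₀ ht.ne',
      mul_div_cancel₀ _ hs0.ne']

end Xi

section VectorCondExp

variable {Ω κ : Type*} {m' mΩ : MeasurableSpace Ω} {P : Measure Ω} [Fintype κ] {f g : Ω → κ → ℝ}

theorem condExp_eval (hf : Integrable f P) (i : κ) :
    P[fun ω => f ω i | m'] =ᵐ[P] fun ω => (P[f | m']) ω i :=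
  ((ContinuousLinearMap.proj (R := ℝ) (φ := fun _ : κ => ℝ) i).comp_condExp_comm hf).symm

theorem condExp_dotProduct (hg : AEStronglyMeasurable[m'] g P)
    (hfg : Integrable (fun ω => f ω ⬝ᵥ g ω) P) (hf : Integrable f P) :
    P[fun ω => f ω ⬝ᵥ g ω | m'] =ᵐ[P] fun ω => (P[f | m']) ω ⬝ᵥ g ω :=
  condExp_bilin_of_aestronglyMeasurable_right
    (dotProductBilin ℝ ℝ : (κ → ℝ) →ₗ[ℝ] (κ → ℝ) →ₗ[ℝ] ℝ).toContinuousBilinearMap hg hfg hf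

end VectorCondExp

/-! ### Recovering dual variables from a density -/

section DualVariables

variable {Ω : Type*} {mΩ : MeasurableSpace Ω} {P : Measure Ω} {ι : Type*} [LinearOrder ι]
  {ℱ : Filtration ι mΩ} {d m : ℕ} {p q : ℝ≥0∞} {t s : ι} {w : Ω → Fin d → ℝ}

theorem MemLt.congr {r : ℝ≥0∞} {D : Ω → Set (Fin d → ℝ)} {f g : Ω → Fin d → ℝ}
    (hf : MemLt P ℱ r t D f) (h : f =ᵐ[P] g) : MemLt P ℱ r t D g :=
  ⟨hf.1.congr h, hf.2.1.ae_eq h, hf.2.2.mp (h.mono fun _ hω => hω ▸ id)⟩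

theorem memDualMtPos_of_nonneg {f : Ω → Fin d → ℝ}
    (hf : MemLt P ℱ q s (fun _ => {x | 0 ≤ x}) f) : MemDualMtPos P ℱ p q m s f := by
  refine ⟨⟨hf.1, hf.2.1, ae_of_all _ fun _ => Set.mem_univ _⟩,
    fun u hu => integral_nonneg_of_ae ?_⟩
  filter_upwards [hf.2.2, (mem_MtPos.1 hu).2] with ω hfω huω
  exact dotProduct_nonneg_of_nonneg hfω huω

theorem exists_vectorMeasures_wStep_condExp [IsProbabilityMeasure P] {Y : Ω → Fin d → ℝ}
    (hY : Integrable Y P) (hY0 : 0 ≤ᵐ[P] Y) : ∃ Q ∈ vectorMeasures P d,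
      ∀ s r, t ≤ s → s ≤ r → wStep P ℱ s r Q (P[Y | ℱ s]) =ᵐ[P] P[Y | ℱ r] := by
  choose Q hQ hQP hxi using fun i => exists_measure_condExp_mul_xi (ℱ := ℱ) (t := t)
    (hY.eval i) (hY0.mono fun _ hω => hω i)
  refine ⟨Q, fun i => ⟨hQ i, hQP i⟩, fun s r hts hsr => ?_⟩
  filter_upwards [ae_all_iff.2 fun i => hxi i s r hts hsr,
    ae_all_iff.2 fun i => condExp_eval (m' := ℱ s) hY i,
    ae_all_iff.2 fun i => condExp_eval (m' := ℱ r) hY i] with ω hω hs hr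
  ext i
  rw [← hr i, ← hω i, Pi.mul_apply, hs i, wStep]

theorem memLt_condExp_nonneg [IsFiniteMeasure P] (hq : 1 ≤ q) {Y : Ω → Fin d → ℝ}
    (hY : MemLp Y q P) (hY0 : 0 ≤ᵐ[P] Y) :
    MemLt P ℱ q t (fun _ => {x | 0 ≤ x}) (P[Y | ℱ t]) :=
  ⟨stronglyMeasurable_condExp.aestronglyMeasurable, hY.condExp hq, condExp_nonneg hY0⟩

theorem exists_splitDensity_ae_eq [IsProbabilityMeasure P] [OrderTop ι] (hℱ : ℱ ⊤ = mΩ)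
    (hq : 1 ≤ q) (hts : t ≤ s) (hw : MemLt P ℱ q t (fun _ => (orth (eligible d m))ᶜ) w)
    {Y : Ω → Fin d → ℝ} (hY : MemLp Y q P) (hY0 : 0 ≤ᵐ[P] Y)
    (hYw : ∀ᵐ ω ∂P, (P[Y | ℱ t]) ω - w ω ∈ orth (eligible d m)) :
    ∃ a ∈ steppedDual P ℱ p q m t s w,
      ∃ b ∈ terminalDual P ℱ p q m s (wStep P ℱ t s a.1 (w + a.2)),
        splitDensity P ℱ t s w a b =ᵐ[P] Y := by
  obtain ⟨Q, hQ, hQY⟩ := exists_vectorMeasures_wStep_condExp (ℱ := ℱ) (t := t)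
    (hY.integrable hq) hY0
  have hE : ∀ r, MemLt P ℱ q r (fun _ => {x | 0 ≤ x}) (P[Y | ℱ r]) := fun r =>
    memLt_condExp_nonneg hq hY hY0
  have hstep := hQY t s le_rfl hts
  have hlast : wStep P ℱ s ⊤ Q (wStep P ℱ t s Q (P[Y | ℱ t])) =ᵐ[P] P[Y | ℱ ⊤] := by
    filter_upwards [hstep, hQY s ⊤ hts le_top] with ω hω hωlast
    rw [← hωlast]
    ext i
    simp only [wStep, ← hω]
  have hdual : MemDualMtPos P ℱ p q m s (wStep P ℱ t s Q (P[Y | ℱ t])) :=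
    memDualMtPos_of_nonneg ((hE s).congr hstep.symm)
  have hwE : w + (P[Y | ℱ t] - w) = P[Y | ℱ t] := add_sub_cancel _ _
  refine ⟨(Q, P[Y | ℱ t] - w), ⟨hQ, ⟨(hE t).1.sub hw.1, (hE t).2.1.sub hw.2.1, hYw⟩, ?_, ?_⟩,
    (Q, 0), ⟨hQ, ⟨aestronglyMeasurable_zero, MemLp.zero, ?_⟩, ?_, ?_⟩, ?_⟩ <;>
    simp only [splitDensity, hwE, add_zero]
  · refine ⟨(hE t).1, (hE t).2.1, ?_⟩
    filter_upwards [hYw, (hE t).2.2, hw.2.2] with ω hωw hω0 hωorth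
    refine ⟨mem_dualCone_eligiblePos.2 fun i _ => hω0 i, fun hωY => hωorth ?_⟩
    exact fun u hu => by simpa [sub_dotProduct, hωY u hu] using hωw u hu
  · exact hdual
  · exact ae_of_all _ fun ω => mem_orth_eligible.2 fun i _ => rfl
  · exact hdual
  · exact (hE ⊤).congr hlast.symm
  · rw [hℱ] at hlast
    exact hlast.trans (condExp_of_aestronglyMeasurable' le_rfl hY.1 (hY.integrable hq))

theorem condExp_wStep [IsFiniteMeasure P] (hts : t ≤ s) {Q : Fin d → Measure Ω}
    (hQ : Q ∈ vectorMeasures P d) {v : Ω → Fin d → ℝ} (hv : AEStronglyMeasurable[ℱ t] v P)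
    (hint : Integrable (wStep P ℱ t s Q v) P) : P[wStep P ℱ t s Q v | ℱ t] =ᵐ[P] v := by
  have hi : ∀ i, P[fun ω => wStep P ℱ t s Q v ω i | ℱ t] =ᵐ[P] fun ω => v ω i := fun i => by
    have : IsProbabilityMeasure (Q i) := (hQ i).1
    exact condExp_mul_xi hts (aestronglyMeasurable_pi_iff.1 hv i) (hint.eval i)
  filter_upwards [ae_all_iff.2 hi, ae_all_iff.2 fun i => condExp_eval (m' := ℱ t) hint i]
    with ω hω hωeval
  ext i
  rw [← hωeval i, hω i]

variable [OrderTop ι] {a b : (Fin d → Measure Ω) × (Ω → Fin d → ℝ)}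

theorem memLp_splitDensity (hb : b ∈ terminalDual P ℱ p q m s (wStep P ℱ t s a.1 (w + a.2))) :
    MemLp (splitDensity P ℱ t s w a b) q P := hb.2.2.2.2.1

variable [IsFiniteMeasure P]

theorem condExp_splitDensity_sub_mem_orth (hq : 1 ≤ q) (hts : t ≤ s)
    (ha : a ∈ steppedDual P ℱ p q m t s w)
    (hb : b ∈ terminalDual P ℱ p q m s (wStep P ℱ t s a.1 (w + a.2))) :
    ∀ᵐ ω ∂P, (P[splitDensity P ℱ t s w a b | ℱ t]) ω - w ω ∈ orth (eligible d m) := by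
  set V := wStep P ℱ t s a.1 (w + a.2)
  have hV : Integrable V P := ha.2.2.2.1.2.1.integrable hq
  have hbI : Integrable b.2 P := hb.2.1.2.1.integrable hq
  have hterm : P[splitDensity P ℱ t s w a b | ℱ s] =ᵐ[P] V + b.2 :=
    condExp_wStep le_top hb.1 hb.2.2.1.1.1 ((memLp_splitDensity hb).integrable hq)
  have hstep : P[V | ℱ t] =ᵐ[P] w + a.2 := condExp_wStep hts ha.1 ha.2.2.1.1 hV
  have htower : P[splitDensity P ℱ t s w a b | ℱ t] =ᵐ[P] P[V | ℱ t] + P[b.2 | ℱ t] :=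
    (condExp_condExp_of_le (ℱ.mono hts) (ℱ.le s)).symm.trans
      ((condExp_congr_ae hterm).trans (condExp_add hV hbI _))
  have hb0 : ∀ i : Fin d, (i : ℕ) < m → P[fun ω => b.2 ω i | ℱ t] =ᵐ[P] 0 := fun i hi => by
    refine (condExp_congr_ae (g := 0) ?_).trans (by rw [condExp_zero])
    filter_upwards [hb.2.1.2.2] with ω hω using mem_orth_eligible.1 hω i hi
  filter_upwards [htower, hstep, ha.2.1.2.2, ae_all_iff.2 fun i => ae_all_iff.2 fun hi => hb0 i hi,
    ae_all_iff.2 fun i => condExp_eval (m' := ℱ t) hbI i] with ω hω hωstep hωa hωb hωeval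
  rw [mem_orth_eligible] at hωa ⊢
  intro i hi
  simp [hω, hωstep, hωa i hi, ← hωeval i, hωb i hi]

theorem condExp_splitDensity_dotProduct [ENNReal.HolderConjugate p q] (hts : t ≤ s)
    (ha : a ∈ steppedDual P ℱ p q m t s w)
    (hb : b ∈ terminalDual P ℱ p q m s (wStep P ℱ t s a.1 (w + a.2)))
    {u : Lp (Fin d → ℝ) p P} (hu : u ∈ Mt P ℱ p m t) :
    P[fun ω => splitDensity P ℱ t s w a b ω ⬝ᵥ u ω | ℱ t] =ᵐ[P] fun ω => w ω ⬝ᵥ u ω := by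
  have hq : 1 ≤ q := ENNReal.HolderConjugate.one_le q p
  have hY := memLp_splitDensity hb
  obtain ⟨hum, huM⟩ := mem_Mt.1 hu
  refine (condExp_dotProduct hum (integrable_dotProduct hY (Lp.memLp u))
    (hY.integrable hq)).trans ?_
  filter_upwards [condExp_splitDensity_sub_mem_orth hq hts ha hb, huM] with ω hω hωu
  rw [← sub_eq_zero, ← sub_dotProduct]
  exact hω _ hωu

end DualVariables

/-! ### Weak duality -/

section WeakDuality

variable {Ω : Type*} {mΩ : MeasurableSpace Ω} {P : Measure Ω}
  {ι : Type*} [LinearOrder ι] {ℱ : Filtration ι mΩ} {d m : ℕ} {p q : ℝ≥0∞} {t s : ι}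
  {w : Ω → Fin d → ℝ}
  {R : Lp (Fin d → ℝ) p P → Set (Lp (Fin d → ℝ) p P)} {R0 : Ω → Set (Fin d → ℝ)}

theorem add_mem_acceptance [Fact (1 ≤ p)] (hR : IsConditionalRiskMeasure P ℱ p m t R R0)
    {X u : Lp (Fin d → ℝ) p P} (hu : u ∈ R X) : X + u ∈ acceptance R := by
  rw [acceptance, Set.mem_ofPred_eq, hR.translative X u (hR.subset_eligible X hu)]
  exact ⟨u, hu, sub_self u⟩

variable [IsProbabilityMeasure P]

theorem measurable_scalarization {X : Lp (Fin d → ℝ) p P} :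
    Measurable (scalarization P R w X) :=
  (isFamilyEssSup_familyEssSup P _).measurable.neg

theorem scalarization_le {X u : Lp (Fin d → ℝ) p P} (hu : u ∈ R X) :
    scalarization P R w X ≤ᵐ[P] fun ω => ((w ω ⬝ᵥ u ω : ℝ) : EReal) := by
  have hupper := (isFamilyEssSup_familyEssSup P {f | ∃ g ∈ {f | ∃ u ∈ R X,
    f = fun ω => ((w ω ⬝ᵥ u ω : ℝ) : EReal)}, f = fun ω' => -g ω'}).upper _
      ⟨_, ⟨u, hu, rfl⟩, rfl⟩
  filter_upwards [hupper] with ω hω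
  exact EReal.neg_le_of_neg_le hω

theorem le_scalarization {X : Lp (Fin d → ℝ) p P} {h : Ω → EReal} (hm : AEMeasurable h P)
    (hle : ∀ u ∈ R X, h ≤ᵐ[P] fun ω => ((w ω ⬝ᵥ u ω : ℝ) : EReal)) :
    h ≤ᵐ[P] scalarization P R w X := by
  have hneg := (isFamilyEssSup_familyEssSup P {f | ∃ g ∈ {f | ∃ u ∈ R X,
    f = fun ω => ((w ω ⬝ᵥ u ω : ℝ) : EReal)}, f = fun ω' => -g ω'}).least
      (fun ω => -h ω) hm.neg (by
      rintro _ ⟨_, ⟨u, hu, rfl⟩, rfl⟩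
      exact (hle u hu).mono fun ω hω => EReal.neg_le_neg_iff.2 hω)
  exact hneg.mono fun ω hω => EReal.le_neg_of_le_neg hω

variable [OrderTop ι] {a b : (Fin d → Measure Ω) × (Ω → Fin d → ℝ)}

theorem splitExpectation_le_beta {Z : Lp (Fin d → ℝ) p P} (hZ : Z ∈ acceptance R) :
    splitExpectation ℱ t s w a b Z ≤ᵐ[P] beta ℱ t s R w a b :=
  (isFamilyEssSup_familyEssSup P _).upper _ ⟨Z, hZ, rfl⟩

theorem measurable_beta : Measurable (beta ℱ t s R w a b) :=
  (isFamilyEssSup_familyEssSup P _).measurable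

theorem measurable_dualValue (X : Lp (Fin d → ℝ) p P) :
    Measurable (dualValue ℱ t s R w a b X) :=
  measurable_beta.neg.add <| measurable_coe_real_ereal.comp <|
    stronglyMeasurable_condExp.measurable.mono (ℱ.le t) le_rfl

variable [ENNReal.HolderConjugate p q]

theorem splitExpectation_add (hts : t ≤ s) (ha : a ∈ steppedDual P ℱ p q m t s w)
    (hb : b ∈ terminalDual P ℱ p q m s (wStep P ℱ t s a.1 (w + a.2))) (X : Lp (Fin d → ℝ) p P)
    {u : Lp (Fin d → ℝ) p P} (hu : u ∈ Mt P ℱ p m t) :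
    splitExpectation ℱ t s w a b (X + u) =ᵐ[P]
      fun ω => splitExpectation ℱ t s w a b X ω - ((w ω ⬝ᵥ u ω : ℝ) : EReal) := by
  set Y := splitDensity P ℱ t s w a b
  have hY : MemLp Y q P := memLp_splitDensity hb
  have hsplit : (fun ω => Y ω ⬝ᵥ -((X + u : Lp (Fin d → ℝ) p P) ω)) =ᵐ[P]
      (fun ω => Y ω ⬝ᵥ -(X ω)) - fun ω => Y ω ⬝ᵥ u ω := by
    filter_upwards [Lp.coeFn_add X u] with ω hω
    simp only [hω, Pi.add_apply, Pi.sub_apply, neg_add, dotProduct_add, dotProduct_neg,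
      sub_eq_add_neg]
  filter_upwards [(condExp_congr_ae hsplit).trans (condExp_sub (m := ℱ t)
    (integrable_dotProduct hY (Lp.memLp X).neg) (integrable_dotProduct hY (Lp.memLp u))),
    condExp_splitDensity_dotProduct hts ha hb hu] with ω hω hωu
  rw [splitExpectation, splitExpectation, hω, Pi.sub_apply, hωu, EReal.coe_sub]
  rfl

variable [Fact (1 ≤ p)]

theorem dualValue_le_of_mem (hR : IsConditionalRiskMeasure P ℱ p m t R R0) (hts : t ≤ s)
    (ha : a ∈ steppedDual P ℱ p q m t s w)
    (hb : b ∈ terminalDual P ℱ p q m s (wStep P ℱ t s a.1 (w + a.2))) {X u : Lp (Fin d → ℝ) p P}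
    (hu : u ∈ R X) : dualValue ℱ t s R w a b X ≤ᵐ[P] fun ω => ((w ω ⬝ᵥ u ω : ℝ) : EReal) := by
  have hle : splitExpectation ℱ t s w a b (X + u) ≤ᵐ[P] beta ℱ t s R w a b :=
    splitExpectation_le_beta (add_mem_acceptance hR hu)
  filter_upwards [hle, splitExpectation_add hts ha hb X (hR.subset_eligible X hu)] with ω hβ hadd
  rw [hadd] at hβ
  simp only [dualValue, splitExpectation] at hβ ⊢
  set x := (P[fun ω => splitDensity P ℱ t s w a b ω ⬝ᵥ -(X ω) | ℱ t]) ω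
  calc -beta ℱ t s R w a b ω + (x : EReal)
      ≤ -((x - w ω ⬝ᵥ u ω : ℝ) : EReal) + (x : EReal) :=
        add_le_add_left (EReal.neg_le_neg_iff.2 hβ) _
    _ = ((w ω ⬝ᵥ u ω : ℝ) : EReal) := by
        rw [← EReal.coe_neg, ← EReal.coe_add]
        congr 1
        ring

theorem dualValue_le_scalarization (hR : IsConditionalRiskMeasure P ℱ p m t R R0) (hts : t ≤ s)
    (ha : a ∈ steppedDual P ℱ p q m t s w)
    (hb : b ∈ terminalDual P ℱ p q m s (wStep P ℱ t s a.1 (w + a.2))) (X : Lp (Fin d → ℝ) p P) :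
    dualValue ℱ t s R w a b X ≤ᵐ[P] scalarization P R w X :=
  le_scalarization (measurable_dualValue X).aemeasurable fun _ hu =>
    dualValue_le_of_mem hR hts ha hb hu

end WeakDuality

/-! ### The expected scalarization and its affine minorants -/

section Scalarization

variable {Ω : Type*} {mΩ : MeasurableSpace Ω} {P : Measure Ω} {ι : Type*} [LinearOrder ι]
  {ℱ : Filtration ι mΩ} {d m : ℕ} {p q : ℝ≥0∞} {t : ι} {w : Ω → Fin d → ℝ}
  {R : Lp (Fin d → ℝ) p P → Set (Lp (Fin d → ℝ) p P)} {R0 : Ω → Set (Fin d → ℝ)}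

theorem ConditionallyConvex.glue_mem (hconv : ConditionallyConvex ℱ t R) {B : Set Ω}
    (hB : MeasurableSet[ℱ t] B) {X Y Z u v z : Lp (Fin d → ℝ) p P} (hu : u ∈ R X) (hv : v ∈ R Y)
    (hZ : Z =ᵐ[P] fun ω => B.indicator X ω + Bᶜ.indicator Y ω)
    (hz : z =ᵐ[P] fun ω => B.indicator u ω + Bᶜ.indicator v ω) : z ∈ R Z := by
  have hcombo : ∀ f g : Ω → Fin d → ℝ, (fun ω => B.indicator f ω + Bᶜ.indicator g ω) =
      fun ω => B.indicator (1 : Ω → ℝ) ω • f ω + (1 - B.indicator (1 : Ω → ℝ) ω) • g ω := by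
    intro f g
    ext ω : 1
    by_cases hω : ω ∈ B <;> simp [hω]
  rw [hcombo] at hZ hz
  refine hconv X Y Z (B.indicator 1) (stronglyMeasurable_one.indicator hB).aestronglyMeasurable
    (ae_of_all _ fun ω => ?_) hZ u hu v hv z hz
  by_cases hω : ω ∈ B <;> simp [hω]

theorem ConditionallyConvex.directedOn_neg_dotProduct (hconv : ConditionallyConvex ℱ t R)
    {X : Lp (Fin d → ℝ) p P} (hRX : R X ⊆ Mt P ℱ p m t) (hw : AEStronglyMeasurable[ℱ t] w P) :
    DirectedOn (· ≤ᵐ[P] ·) {f : Ω → ℝ | ∃ u ∈ R X, f = fun ω => -(w ω ⬝ᵥ u ω)} := by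
  refine directedOn_ae_le_of_glue (m' := ℱ t) ?_ ?_
  · rintro _ ⟨u, hu, rfl⟩
    exact (aestronglyMeasurable_dotProduct hw (mem_Mt.1 (hRX hu)).1).neg
  · rintro _ ⟨u, hu, rfl⟩ _ ⟨v, hv, rfl⟩ B hB
    obtain ⟨z, hz⟩ := exists_glue (ℱ.le t _ hB) u v
    refine ⟨_, ⟨z, hconv.glue_mem hB hu hv (ae_of_all _ fun ω => ?_) hz, rfl⟩, ?_⟩
    · by_cases hω : ω ∈ B <;> simp [hω]
    · filter_upwards [hz] with ω hωz
      by_cases hω : ω ∈ B <;> simp [hωz, hω]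

variable [IsProbabilityMeasure P] {X : Lp (Fin d → ℝ) p P}

theorem nonempty_of_scalarization_ae_eq_coe {g : Ω → ℝ}
    (hgX : scalarization P R w X =ᵐ[P] fun ω => (g ω : EReal)) : (R X).Nonempty := by
  by_contra! hempty
  have htop : (fun _ => ⊤ : Ω → EReal) ≤ᵐ[P] scalarization P R w X :=
    le_scalarization aemeasurable_const fun u hu => by simp [hempty] at hu
  obtain ⟨ω, hω, hωg⟩ := (htop.and hgX).exists
  rw [hωg] at hω
  exact EReal.coe_ne_top _ (top_le_iff.1 hω)

theorem isGLB_pairing_image [ENNReal.HolderConjugate p q] (hconv : ConditionallyConvex ℱ t R)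
    (hRX : R X ⊆ Mt P ℱ p m t) (hwm : AEStronglyMeasurable[ℱ t] w P) (hwq : MemLp w q P)
    {g : Ω → ℝ} (hg : Integrable g P)
    (hgX : scalarization P R w X =ᵐ[P] fun ω => (g ω : EReal)) :
    IsGLB (pairing p hwq '' R X) (∫ ω, g ω ∂P) := by
  have hI : ∀ u : Lp (Fin d → ℝ) p P, Integrable (fun ω => w ω ⬝ᵥ u ω) P := fun u =>
    integrable_dotProduct hwq (Lp.memLp u)
  refine ⟨?_, fun a ha => ?_⟩
  · rintro _ ⟨u, hu, rfl⟩
    refine integral_mono_ae hg (hI u) ?_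
    filter_upwards [scalarization_le (w := w) hu, hgX] with ω hω hωg
    exact EReal.coe_le_coe_iff.1 (hωg ▸ hω)
  obtain ⟨u₀, hu₀⟩ := nonempty_of_scalarization_ae_eq_coe hgX
  obtain ⟨h, hh, hha, hle⟩ := exists_integrable_upper_bound
    (F := {f | ∃ u ∈ R X, f = fun ω => -(w ω ⬝ᵥ u ω)}) (a := -a) ⟨_, u₀, hu₀, rfl⟩
    (by rintro _ ⟨u, -, rfl⟩; exact (hI u).neg) (hconv.directedOn_neg_dotProduct hRX hwm) (by
      rintro _ ⟨u, hu, rfl⟩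
      rw [integral_neg]
      exact neg_le_neg (ha ⟨u, hu, rfl⟩))
  have hlow : (fun ω => ((-h ω : ℝ) : EReal)) ≤ᵐ[P] scalarization P R w X := by
    refine le_scalarization hh.1.aemeasurable.neg.coe_real_ereal fun u hu => ?_
    filter_upwards [hle _ ⟨u, hu, rfl⟩] with ω hω
    exact EReal.coe_le_coe_iff.2 (neg_le.1 hω)
  have hhg : (fun ω => -h ω) ≤ᵐ[P] g := by
    filter_upwards [hlow, hgX] with ω hω hωg
    exact EReal.coe_le_coe_iff.1 (hωg ▸ hω)
  calc a ≤ -∫ ω, h ω ∂P := le_neg.1 hha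
    _ = ∫ ω, -h ω ∂P := (integral_neg _).symm
    _ ≤ ∫ ω, g ω ∂P := integral_mono_ae hh.neg hg hhg

end Scalarization

section Infimum

variable {Ω : Type*} {mΩ : MeasurableSpace Ω} {P : Measure Ω} {ι : Type*} [LinearOrder ι]
  {ℱ : Filtration ι mΩ} {d m : ℕ} {p : ℝ≥0∞} {t : ι}
  {R : Lp (Fin d → ℝ) p P → Set (Lp (Fin d → ℝ) p P)} {R0 : Ω → Set (Fin d → ℝ)}
  {f : Lp (Fin d → ℝ) p P →ₗ[ℝ] ℝ} {φ : Lp (Fin d → ℝ) p P → ℝ}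

theorem convexOn_of_isGLB_image (hconv : ConditionallyConvex ℱ t R)
    (hφ : ∀ X, IsGLB (f '' R X) (φ X)) : ConvexOn ℝ Set.univ φ := by
  refine ⟨convex_univ, fun X _ Y _ a b ha hb hab => le_of_forall_pos_le_add fun ε hε => ?_⟩
  obtain ⟨_, ⟨u, hu, rfl⟩, -, hfu⟩ := (hφ X).exists_between (lt_add_of_pos_right _ hε)
  obtain ⟨_, ⟨v, hv, rfl⟩, -, hfv⟩ := (hφ Y).exists_between (lt_add_of_pos_right _ hε)
  calc φ (a • X + b • Y) ≤ f (a • u + b • v) :=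
        (hφ _).1 ⟨_, hconv.combo_mem hu hv ha hb hab, rfl⟩
    _ = a • f u + b • f v := by rw [map_add, map_smul, map_smul]
    _ ≤ a • (φ X + ε) + b • (φ Y + ε) :=
        add_le_add (smul_le_smul_of_nonneg_left hfu.le ha) (smul_le_smul_of_nonneg_left hfv.le hb)
    _ = a • φ X + b • φ Y + ε := by
        rw [smul_add, smul_add, add_add_add_comm, Convex.combo_self hab]

variable [Fact (1 ≤ p)]

theorem apply_add_of_isGLB_image (hR : IsConditionalRiskMeasure P ℱ p m t R R0)
    (hφ : ∀ X, IsGLB (f '' R X) (φ X)) (X : Lp (Fin d → ℝ) p P) {k : Lp (Fin d → ℝ) p P}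
    (hk : k ∈ Mt P ℱ p m t) : φ (X + k) = φ X - f k := by
  have himage : f '' R (X + k) = OrderIso.subRight (f k) '' (f '' R X) := by
    rw [hR.translative X k hk, Set.image_image, Set.image_image]
    simp only [map_sub, OrderIso.subRight_apply]
  refine (hφ (X + k)).unique ?_
  rw [himage]
  exact (OrderIso.isGLB_image' _).2 (hφ X)

theorem lowerSemicontinuous_of_isGLB_image [IsFiniteMeasure P]
    (hR : IsConditionalRiskMeasure P ℱ p m t R R0) (hcuc : ConvexUpperContinuous ℱ m t R)
    (hfc : @Continuous _ _ (lpTopology P p) _ f) (hf : ∀ e ∈ MtPos P ℱ p m t, 0 ≤ f e)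
    (hφ : ∀ X, IsGLB (f '' R X) (φ X)) : @LowerSemicontinuous _ _ (lpTopology P p) _ φ := by
  let := lpTopology (d := d) P p
  let D : ℝ → Set (Lp (Fin d → ℝ) p P) := fun c => Mt P ℱ p m t ∩ {u | f u ≤ c}
  have hD : ∀ c, D c ∈ lowerClosedConvex P ℱ p m t := fun c =>
    mem_lowerClosedConvex Set.inter_subset_left
      (convex_Mt.inter (convex_halfSpace_le f.isLinear c))
      (isClosed_Mt.inter (isClosed_le hfc continuous_const))
      fun u hu e he => ⟨sub_mem_Mt hu.1 (mem_MtPos.1 he).1, by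
        rw [Set.mem_ofPred_eq, map_sub]
        exact (sub_le_self _ (hf e he)).trans hu.2⟩
  have hsublevel : ∀ c, φ ⁻¹' Set.Iic c = ⋂ ε > (0 : ℝ), {X | (R X ∩ D (c + ε)).Nonempty} := by
    intro c
    ext X
    simp only [Set.mem_preimage, Set.mem_Iic, Set.mem_iInter, Set.mem_ofPred_eq]
    refine ⟨fun hX ε hε => ?_, fun hX => le_of_forall_pos_le_add fun ε hε => ?_⟩
    · obtain ⟨_, ⟨u, hu, rfl⟩, -, hfu⟩ := (hφ X).exists_between (lt_add_of_pos_right _ hε)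
      exact ⟨u, hu, hR.subset_eligible X hu, hfu.le.trans (add_le_add_left hX ε)⟩
    · obtain ⟨u, hu, -, hfu⟩ := hX ε hε
      exact ((hφ X).1 ⟨u, hu, rfl⟩).trans hfu
  refine lowerSemicontinuous_iff_isClosed_preimage.2 fun c => ?_
  rw [hsublevel]
  exact isClosed_biInter fun ε _ => hcuc _ (hD _)

theorem exists_affine_le_of_isGLB_image [IsFiniteMeasure P]
    (hR : IsConditionalRiskMeasure P ℱ p m t R R0) (hconv : ConditionallyConvex ℱ t R)
    (hcuc : ConvexUpperContinuous ℱ m t R) (hfc : @Continuous _ _ (lpTopology P p) _ f)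
    (hf : ∀ e ∈ MtPos P ℱ p m t, 0 ≤ f e) (hφ : ∀ X, IsGLB (f '' R X) (φ X))
    (X : Lp (Fin d → ℝ) p P) {ε : ℝ} (hε : 0 < ε) :
    ∃ (l : Lp (Fin d → ℝ) p P →ₗ[ℝ] ℝ) (c : ℝ), @Continuous _ _ (lpTopology P p) _ l ∧
      (∀ Z, c - l Z ≤ φ Z) ∧ c - l X = φ X - ε := by
  let := lpTopology (d := d) P p
  have := isTopologicalAddGroup_lpTopology (d := d) (P := P) (p := p)
  have := continuousSMul_lpTopology (d := d) (P := P) (p := p)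
  have := locallyConvexSpace_lpTopology (d := d) (P := P) (p := p)
  obtain ⟨l, c, hle, hX⟩ := ConvexOn.exists_affine_le_of_lt (𝕜 := ℝ) (Set.mem_univ X)
    (sub_lt_self (φ X) hε) isClosed_univ (lowerSemicontinuousOn_univ_iff.2
      (lowerSemicontinuous_of_isGLB_image hR hcuc hfc hf hφ)) (convexOn_of_isGLB_image hconv hφ)
  refine ⟨-l.toLinearMap, c, l.continuous.neg, fun Z => ?_, ?_⟩
  · simpa [add_comm] using hle ⟨Z, Set.mem_univ Z⟩
  · simpa [add_comm] using hX

end Infimum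

section Representation

variable {Ω : Type*} {mΩ : MeasurableSpace Ω} {P : Measure Ω} [IsFiniteMeasure P] {d : ℕ}
  {p q : ℝ≥0∞} {ι : Type*} [LinearOrder ι] {ℱ : Filtration ι mΩ} {m : ℕ} {t : ι}
  {Y w : Ω → Fin d → ℝ}

theorem indicatorConstLp_single_mem_Mt {A : Set Ω} (hA : MeasurableSet[ℱ t] A) {i : Fin d}
    (hi : (i : ℕ) < m) :
    indicatorConstLp p (ℱ.le t _ hA) (measure_ne_top P A) (Pi.single i 1) ∈ Mt P ℱ p m t := by
  have hae := indicatorConstLp_coeFn (p := p) (hs := ℱ.le t _ hA) (hμs := measure_ne_top P A)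
    (c := (Pi.single i 1 : Fin d → ℝ))
  refine mem_Mt.2 ⟨(stronglyMeasurable_const.indicator hA).aestronglyMeasurable.congr hae.symm, ?_⟩
  filter_upwards [hae] with ω hω j hj
  have hji : j ≠ i := by rintro rfl; exact hj.not_gt hi
  rw [hω]
  by_cases h : ω ∈ A <;> simp [h, hji]

variable [ENNReal.HolderConjugate p q]

theorem pairing_indicatorConstLp_single (hY : MemLp Y q P) {A : Set Ω} (hA : MeasurableSet A)
    (i : Fin d) :
    pairing p hY (indicatorConstLp p hA (measure_ne_top P A) (Pi.single i 1)) =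
      ∫ ω in A, Y ω i ∂P := by
  rw [pairing_apply, ← integral_indicator hA]
  refine integral_congr_ae ?_
  filter_upwards [indicatorConstLp_coeFn (p := p) (hs := hA) (hμs := measure_ne_top P A)
    (c := (Pi.single i 1 : Fin d → ℝ))] with ω hω
  rw [hω]
  by_cases h : ω ∈ A <;> simp [h]

theorem ae_nonneg_of_forall_pairing_nonneg (hY : MemLp Y q P)
    (hpos : ∀ Z : Lp (Fin d → ℝ) p P, (∀ᵐ ω ∂P, 0 ≤ Z ω) → 0 ≤ pairing p hY Z) :
    0 ≤ᵐ[P] Y := by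
  have hq : 1 ≤ q := ENNReal.HolderConjugate.one_le q p
  have hcoord : ∀ i, 0 ≤ᵐ[P] fun ω => Y ω i := fun i => by
    refine ae_nonneg_of_forall_setIntegral_nonneg ((hY.eval i).integrable hq) fun A hA _ => ?_
    rw [← pairing_indicatorConstLp_single (p := p) hY hA i]
    refine hpos _ ?_
    filter_upwards [indicatorConstLp_coeFn (p := p) (hs := hA) (hμs := measure_ne_top P A)
      (c := (Pi.single i 1 : Fin d → ℝ))] with ω hω
    rw [hω]
    exact Set.indicator_nonneg (fun _ _ => Pi.single_nonneg.2 zero_le_one) _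
  exact ae_all_iff.2 hcoord

theorem condExp_sub_mem_orth_of_pairing_eq (hY : MemLp Y q P) (hw : MemLp w q P)
    (hwm : AEStronglyMeasurable[ℱ t] w P)
    (heq : ∀ k ∈ Mt P ℱ p m t, pairing p hY k = pairing p hw k) :
    ∀ᵐ ω ∂P, (P[Y | ℱ t]) ω - w ω ∈ orth (eligible d m) := by
  have hq : 1 ≤ q := ENNReal.HolderConjugate.one_le q p
  have hcoord : ∀ i : Fin d, (i : ℕ) < m → (fun ω => w ω i) =ᵐ[P] fun ω => (P[Y | ℱ t]) ω i := by
    intro i hi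
    have hY1 := hY.integrable hq
    refine (ae_eq_condExp_of_forall_setIntegral_eq (ℱ.le t) (hY1.eval i)
      (fun A _ _ => ((hw.integrable hq).eval i).integrableOn) (fun A hA _ => ?_)
      ((continuous_apply i).comp_aestronglyMeasurable hwm)).trans (condExp_eval hY1 i)
    rw [← pairing_indicatorConstLp_single (p := p) hY (ℱ.le t _ hA),
      ← pairing_indicatorConstLp_single (p := p) hw (ℱ.le t _ hA)]
    exact (heq _ (indicatorConstLp_single_mem_Mt hA hi)).symm
  filter_upwards [ae_all_iff.2 fun i => eventually_imp_distrib_left.2 (hcoord i)] with ω hω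
  exact mem_orth_eligible.2 fun i hi => sub_eq_zero.2 (hω i hi).symm

end Representation

section Minorant

variable {Ω : Type*} {mΩ : MeasurableSpace Ω} {P : Measure Ω} {ι : Type*} [LinearOrder ι]
  {ℱ : Filtration ι mΩ} {d m : ℕ} {p q : ℝ≥0∞} [Fact (1 ≤ p)] {t : ι}
  {R : Lp (Fin d → ℝ) p P → Set (Lp (Fin d → ℝ) p P)} {R0 : Ω → Set (Fin d → ℝ)}
  {f l : Lp (Fin d → ℝ) p P →ₗ[ℝ] ℝ} {φ : Lp (Fin d → ℝ) p P → ℝ} {c : ℝ}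

theorem nonneg_of_forall_le_mul {a b : ℝ} (h : ∀ r, 0 ≤ r → b ≤ r * a) : 0 ≤ a := by
  by_contra! ha
  have hb := h ((|b| + 1) / -a) (div_nonneg (by positivity) (neg_nonneg.2 ha.le))
  rw [div_neg, neg_mul, div_mul_cancel₀ _ ha.ne] at hb
  linarith [neg_abs_le b]

theorem nonneg_of_affine_le (hR : IsConditionalRiskMeasure P ℱ p m t R R0)
    (hφ : ∀ X, IsGLB (f '' R X) (φ X)) (hle : ∀ Z, c - l Z ≤ φ Z) {Z : Lp (Fin d → ℝ) p P}
    (hZ : ∀ᵐ ω ∂P, 0 ≤ Z ω) : 0 ≤ l Z := by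
  refine nonneg_of_forall_le_mul (b := c - φ 0) fun r hr => ?_
  have hrZ : R 0 ⊆ R (r • Z) := hR.monotone _ _ <| by
    rw [sub_zero]
    filter_upwards [hZ, Lp.coeFn_smul r Z] with ω hω hωr
    rw [hωr]
    exact smul_nonneg hr hω
  have hanti : φ (r • Z) ≤ φ 0 := (hφ 0).mono (hφ _) (Set.image_mono hrZ)
  have hleZ := hle (r • Z)
  rw [map_smul, smul_eq_mul] at hleZ
  linarith

theorem eq_of_affine_le (hR : IsConditionalRiskMeasure P ℱ p m t R R0)
    (hφ : ∀ X, IsGLB (f '' R X) (φ X)) (hle : ∀ Z, c - l Z ≤ φ Z) {k : Lp (Fin d → ℝ) p P}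
    (hk : k ∈ Mt P ℱ p m t) : l k = f k := by
  have hnonneg : ∀ e ∈ Mt P ℱ p m t, 0 ≤ l e - f e := fun e he => by
    refine nonneg_of_forall_le_mul (b := c - φ 0) fun r _ => ?_
    have hler := hle (0 + r • e)
    rw [apply_add_of_isGLB_image hR hφ 0 (smul_mem_Mt r he), zero_add, map_smul, map_smul,
      smul_eq_mul, smul_eq_mul] at hler
    linarith
  have hneg := hnonneg _ (smul_mem_Mt (-1) hk)
  rw [map_smul, map_smul, smul_eq_mul, smul_eq_mul] at hneg
  linarith [hnonneg k hk]

theorem exists_pairing_affine_le [IsFiniteMeasure P] [ENNReal.HolderConjugate p q]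
    (hR : IsConditionalRiskMeasure P ℱ p m t R R0) (hconv : ConditionallyConvex ℱ t R)
    (hcuc : ConvexUpperContinuous ℱ m t R) {w : Ω → Fin d → ℝ}
    (hwm : AEStronglyMeasurable[ℱ t] w P) (hwq : MemLp w q P)
    (hwv : ∀ᵐ ω ∂P, w ω ∈ dualCone (eligiblePos d m))
    (hφ : ∀ X, IsGLB (pairing p hwq '' R X) (φ X)) (X : Lp (Fin d → ℝ) p P) {ε : ℝ}
    (hε : 0 < ε) :
    ∃ (Y : Ω → Fin d → ℝ) (hY : MemLp Y q P) (c : ℝ), 0 ≤ᵐ[P] Y ∧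
      (∀ᵐ ω ∂P, (P[Y | ℱ t]) ω - w ω ∈ orth (eligible d m)) ∧
      (∀ Z, c - pairing p hY Z ≤ φ Z) ∧ c - pairing p hY X = φ X - ε := by
  have hf : ∀ e ∈ MtPos P ℱ p m t, 0 ≤ pairing p hwq e := fun e he => by
    rw [pairing_apply]
    refine integral_nonneg_of_ae ?_
    have hePos : ∀ᵐ ω ∂P, e ω ∈ eligiblePos d m := he.2.2
    filter_upwards [hwv, hePos] with ω hω hωe using hω _ hωe
  obtain ⟨l, c, hlc, hle, hlX⟩ :=
    exists_affine_le_of_isGLB_image hR hconv hcuc (continuous_pairing hwq) hf hφ X hε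
  obtain ⟨Y, hY, rfl⟩ := exists_eq_pairing (q := q) hlc
  exact ⟨Y, hY, c, ae_nonneg_of_forall_pairing_nonneg hY fun Z => nonneg_of_affine_le hR hφ hle,
    condExp_sub_mem_orth_of_pairing_eq hY hwq hwm fun k => eq_of_affine_le hR hφ hle, hle, hlX⟩

end Minorant

/-! ### Strong duality -/

theorem ae_eq_coe_of_forall_exists_integral {Ω : Type*} {mΩ : MeasurableSpace Ω} {P : Measure Ω}
    {f : Ω → ℝ} (hf : Integrable f P) {G : Ω → EReal} (hG : AEMeasurable G P)
    (hle : G ≤ᵐ[P] fun ω => (f ω : EReal))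
    (happ : ∀ ε : ℝ, 0 < ε → ∃ k : Ω → ℝ, Integrable k P ∧ ∫ ω, f ω ∂P - ε ≤ ∫ ω, k ω ∂P ∧
      (fun ω => (k ω : EReal)) ≤ᵐ[P] G) :
    G =ᵐ[P] fun ω => (f ω : EReal) := by
  obtain ⟨k, hk, -, hkG⟩ := happ 1 one_pos
  have hreal : G =ᵐ[P] fun ω => ((G ω).toReal : EReal) := by
    filter_upwards [hle, hkG] with ω hωf hωk
    exact (EReal.coe_toReal (ne_top_of_le_ne_top (EReal.coe_ne_top _) hωf)
      (ne_bot_of_le_ne_bot (EReal.coe_ne_bot _) hωk)).symm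
  have hle' : (fun ω => (G ω).toReal) ≤ᵐ[P] f := by
    filter_upwards [hle, hreal] with ω hωf hω
    exact EReal.coe_le_coe_iff.1 (hω ▸ hωf)
  have hge : ∀ {k : Ω → ℝ}, (fun ω => (k ω : EReal)) ≤ᵐ[P] G →
      k ≤ᵐ[P] fun ω => (G ω).toReal := fun hkG => by
    filter_upwards [hkG, hreal] with ω hωk hω
    exact EReal.coe_le_coe_iff.1 (hω ▸ hωk)
  have hGI : Integrable (fun ω => (G ω).toReal) P :=
    integrable_of_le_of_le hG.ereal_toReal.aestronglyMeasurable (hge hkG) hle' hk hf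
  have hint : ∫ ω, f ω ∂P ≤ ∫ ω, (G ω).toReal ∂P := le_of_forall_pos_le_add fun ε hε => by
    obtain ⟨k, hk, hkε, hkG⟩ := happ ε hε
    linarith [integral_mono_ae hk hGI (hge hkG)]
  have heq := (integral_eq_iff_of_ae_le hGI hf hle').1
    (le_antisymm (integral_mono_ae hGI hf hle') hint)
  exact hreal.trans (heq.mono fun ω hω => congrArg _ hω)

section StrongDuality

variable {Ω : Type*} {mΩ : MeasurableSpace Ω} {P : Measure Ω} {ι : Type*} [LinearOrder ι]
  {ℱ : Filtration ι mΩ} {d m : ℕ} {p q : ℝ≥0∞} [ENNReal.HolderConjugate p q] {t s : ι}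
  {Y w : Ω → Fin d → ℝ} {R : Lp (Fin d → ℝ) p P → Set (Lp (Fin d → ℝ) p P)}
  {R0 : Ω → Set (Fin d → ℝ)}

theorem integral_dotProduct_neg (hY : MemLp Y q P) (X : Lp (Fin d → ℝ) p P) :
    ∫ ω, Y ω ⬝ᵥ -(X ω) ∂P = -pairing p hY X := by
  simp only [pairing_apply, dotProduct_neg, integral_neg]

theorem ConditionallyConvex.directedOn_condExp_acceptance (hconv : ConditionallyConvex ℱ t R)
    (hY : MemLp Y q P) :
    DirectedOn (· ≤ᵐ[P] ·)
      {f | ∃ Z ∈ acceptance R, f = P[fun ω => Y ω ⬝ᵥ -(Z ω) | ℱ t]} := by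
  refine directedOn_ae_le_of_glue (m' := ℱ t) ?_ ?_
  · rintro _ ⟨Z, -, rfl⟩
    exact stronglyMeasurable_condExp.aestronglyMeasurable
  rintro _ ⟨Z₁, hZ₁, rfl⟩ _ ⟨Z₂, hZ₂, rfl⟩ B hB
  have hI : ∀ X : Lp (Fin d → ℝ) p P, Integrable (fun ω => Y ω ⬝ᵥ -(X ω)) P := fun X =>
    integrable_dotProduct hY (Lp.memLp X).neg
  have hB' : MeasurableSet B := ℱ.le t _ hB
  obtain ⟨Z, hZ⟩ := exists_glue hB' Z₁ Z₂
  have hglue : (fun ω => Y ω ⬝ᵥ -(Z ω)) =ᵐ[P] (B.indicator fun ω => Y ω ⬝ᵥ -(Z₁ ω)) +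
      Bᶜ.indicator fun ω => Y ω ⬝ᵥ -(Z₂ ω) := by
    filter_upwards [hZ] with ω hω
    rw [hω]
    by_cases hωB : ω ∈ B <;> simp [hωB]
  refine ⟨_, ⟨Z, hconv.glue_mem hB hZ₁ hZ₂ hZ (ae_of_all _ fun ω => ?_), rfl⟩, ?_⟩
  · by_cases hωB : ω ∈ B <;> simp [hωB]
  · exact (condExp_congr_ae hglue).trans <|
      (condExp_add ((hI Z₁).indicator hB') ((hI Z₂).indicator hB'.compl) _).trans <|
        (condExp_indicator (hI Z₁) hB).add (condExp_indicator (hI Z₂) hB.compl)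

variable [OrderTop ι] {a b : (Fin d → Measure Ω) × (Ω → Fin d → ℝ)}

theorem splitExpectation_congr (hab : splitDensity P ℱ t s w a b =ᵐ[P] Y)
    (X : Lp (Fin d → ℝ) p P) : splitExpectation ℱ t s w a b X =ᵐ[P]
      fun ω => ((P[fun ω => Y ω ⬝ᵥ -(X ω) | ℱ t] ω : ℝ) : EReal) := by
  have hX : (fun ω => splitDensity P ℱ t s w a b ω ⬝ᵥ -(X ω)) =ᵐ[P] fun ω => Y ω ⬝ᵥ -(X ω) :=
    hab.mono fun ω hω => congrArg (· ⬝ᵥ -(X ω)) hω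
  exact (condExp_congr_ae hX).mono fun ω hω => congrArg _ hω

variable [IsProbabilityMeasure P]

theorem exists_integrable_ge_beta (hconv : ConditionallyConvex ℱ t R)
    (hne : (acceptance R).Nonempty) (hY : MemLp Y q P) (hab : splitDensity P ℱ t s w a b =ᵐ[P] Y)
    {c : ℝ} (hc : ∀ Z ∈ acceptance R, c ≤ pairing p hY Z) :
    ∃ h : Ω → ℝ, Integrable h P ∧ ∫ ω, h ω ∂P ≤ -c ∧
      beta ℱ t s R w a b ≤ᵐ[P] fun ω => (h ω : EReal) := by
  obtain ⟨Z₀, hZ₀⟩ := hne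
  obtain ⟨h, hh, hhc, hle⟩ := exists_integrable_upper_bound (a := -c)
    (F := {f | ∃ Z ∈ acceptance R, f = P[fun ω => Y ω ⬝ᵥ -(Z ω) | ℱ t]}) ⟨_, Z₀, hZ₀, rfl⟩
    (by rintro _ ⟨Z, -, rfl⟩; exact integrable_condExp) (hconv.directedOn_condExp_acceptance hY)
    (by
      rintro _ ⟨Z, hZ, rfl⟩
      rw [integral_condExp (ℱ.le t), integral_dotProduct_neg hY]
      exact neg_le_neg (hc Z hZ))
  refine ⟨h, hh, hhc, (isFamilyEssSup_familyEssSup P _).least _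
    hh.1.aemeasurable.coe_real_ereal ?_⟩
  rintro _ ⟨Z, hZ, rfl⟩
  filter_upwards [splitExpectation_congr hab Z, hle _ ⟨Z, hZ, rfl⟩] with ω hω hωh
  exact hω.trans_le (EReal.coe_le_coe_iff.2 hωh)

theorem exists_jointDual_le_dualValue [Fact (1 ≤ p)] (hℱ : ℱ ⊤ = mΩ) (hts : t ≤ s)
    (hR : IsConditionalRiskMeasure P ℱ p m t R R0) (hconv : ConditionallyConvex ℱ t R)
    (hcuc : ConvexUpperContinuous ℱ m t R)
    (hw : MemLt P ℱ q t (fun _ => dualCone (eligiblePos d m) \ orth (eligible d m)) w)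
    {g : Lp (Fin d → ℝ) p P → Ω → ℝ} (hg : ∀ X, Integrable (g X) P)
    (hgX : ∀ X, scalarization P R w X =ᵐ[P] fun ω => (g X ω : EReal))
    (X : Lp (Fin d → ℝ) p P) {ε : ℝ} (hε : 0 < ε) :
    ∃ z ∈ jointDual ℱ q m t s R w, ∃ k : Ω → ℝ, Integrable k P ∧
      ∫ ω, g X ω ∂P - ε ≤ ∫ ω, k ω ∂P ∧
      (fun ω => (k ω : EReal)) ≤ᵐ[P] dualValue ℱ t s R w z.1 z.2 X := by
  obtain ⟨hwm, hwq, hwv⟩ := hw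
  have hφ : ∀ X, IsGLB (pairing p hwq '' R X) (∫ ω, g X ω ∂P) := fun X =>
    isGLB_pairing_image hconv (hR.subset_eligible X) hwm hwq (hg X) (hgX X)
  obtain ⟨Y, hY, c, hY0, hYw, hle, hX⟩ :=
    exists_pairing_affine_le hR hconv hcuc hwm hwq (hwv.mono fun _ h => h.1) hφ X hε
  obtain ⟨a, ha, b, hb, hab⟩ := exists_splitDensity_ae_eq (p := p) hℱ
    (ENNReal.HolderConjugate.one_le q p) hts ⟨hwm, hwq, hwv.mono fun _ h => h.2⟩ hY hY0 hYw
  have hacc : ∀ Z ∈ acceptance R, c ≤ pairing p hY Z := fun Z hZ => by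
    have hφZ := (hφ Z).1 ⟨0, hZ, map_zero _⟩
    linarith [hle Z]
  obtain ⟨u, hu⟩ := hR.nonempty_zero
  obtain ⟨h, hh, hhc, hβ⟩ :=
    exists_integrable_ge_beta hconv ⟨_, add_mem_acceptance hR hu⟩ hY hab hacc
  refine ⟨(a, b), ⟨ha, hb, ?_⟩, fun ω => -h ω + (P[fun ω => Y ω ⬝ᵥ -(X ω) | ℱ t]) ω,
    hh.neg.add integrable_condExp, ?_, ?_⟩
  · exact (lintegral_mono_ae (hβ.mono fun _ => EReal.toENNReal_le_toENNReal)).trans_lt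
      hh.lintegral_lt_top
  · rw [integral_add hh.fun_neg integrable_condExp, integral_neg, integral_condExp (ℱ.le t),
      integral_dotProduct_neg hY]
    linarith
  · filter_upwards [hβ, splitExpectation_congr hab X] with ω hβω hω
    rw [dualValue, hω, EReal.coe_add, EReal.coe_neg]
    exact add_le_add_left (EReal.neg_le_neg_iff.2 hβω) _

theorem scalarization_ae_eq_of_dualValue_le [Fact (1 ≤ p)] (hℱ : ℱ ⊤ = mΩ) (hts : t ≤ s)
    (hR : IsConditionalRiskMeasure P ℱ p m t R R0) (hnorm : Normalized R)
    (hconv : ConditionallyConvex ℱ t R) (hcuc : ConvexUpperContinuous ℱ m t R)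
    (hint : IntegrableScalarizations P ℱ q m t R R0)
    (hw : MemLt P ℱ q t (fun _ => dualCone (eligiblePos d m) \ orth (eligible d m)) w)
    {X : Lp (Fin d → ℝ) p P} {G : Ω → EReal} (hG : AEMeasurable G P)
    (hle : G ≤ᵐ[P] scalarization P R w X)
    (hdual : ∀ z ∈ jointDual ℱ q m t s R w, dualValue ℱ t s R w z.1 z.2 X ≤ᵐ[P] G) :
    scalarization P R w X =ᵐ[P] G := by
  choose g hg hgX using hint w (memLt_dualCone hR hnorm hconv hcuc hw)
  refine (hgX X).trans (ae_eq_coe_of_forall_exists_integral (hg X) hG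
    (hle.trans (hgX X).le) fun ε hε => ?_).symm
  obtain ⟨z, hz, k, hk, hkε, hkz⟩ :=
    exists_jointDual_le_dualValue hℱ hts hR hconv hcuc hw hg hgX X hε
  exact ⟨k, hk, hkε, hkz.trans (hdual z hz)⟩

end StrongDuality

end RiskMeasure

theorem proposition3p7
    {Ω : Type*} {mΩ : MeasurableSpace Ω} (P : Measure Ω) [IsProbabilityMeasure P]
    {ι : Type*} [LinearOrder ι] [OrderTop ι] (ℱ : Filtration ι mΩ) (hℱ : ℱ ⊤ = mΩ)
    (p q : ℝ≥0∞) [Fact (1 ≤ p)] [ENNReal.HolderConjugate p q]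
    (d m : ℕ) (hm : 1 ≤ m) (hmd : m ≤ d) (t s : ι) (hts : t ≤ s)
    (R : Lp (Fin d → ℝ) p P → Set (Lp (Fin d → ℝ) p P)) (R0 : Ω → Set (Fin d → ℝ))
    (hR : RiskMeasure.IsConditionalRiskMeasure P ℱ p m t R R0)
    (hnorm : RiskMeasure.Normalized R)
    (hconv : RiskMeasure.ConditionallyConvex ℱ t R)
    (hcuc : RiskMeasure.ConvexUpperContinuous ℱ m t R)
    (hint : RiskMeasure.IntegrableScalarizations P ℱ q m t R R0)
    (w : Ω → Fin d → ℝ)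
    (hw : RiskMeasure.MemLt P ℱ q t
      (fun _ => RiskMeasure.dualCone (RiskMeasure.eligiblePos d m) \
        RiskMeasure.orth (RiskMeasure.eligible d m)) w)
    (X : Lp (Fin d → ℝ) p P) :
    (RiskMeasure.scalarization P R w X =ᵐ[P]
      familyEssSup P {f | ∃ a ∈ RiskMeasure.steppedDual P ℱ p q m t s w,
        f = familyEssSup P
          {g | ∃ b ∈ RiskMeasure.terminalDual P ℱ p q m s
              (RiskMeasure.wStep P ℱ t s a.1 (w + a.2)),
            g = RiskMeasure.dualValue ℱ t s R w a b X}}) ∧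
    (RiskMeasure.scalarization P R w X =ᵐ[P]
      familyEssSup P {f | ∃ c ∈ RiskMeasure.jointDual ℱ q m t s R w,
        f = RiskMeasure.dualValue ℱ t s R w c.1 c.2 X}) := by
  have hρ : AEMeasurable (RiskMeasure.scalarization P R w X) P :=
    RiskMeasure.measurable_scalarization.aemeasurable
  have hweak : ∀ {a b}, a ∈ RiskMeasure.steppedDual P ℱ p q m t s w →
      b ∈ RiskMeasure.terminalDual P ℱ p q m s (RiskMeasure.wStep P ℱ t s a.1 (w + a.2)) →
      RiskMeasure.dualValue ℱ t s R w a b X ≤ᵐ[P] RiskMeasure.scalarization P R w X :=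
    fun ha hb => RiskMeasure.dualValue_le_scalarization hR hts ha hb X
  have hsup := isFamilyEssSup_familyEssSup (Ω := Ω) P
  constructor <;> refine RiskMeasure.scalarization_ae_eq_of_dualValue_le hℱ hts hR hnorm hconv hcuc
    hint hw (hsup _).measurable.aemeasurable ((hsup _).least _ hρ ?_) fun z hz => ?_
  · rintro _ ⟨a, ha, rfl⟩
    refine (hsup _).least _ hρ ?_
    rintro _ ⟨b, hb, rfl⟩
    exact hweak ha hb
  · refine EventuallyLE.trans ?_ ((hsup _).upper _ ⟨z.1, hz.1, rfl⟩)
    exact (hsup _).upper _ ⟨z.2, hz.2.1, rfl⟩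
  · rintro _ ⟨z, hz, rfl⟩
    exact hweak hz.1 hz.2.1
  · exact (hsup _).upper _ ⟨z, hz, rfl⟩
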